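/- **Setting.** Let $\Delta$ be a finite simplicial complex of dimension 4 such that every simplex lies in a 4-simplex, every tetrahedron lies in exactly two 4-simplices, and any two 4-simplices containing a common simplex $\rho$ (including $\rho=\emptyset$) can be joined by a chain of 4-simplices containing $\rho$ in which consecutive ones share a tetrahedron containing $\rho$ (e.g. a triangulated closed connected 4-manifold). Assume $\Delta$ is orientable and fix a global orientation. The dual complex $\Delta^*$ has as vertices $v$, edges $e$, faces $f$ the 4-simplices, tetrahedra and triangles of $\Delta$, with reversed incidence. The five edges $e$ of $\Delta^*$ at $v$ correspond to the vertices $p$ of the 4-simplex $v^*$ ($e^*$ is obtained by deleting $p$), so an edge $[pq]$ of $v^*$ is also labelled by a pair $(e,e')$, and $[e_1\ldots e_5]$ always denotes a positively oriented ordering of the edges at $v$. Each face $f$ of $\Delta^*$ is given an arbitrary orientation; $\epsilon_{ef}(v)=1$ if $f$ runs from $e$ to $v$, and $-1$ if it runs from $v$ to $e$. For a bivector (antisymmetric $4\times4$ matrix) $X^{IJ}$ put $(\star X)_{IJ}=\frac12\epsilon_{IJKL}X^{KL}$, $|X|^2=\frac12X_{IJ}X^{IJ}$, $X^{\pm}_i=\frac12\epsilon_i{}^{jk}X_{jk}\pm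 X_{0i}$, $(a\wedge b)^{IJ}=a^Ib^J-b^Ia^J$ and $g\triangleright X=gXg^{T}$ for $g\in SO(4)$; bivectors are identified with pairs $(X^+,X^-)$, $X^\pm=X^\pm_i\sigma_i$. A *configuration* $(j_f,n_{ef},u_e,g_{ev},h_{ef})$ consists of real numbers $j_f\ge 0$, $n_{ef},u_e\in SU(2)$ and $g_{ev},h_{ef}\in SO(4)$ for incident pairs, with $g_{ve}=g_{ev}^{-1}$, $h_{fe}=h_{ef}^{-1}$. Define $\hat U_e\in\mathbb R^4$ by $u_e=\hat U_e^0\mathbb 1+i\hat U_e^i\sigma_i$, and define bivectors by the simplicity condition $$X_{ef}^+=j_f\,n_{ef}\sigma_3n_{ef}^{-1},\qquad X_{ef}^-=-j_f\,u_en_{ef}\sigma_3n_{ef}^{-1}u_e^{-1}.$$ Put $X_{ef}(v)=g_{ve}\triangleright X_{ef}$, $\hat U_e(v)=g_{ve}\hat U_e$, $g_{v'v}=g_{v'e}g_{ev}$ for $e=(vv')$, and $G_{ef}(v)=g_{ve}\,(g_{ev}g_{ve'}h_{e'f}h_{fe})\,g_{ev}$ if $e,e'$ are consecutive edges at $v$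 in the orientation of $f$. The configuration is a *solution* if $$G_{ef}(v)\triangleright X_{ef}(v)=X_{ef}(v),\quad X_{ef}(v')=g_{v'v}\triangleright X_{ef}(v),\quad \hat U_e(v')=g_{v'v}\hat U_e(v),$$ $$X_{ef}(v)=X_{e'f}(v),\qquad \sum_{f\supset e}\epsilon_{ef}(v)X_{ef}(v)=0 ,$$ and it is *non-degenerate* if $X_{ef}(v)\wedge X_{e'f'}(v)\ne0$ for all wedges at a common vertex whose faces $f,f'$ do not share an edge. For edges $e\neq e'$ at $v$ with common face $f$ put $X_{ee'}(v)=\epsilon_{ef}(v)X_{ef}(v)$. A *co-tetrad* $E$ assigns to each $v$ and each oriented edge $\ell=[pq]$ of $v^*$ a vector $E_\ell(v)\in\mathbb R^4$ with $E_{-\ell}=-E_\ell$, $E_{\ell_1}+E_{\ell_2}+E_{\ell_3}=0$ around triangles, and $E_{\ell_1}(v')\cdot E_{\ell_2}(v')=E_{\ell_1}(v)\cdot E_{\ell_2}(v)$ for edges $\ell_1,\ell_2$ of the tetrahedron common to $v^*$ and $v'^*$. It is *non-degenerate* if for each $v$ the vectors $E_\ell(v)$, $\ell\subset v^*$, span $\mathbb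 R^4$. Its *tetrad* $U$ is given by $U_e(v)\cdot E_{e''e'}(v)=\delta_{e''e}-\delta_{e'e}$, its *spin connection* $\Omega_{v'v}\in SO(4)$ by $\Omega_{v'v}E_\ell(v)=E_\ell(v')$ for $\ell\subset e^*$, $e=(vv')$, and $V_4(v)=\det(E_{e_2e_1}(v),\ldots,E_{e_5e_1}(v))$. Spins $j_f$ are *Regge-like* (in units with area $=\kappa j$) if there are edge lengths on $\Delta$, realizable on each 4-simplex by a non-degenerate Euclidean simplex, such that $\kappa j_f$ is the area of the triangle $f^*$ for all $f$. **Proposition.** (1) Let $(j_f,n_{ef},u_e,g_{ev},h_{ef})$ be a non-degenerate solution. Then there are a sign $\epsilon=\pm1$ and a non-degenerate co-tetrad $E$ such that $$X_{e_4e_5}(v)=\epsilon\star\big(E_{e_1e_2}(v)\wedge E_{e_2e_3}(v)\big)$$ for all $v$ and all $[e_1\ldots e_5]$ at $v$; $\epsilon$ is unique and $E$ is unique up to inversions $E_\ell(v)\to s_vE_\ell(v)$, $\ell\subset v^*$, with arbitrary signs $s_v=\pm1$. Moreover, with $U$ and $\Omega$ the tetrad and spin connection of $E$: * $X_{ee'}(v)=\epsilon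 V_4(v)\,U_e(v)\wedge U_{e'}(v)$ for any two edges $e\ne e'$ at $v$; * $j_f=|\star X_{ef}(v)|=|E_{\ell_1}(v)\wedge E_{\ell_2}(v)|$ for two different edges $\ell_1,\ell_2$ of the triangle $f^*$. Thus $\frac12j_f$ is the area of $f^*$ in the discrete metric with edge lengths $|E_\ell(v)|$, which do not depend on $v$; consequently the spins are Regge-like for every $\kappa>0$; * there are signs $\epsilon_e=\pm1$ with $g_{v'v}=\epsilon_e\Omega_{v'v}$ for all $e=(vv')$; * $u_e=\pm|U_e(v)|^{-1}\big((g_{ev}U_e(v))^0\mathbb 1+i(g_{ev}U_e(v))^i\sigma_i\big)$; * $n_{ef}\sigma_3n_{ef}^{-1}=N_{ef}^i\sigma_i$ with $j_fN_{ef}^i=\epsilon V_4(v)\big(g_{ev}\triangleright(U_e(v)\wedge U_{e'}(v))\big)^{+i}$ for $e,e'$ consecutive edges of $f$ at $v$; this fixes $n_{ef}$ up to $n_{ef}\to n_{ef}e^{i\varphi\sigma_3}$. (2) For any configuration, any sign $\epsilon$ and any non-degenerate co-tetrad $E$ with tetrad $U$, the formula for $X_{e_4e_5}(v)$ in terms of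 $E$ (for all $v$, $[e_1\ldots e_5]$) is equivalent to the formula $X_{ee'}(v)=\epsilon V_4(v)U_e(v)\wedge U_{e'}(v)$ (for all $v$, $e\ne e'$). (3) Conversely, every non-degenerate co-tetrad $E$ has exactly one tetrad $U$ and exactly one spin connection $\Omega$, and for every choice of signs $\epsilon$ and $(\epsilon_e)_e$ there exist $j_f,n_{ef},u_e,g_{ev}$ satisfying the formulas $j_f=|E_{\ell_1}(v)\wedge E_{\ell_2}(v)|$, $g_{v'v}=\epsilon_e\Omega_{v'v}$ and those for $u_e$ and $n_{ef}$ in (1). For any such $j_f,n_{ef},u_e,g_{ev}$ there are $h_{ef}$ such that $(j_f,n_{ef},u_e,g_{ev},h_{ef})$ is a non-degenerate solution, and its bivectors are given by the formulas of (1) in terms of $E$ and $U$. -/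

import Mathlib

open Matrix

noncomputable section

namespace SpinFoam

/-! ### Linear algebra in Euclidean `ℝ⁴`

Vectors are functions `Fin 4 → ℝ` with the Euclidean scalar product `⬝ᵥ`; bivectors are
antisymmetric `4 × 4` matrices `X^{IJ}`. -/

/-- Vectors of Euclidean `ℝ⁴`. -/
abbrev Vec : Type := Fin 4 → ℝ

/-- Matrices `X^{IJ}`, among them the bivectors. -/
abbrev Biv : Type := Matrix (Fin 4) (Fin 4) ℝ

/-- The group `SU(2)`. -/
abbrev SU2 : Type := Matrix.specialUnitaryGroup (Fin 2) ℂ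

/-- The group `SO(4)`. -/
abbrev SO4 : Type := Matrix.specialOrthogonalGroup (Fin 4) ℝ

/-- Euclidean length of a vector. -/
def len (x : Vec) : ℝ := Real.sqrt (x ⬝ᵥ x)

/-- The totally antisymmetric symbol with `ε_{0123} = 1`. -/
def leviCivita (i j k l : Fin 4) : ℝ :=
  Matrix.det (Matrix.of fun a b : Fin 4 => if ![i, j, k, l] a = b then (1 : ℝ) else 0)

/-- `(x ∧ y)^{IJ} = x^I y^J - y^I x^J`. -/
def wedge (x y : Vec) : Biv := Matrix.vecMulVec x y - Matrix.vecMulVec y x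

/-- Hodge dual `(⋆X)_{IJ} = ½ ε_{IJKL} X^{KL}`. -/
def hodge (X : Biv) : Biv :=
  Matrix.of fun i j => (1 / 2) * ∑ k, ∑ l, leviCivita i j k l * X k l

/-- The scalar `ε_{IJKL} X^{IJ} Y^{KL}` that represents the 4-form `X ∧ Y`. -/
def wedge4 (X Y : Biv) : ℝ := ∑ i, ∑ j, ∑ k, ∑ l, leviCivita i j k l * X i j * Y k l

/-- Norm of a bivector, `|X|² = ½ X_{IJ} X^{IJ}`; for `X = x ∧ y` it is the area of the
parallelogram spanned by `x` and `y`. -/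
def bivNorm (X : Biv) : ℝ := Real.sqrt ((1 / 2) * ∑ i, ∑ j, X i j ^ 2)

/-- The action `g ▷ X` of `SO(4)` on bivectors. -/
def act (g : SO4) (X : Biv) : Biv := (g : Matrix (Fin 4) (Fin 4) ℝ) * X * (g : Matrix _ _ ℝ)ᵀ

/-- The self-dual part `X⁺_i = ½ ε_i^{jk} X_{jk} + X_{0i}` of a bivector. -/
def plusPart (X : Biv) : Fin 3 → ℝ := ![X 2 3 + X 0 1, X 3 1 + X 0 2, X 1 2 + X 0 3]

/-- The anti-self-dual part `X⁻_i = ½ ε_i^{jk} X_{jk} - X_{0i}` of a bivector. -/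
def minusPart (X : Biv) : Fin 3 → ℝ := ![X 2 3 - X 0 1, X 3 1 - X 0 2, X 1 2 - X 0 3]

/-- The bivector with self-dual part `a` and anti-self-dual part `b`. -/
def ofParts (a b : Fin 3 → ℝ) : Biv :=
  (1 / 2 : ℝ) •
    !![0, a 0 - b 0, a 1 - b 1, a 2 - b 2;
       b 0 - a 0, 0, a 2 + b 2, -(a 1 + b 1);
       b 1 - a 1, -(a 2 + b 2), 0, a 0 + b 0;
       b 2 - a 2, a 1 + b 1, -(a 0 + b 0), 0]

theorem plusPart_ofParts (a b : Fin 3 → ℝ) : plusPart (ofParts a b) = a := by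
  ext i
  fin_cases i <;> simp [plusPart, ofParts] <;> ring

theorem minusPart_ofParts (a b : Fin 3 → ℝ) : minusPart (ofParts a b) = b := by
  ext i
  fin_cases i <;> simp [minusPart, ofParts] <;> ring

/-! ### Pauli matrices -/

/-- The Pauli matrices `σ₁, σ₂, σ₃` (indexed by `0, 1, 2`). -/
def pauli : Fin 3 → Matrix (Fin 2) (Fin 2) ℂ :=
  ![!![0, 1; 1, 0], !![0, -Complex.I; Complex.I, 0], !![1, 0; 0, -1]]

/-- `N^i σ_i`. -/
def pauliVec (N : Fin 3 → ℝ) : Matrix (Fin 2) (Fin 2) ℂ := ∑ i, (N i : ℂ) • pauli i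

/-- The components `M^i` of a matrix `M = M^i σ_i`. -/
def pauliCoord (M : Matrix (Fin 2) (Fin 2) ℂ) : Fin 3 → ℝ :=
  fun i => (Matrix.trace (M * pauli i)).re / 2

theorem pauliCoord_pauliVec (N : Fin 3 → ℝ) : pauliCoord (pauliVec N) = N := by
  ext i
  fin_cases i <;>
    simp [pauliCoord, pauliVec, pauli, Fin.sum_univ_three, Matrix.trace, Fin.sum_univ_two]


/-- `n σ₃ n⁻¹`. -/
def conjSigma (n : SU2) : Matrix (Fin 2) (Fin 2) ℂ :=
  (n : Matrix (Fin 2) (Fin 2) ℂ) * pauli 2 * ((n⁻¹ : SU2) : Matrix (Fin 2) (Fin 2) ℂ)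

/-- The matrix `x⁰ 𝟙 + i x^i σ_i`. -/
def quat (x : Vec) : Matrix (Fin 2) (Fin 2) ℂ :=
  (x 0 : ℂ) • (1 : Matrix (Fin 2) (Fin 2) ℂ) + Complex.I • pauliVec ![x 1, x 2, x 3]

/-- The vector `Û` with `u = Û⁰ 𝟙 + i Û^i σ_i`. -/
def unitVec (u : Matrix (Fin 2) (Fin 2) ℂ) : Vec :=
  ![(Matrix.trace u).re / 2, (Matrix.trace (u * pauli 0)).im / 2,
    (Matrix.trace (u * pauli 1)).im / 2, (Matrix.trace (u * pauli 2)).im / 2]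

theorem unitVec_quat (x : Vec) : unitVec (quat x) = x := by
  ext i
  fin_cases i <;>
    simp [unitVec, quat, pauliVec, pauli, Fin.sum_univ_three, Matrix.trace, Fin.sum_univ_two,
      Matrix.mul_apply]

/-! ### The simplicial complex `Δ` and its dual -/

/-- A finite, closed, connected 4-dimensional simplicial complex `Δ` that has a dual cell complex:
every simplex lies in a 4-simplex, every tetrahedron lies in exactly two 4-simplices, and any two
4-simplices that contain a common simplex `ρ` (or `ρ = ∅`) are joined by a chain of 4-simplices
that contain `ρ`, in which consecutive ones share a tetrahedron that contains `ρ`. -/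
structure Triangulation (P : Type*) [DecidableEq P] extends PreAbstractSimplicialComplex P where
  finite : faces.Finite
  nonempty : faces.Nonempty
  pure : ∀ s ∈ faces, ∃ σ ∈ faces, σ.card = 5 ∧ s ⊆ σ
  closed : ∀ τ ∈ faces, τ.card = 4 → {σ | σ ∈ faces ∧ σ.card = 5 ∧ τ ⊆ σ}.ncard = 2
  connected : ∀ (ρ σ σ' : Finset P), σ ∈ faces → σ.card = 5 → ρ ⊆ σ →
    σ' ∈ faces → σ'.card = 5 → ρ ⊆ σ' →
    Relation.ReflTransGen
      (fun a b => b ∈ faces ∧ b.card = 5 ∧ ρ ⊆ b ∧ (a ∩ b).card = 4) σ σ'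

namespace Triangulation

variable {P : Type*} [DecidableEq P] (Δ : Triangulation P)

/-- Simplices of `Δ` with `k` vertices. -/
def Cell (k : ℕ) : Type _ := {s : Finset P // s ∈ Δ.faces ∧ s.card = k}

/-- Vertices `v` of `Δ*`, i.e. 4-simplices of `Δ`. -/
abbrev Vert : Type _ := Δ.Cell 5

/-- Edges `e` of `Δ*`, i.e. tetrahedra of `Δ`. -/
abbrev Edge : Type _ := Δ.Cell 4

/-- Faces `f` of `Δ*`, i.e. triangles of `Δ`. -/
abbrev Face : Type _ := Δ.Cell 3

variable {Δ}

/-- The set of vertices of a simplex. Incidence in `Δ*` is reversed inclusion: `e` is an edge at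
the vertex `v` iff `e.verts ⊆ v.verts`, and `e` lies in the boundary of the face `f` iff
`f.verts ⊆ e.verts`. -/
def Cell.verts {k : ℕ} (s : Δ.Cell k) : Finset P := s.1

/-- The simplex opposite to one of the vertices of a simplex. -/
def Cell.opp {k : ℕ} (s : Δ.Cell (k + 2)) (p : s.verts) : Δ.Cell (k + 1) :=
  ⟨s.verts.erase p, by
    have hc : (s.verts.erase p).card = k + 1 := by
      rw [Finset.card_erase_of_mem p.2, Cell.verts, s.2.2]; rfl
    refine ⟨?_, hc⟩
    exact (Δ.isRelLowerSet_faces s.2.1).2 (Finset.erase_subset _ _)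
      (Finset.card_pos.1 (by omega))⟩

/-- The edge of `Δ*` at `v` that corresponds to the vertex `p` of the 4-simplex `v`: the
tetrahedron obtained by deleting `p`. -/
abbrev edgeAt (v : Δ.Vert) (p : v.verts) : Δ.Edge := Cell.opp (k := 3) v p

/-- The face at `v` that contains the edges `e`, `e'` opposite to `p`, `q`. -/
def faceAt (v : Δ.Vert) (p q : v.verts) (h : p ≠ q) : Δ.Face :=
  Cell.opp (k := 2) (edgeAt v p)
    ⟨q, Finset.mem_erase.2 ⟨fun hq => h (Subtype.ext hq.symm), q.2⟩⟩

/-- Inclusion of the vertices of a tetrahedron into those of a 4-simplex. -/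
def incl {e : Δ.Edge} {v : Δ.Vert} (h : e.verts ⊆ v.verts) (p : e.verts) : v.verts := ⟨p, h p.2⟩

variable (Δ)

/-- An ordering `[p₁, …, p₅]` of the vertices of the 4-simplex `v` (equivalently
`[e₁, …, e₅]` of the edges of `Δ*` at `v`). -/
abbrev Ordering (v : Δ.Vert) : Type _ := Fin 5 ≃ v.verts

/-- A global orientation of `Δ`: a sign for each ordering of each 4-simplex, changing by the sign of
permutations, such that neighbouring 4-simplices are consistently oriented: if `[p₀,p₁,…,p₄]` is
positive then `[p₀',p₁,…,p₄]` is negative. -/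
structure Orientation where
  sgn : ∀ v : Δ.Vert, Δ.Ordering v → ℤˣ
  perm : ∀ (v : Δ.Vert) (p : Δ.Ordering v) (π : Equiv.Perm (Fin 5)),
    sgn v (π.trans p) = Equiv.Perm.sign π * sgn v p
  consistent : ∀ (v v' : Δ.Vert) (p : Δ.Ordering v) (p' : Δ.Ordering v'), v ≠ v' →
    (∀ i : Fin 5, i ≠ 0 → (p i : P) = p' i) → sgn v' p' = - sgn v p

/-- A choice of orientation (sense of circulation of the boundary) for every face `f` of `Δ*`,
given by `ε_{ef}(v)`: it is `1` if `f` is oriented consistently with the half-edge from `e` to `v`,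
and `-1` if `f` runs from `v` to `e`. -/
structure FaceOrientation where
  eps : Δ.Edge → Δ.Face → Δ.Vert → ℤˣ
  flip_edge : ∀ (f : Δ.Face) (e e' : Δ.Edge) (v : Δ.Vert), f.verts ⊆ e.verts → f.verts ⊆ e'.verts →
    e.verts ⊆ v.verts → e'.verts ⊆ v.verts → e ≠ e' → eps e' f v = - eps e f v
  flip_vert : ∀ (f : Δ.Face) (e : Δ.Edge) (v v' : Δ.Vert), f.verts ⊆ e.verts →
    e.verts ⊆ v.verts → e.verts ⊆ v'.verts → v ≠ v' → eps e f v' = - eps e f v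

/-! ### Co-tetrads, tetrads, spin connection -/

/-- Families `E_ℓ(v)`: for every 4-simplex `v` and vertices `p`, `q` of it, the vector of the
oriented edge `ℓ = [p q]`. In dual notation `E v p q = E_{ee'}(v)` with `e`, `e'` the edges of `Δ*`
at `v` opposite to `p`, `q`. -/
abbrev EdgeVectors : Type _ := ∀ v : Δ.Vert, v.verts → v.verts → Vec

/-- Families `U_e(v)`: `U v p = U_e(v)` for the edge `e` at `v` opposite to `p`. -/
abbrev NormalVectors : Type _ := ∀ v : Δ.Vert, v.verts → Vec

variable {Δ}

/-- Co-tetrads on `Δ`. -/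
structure IsCotetrad (E : Δ.EdgeVectors) : Prop where
  antisymm : ∀ v p q, E v q p = - E v p q
  closure : ∀ v p q r, E v p q + E v q r + E v r p = 0
  metric : ∀ (v v' : Δ.Vert) (e : Δ.Edge) (h : e.verts ⊆ v.verts) (h' : e.verts ⊆ v'.verts)
    (p q r s : e.verts),
    E v' (incl h' p) (incl h' q) ⬝ᵥ E v' (incl h' r) (incl h' s)
      = E v (incl h p) (incl h q) ⬝ᵥ E v (incl h r) (incl h s)

/-- Non-degeneracy: in each 4-simplex the edge vectors span `ℝ⁴`. -/
def CotetradNondegenerate (E : Δ.EdgeVectors) : Prop :=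
  ∀ v : Δ.Vert, Submodule.span ℝ (Set.range fun pq : v.verts × v.verts => E v pq.1 pq.2) = ⊤

/-- `U` is the tetrad associated with the co-tetrad `E`:
`U_e · E_{e''e'} = δ_{e''e} - δ_{e'e}`. -/
def IsTetrad (E : Δ.EdgeVectors) (U : Δ.NormalVectors) : Prop :=
  ∀ (v : Δ.Vert) (p q r : v.verts),
    U v p ⬝ᵥ E v q r = (if q = p then 1 else 0) - (if r = p then 1 else 0)

/-- `Ω` (where `Ω v' v` is the parallel transport from `v` to a neighbour `v'`) is the spin
connection of `E`: `E_ℓ(v') = Ω_{v'v} E_ℓ(v)` for all edges `ℓ` of the common tetrahedron. -/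
def IsSpinConnection (E : Δ.EdgeVectors) (Ω : Δ.Vert → Δ.Vert → SO4) : Prop :=
  ∀ (v v' : Δ.Vert) (e : Δ.Edge) (h : e.verts ⊆ v.verts) (h' : e.verts ⊆ v'.verts), v ≠ v' →
    ∀ p q : e.verts,
      (Ω v' v : Matrix (Fin 4) (Fin 4) ℝ) *ᵥ E v (incl h p) (incl h q)
        = E v' (incl h' p) (incl h' q)

/-- `V₄(v) = det (E_{e₂e₁}, E_{e₃e₁}, E_{e₄e₁}, E_{e₅e₁})`, for an ordering of the edges at `v`. -/
def vol4 (E : Δ.EdgeVectors) (v : Δ.Vert) (p : Δ.Ordering v) : ℝ :=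
  Matrix.det (Matrix.of ![E v (p 1) (p 0), E v (p 2) (p 0), E v (p 3) (p 0), E v (p 4) (p 0)])

/-! ### Discrete metrics and Regge-like spins -/

/-- A discrete metric: lengths `l p q` of the edges of `Δ` for which every 4-simplex can be
realized as a non-degenerate simplex in Euclidean `ℝ⁴`. -/
def IsDiscreteMetric (Δ : Triangulation P) (l : P → P → ℝ) : Prop :=
  ∀ v : Δ.Vert, ∃ x : v.verts → Vec, AffineIndependent ℝ x ∧
    ∀ p q : v.verts, l p q = len (x p - x q)

/-- Area of a triangle with side lengths `a`, `b`, `c` (Heron's formula). -/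
def triangleArea (a b c : ℝ) : ℝ :=
  Real.sqrt ((a + b + c) / 2 * ((a + b + c) / 2 - a) * ((a + b + c) / 2 - b) *
    ((a + b + c) / 2 - c))

/-- The numbers `a f` are the areas of the triangles dual to `f` in the metric `l`. -/
def IsAreaOf (a : Δ.Face → ℝ) (l : P → P → ℝ) : Prop :=
  ∀ (f : Δ.Face) (p q r : P), f.verts = {p, q, r} → a f = triangleArea (l p q) (l q r) (l r p)

/-- The spins are Regge-like, areas being measured in units in which `area = κ * spin`. -/
def IsReggeLike (κ : ℝ) (j : Δ.Face → ℝ) : Prop :=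
  ∃ l : P → P → ℝ, IsDiscreteMetric Δ l ∧ IsAreaOf (fun f => κ * j f) l

variable (Δ)

/-! ### Configurations and the equations -/

/-- A configuration `(j_f, n_{ef}, u_e, g_{ev}, h_{ef})`; the connection variables are projected to
`SO(4)`. Only the values at incident pairs matter. -/
structure Config where
  j : Δ.Face → ℝ
  j_nonneg : ∀ f, 0 ≤ j f
  n : Δ.Edge → Δ.Face → SU2
  u : Δ.Edge → SU2
  g : Δ.Edge → Δ.Vert → SO4
  h : Δ.Edge → Δ.Face → SO4

end Triangulation

namespace Triangulation.Config

variable {P : Type*} [DecidableEq P] {Δ : Triangulation P} (c : Δ.Config)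

/-- The bivector `X_{ef}` based at `e`, given by the simplicity condition
`X⁺ = j n σ₃ n⁻¹`, `X⁻ = - j u n σ₃ n⁻¹ u⁻¹`. -/
def bivEdge (e : Δ.Edge) (f : Δ.Face) : Biv :=
  ofParts (c.j f • pauliCoord (conjSigma (c.n e f)))
    (-(c.j f • pauliCoord (conjSigma (c.u e * c.n e f))))

/-- `X_{ef}(v) = g_{ve} ▷ X_{ef}`, where `g_{ve} = g_{ev}⁻¹`. -/
def biv (e : Δ.Edge) (f : Δ.Face) (v : Δ.Vert) : Biv := act (c.g e v)⁻¹ (c.bivEdge e f)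

/-- `Û_e(v) = g_{ve} Û_e`, with `u_e = Û_e⁰ 𝟙 + i Û_e^i σ_i`. -/
def unitNormal (e : Δ.Edge) (v : Δ.Vert) : Vec :=
  (((c.g e v)⁻¹ : SO4) : Matrix (Fin 4) (Fin 4) ℝ) *ᵥ unitVec (c.u e : Matrix (Fin 2) (Fin 2) ℂ)

/-- `g_{v'v} = g_{v'e} g_{ev}` for the edge `e = (v v')`. -/
def transport (e : Δ.Edge) (v' v : Δ.Vert) : SO4 := (c.g e v')⁻¹ * c.g e v

/-- The wedge holonomy `G_{ef}(v) = g_{ve} G_{ef} g_{ev}`, `G_{ef} = g_{ev} g_{ve'} h_{e'f} h_{fe}`,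
of the wedge `[e v e' f]`. -/
def wedgeHol (e e' : Δ.Edge) (f : Δ.Face) (v : Δ.Vert) : SO4 :=
  (c.g e v)⁻¹ * (c.g e v * (c.g e' v)⁻¹ * c.h e' f * (c.h e f)⁻¹) * c.g e v

/-- The system of equations: the wedge holonomies fix the bivectors (maximality), the
parallel transport of `X` and `Û` between neighbouring vertices, the interior and the exterior
closure constraint. -/
structure IsSolution (w : Δ.FaceOrientation) : Prop where
  holonomy : ∀ (e e' : Δ.Edge) (f : Δ.Face) (v : Δ.Vert),
    f.verts ⊆ e.verts → f.verts ⊆ e'.verts → e.verts ⊆ v.verts → e'.verts ⊆ v.verts → e ≠ e' →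
    w.eps e f v = 1 → act (c.wedgeHol e e' f v) (c.biv e f v) = c.biv e f v
  transport_biv : ∀ (e : Δ.Edge) (f : Δ.Face) (v v' : Δ.Vert),
    f.verts ⊆ e.verts → e.verts ⊆ v.verts → e.verts ⊆ v'.verts → v ≠ v' →
    c.biv e f v' = act (c.transport e v' v) (c.biv e f v)
  transport_normal : ∀ (e : Δ.Edge) (v v' : Δ.Vert),
    e.verts ⊆ v.verts → e.verts ⊆ v'.verts → v ≠ v' →
    c.unitNormal e v' = (c.transport e v' v : Matrix (Fin 4) (Fin 4) ℝ) *ᵥ c.unitNormal e v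
  interior : ∀ (e e' : Δ.Edge) (f : Δ.Face) (v : Δ.Vert),
    f.verts ⊆ e.verts → f.verts ⊆ e'.verts → e.verts ⊆ v.verts → e'.verts ⊆ v.verts →
    c.biv e f v = c.biv e' f v
  exterior : ∀ (e : Δ.Edge) (v : Δ.Vert), e.verts ⊆ v.verts →
    ∑ p : e.verts, w.eps e (Cell.opp (k := 2) e p) v • c.biv e (Cell.opp (k := 2) e p) v = 0

/-- Non-degeneracy: `X_{ef}(v) ∧ X_{e'f'}(v) ≠ 0` for all wedges at a common vertex whose faces do
not share an edge. -/
def Nondegenerate : Prop :=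
  ∀ (v : Δ.Vert) (e e' : Δ.Edge) (f f' : Δ.Face),
    f.verts ⊆ e.verts → e.verts ⊆ v.verts → f'.verts ⊆ e'.verts → e'.verts ⊆ v.verts →
    (¬ ∃ e'' : Δ.Edge, f.verts ⊆ e''.verts ∧ f'.verts ⊆ e''.verts) →
    wedge4 (c.biv e f v) (c.biv e' f' v) ≠ 0

/-- `X_{ee'}(v)` for the edges `e`, `e'` at `v` opposite to `p`, `q`. It is `X_{ef}(v)` if `e` and
`e'` are consecutive in the orientation of their common face `f`, and `-X_{ef}(v)` otherwise. -/
def bivPair (w : Δ.FaceOrientation) (v : Δ.Vert) (p q : v.verts) (h : p ≠ q) : Biv :=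
  w.eps (edgeAt v p) (faceAt v p q h) v • c.biv (edgeAt v p) (faceAt v p q h) v

/-- `X_{e₄e₅}(v) = ε ⋆(E_{e₁e₂}(v) ∧ E_{e₂e₃}(v))` for every positively oriented tuple
`[e₁ … e₅]` of edges at a vertex `v`. -/
def BivFromCotetrad (o : Δ.Orientation) (w : Δ.FaceOrientation) (ε : ℤˣ) (E : Δ.EdgeVectors) :
    Prop :=
  ∀ (v : Δ.Vert) (p : Δ.Ordering v), o.sgn v p = 1 →
    c.bivPair w v (p 3) (p 4) (p.injective.ne (by decide))
      = ε • hodge (wedge (E v (p 0) (p 1)) (E v (p 1) (p 2)))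

/-- `X_{ee'}(v) = ε V₄(v) U_e(v) ∧ U_{e'}(v)` for any two edges `e`, `e'` at a vertex `v`. -/
def BivFromTetrad (o : Δ.Orientation) (w : Δ.FaceOrientation) (ε : ℤˣ) (E : Δ.EdgeVectors)
    (U : Δ.NormalVectors) : Prop :=
  ∀ (v : Δ.Vert) (p : Δ.Ordering v), o.sgn v p = 1 → ∀ (q r : v.verts) (h : q ≠ r),
    c.bivPair w v q r h = ε • (vol4 E v p • wedge (U v q) (U v r))

/-- The variables `(j_f, g_{ev}, u_e, n_{ef})` are expressed through a co-tetrad `E`, its tetrad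
`U` and spin connection `Ω`, a global sign `ε` and signs `ε_e`:
* `j_f = |E_{ℓ₁} ∧ E_{ℓ₂}|` for edges `ℓ₁`, `ℓ₂` of the triangle dual to `f`;
* `g_{v'v} = ε_e Ω_{v'v}`;
* `u_e = ± |U_e(v)|⁻¹ ((g_{ev} U_e(v))⁰ 𝟙 + i (g_{ev} U_e(v))^i σ_i)`;
* `n_{ef} σ₃ n_{ef}⁻¹ = N^i σ_i` with
  `j_f N^i = ε V₄(v) (g_{ev} ▷ (U_e(v) ∧ U_{e'}(v)))^{+i}`, for consecutive edges `e`, `e'` of `f`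
  at `v`. -/
structure IsDeterminedBy (o : Δ.Orientation) (w : Δ.FaceOrientation) (ε : ℤˣ) (sgn : Δ.Edge → ℤˣ)
    (E : Δ.EdgeVectors) (U : Δ.NormalVectors) (Ω : Δ.Vert → Δ.Vert → SO4) : Prop where
  spin : ∀ (v : Δ.Vert) (p : Δ.Ordering v),
    c.j (faceAt v (p 3) (p 4) (p.injective.ne (by decide)))
      = bivNorm (wedge (E v (p 0) (p 1)) (E v (p 1) (p 2)))
  connection : ∀ (e : Δ.Edge) (v v' : Δ.Vert), e.verts ⊆ v.verts → e.verts ⊆ v'.verts → v ≠ v' →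
    (c.transport e v' v : Matrix (Fin 4) (Fin 4) ℝ)
      = sgn e • (Ω v' v : Matrix (Fin 4) (Fin 4) ℝ)
  normal : ∀ (v : Δ.Vert) (p : v.verts), ∃ s : ℤˣ,
    (c.u (edgeAt v p) : Matrix (Fin 2) (Fin 2) ℂ)
      = s • quat ((len (U v p))⁻¹ •
          ((c.g (edgeAt v p) v : Matrix (Fin 4) (Fin 4) ℝ) *ᵥ U v p))
  direction : ∀ (v : Δ.Vert) (p : Δ.Ordering v), o.sgn v p = 1 →
    ∀ (q r : v.verts) (h : q ≠ r), w.eps (edgeAt v q) (faceAt v q r h) v = 1 →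
    ∃ N : Fin 3 → ℝ,
      conjSigma (c.n (edgeAt v q) (faceAt v q r h)) = pauliVec N ∧
      c.j (faceAt v q r h) • N
        = ε • (vol4 E v p • plusPart (act (c.g (edgeAt v q) v) (wedge (U v q) (U v r))))

end Triangulation.Config

/-- The element `exp(i φ σ₃)` of the `U(1)` subgroup of `SU(2)`. -/
def phase (φ : ℝ) : Matrix (Fin 2) (Fin 2) ℂ :=
  !![Complex.exp (φ * Complex.I), 0; 0, Complex.exp (-(φ * Complex.I))]

end SpinFoam

end

open Matrix

noncomputable section

namespace SpinFoam

/-! ### Linear algebra of vectors and bivectors -/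

/-! The argument reconstructs a simplex from the bivectors at each vertex of the dual complex, and
then glues these simplices along tetrahedra.

At one vertex: simplicity says that the anti-self-dual part of a bivector is minus the rotation by
u_e of its self-dual part. This makes X_ef(v) a wedge product of Û_e(v) with another vector
(`minusPart_wedge`, `exists_biv_eq_wedge`). Interior closure makes B_pq = X_ee'(v) antisymmetric in
p, q, so it contains both normals. Non-degeneracy makes the two normals independent, hence B_pq =
l_pq N_p ∧ N_q (`exists_eq_smul_wedge`). Any four of the five normals are independent, so there is a
relation ∑ m_p N_p = 0 with no vanishing coefficient, and exterior closure forces l_pq = c m_p m_q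
(`exists_normals`). Vectors that sum to zero, four of them independent, are dual to the edge vectors
of a simplex (`exists_edgeFamily_dual`). Scaling the normals by α scales V₄ U ∧ U by α⁻², so c can
be normalized up to its sign relative to the volume; this is the origin of ε (`exists_edgeFamily`).
The identity ⋆(E₁₂ ∧ E₂₃) = V₄ U₄ ∧ U₅ (`IsDual.hodge_wedge`) converts normals into edge vectors and
is the content of part (2).

Gluing: across a tetrahedron the bivectors are related by parallel transport. The sign from
reversing the half-edge cancels the sign from the consistent orientation. Three independent vectors
are determined up to a common sign by their pairwise wedge products, and these products cannot all
change sign, because the factor is a square (`wedge_triple_rigid`). Hence ε is the same on both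
sides and the edge vectors agree up to transport and a sign (`neighbour_rigid`). This yields
metricity and g = ±Ω; connectedness makes ε global. The same rigidity inside one simplex gives
uniqueness (`simplex_rigid`).

Converse: a simple bivector containing a given unit vector is determined by its self-dual part
(`wedge_eq_ofParts`), so the formulas for u_e and n_ef recover X at the end of e where ε_ef = 1;
transport with ±Ω gives the other end. Closure follows from ∑ U_e = 0. Choosing every h_ef to rotate
one reference bivector per face into X_ef makes the wedge holonomies fix the bivectors. -/

/-- Multiplying the selection matrix by the Vandermonde matrix of the nodes 0, 1, 2, 3 gives the one
of the nodes i, j, k, l; the constant 12 is the Vandermonde determinant of 0, 1, 2, 3. -/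
theorem leviCivita_eq (i j k l : Fin 4) :
    leviCivita i j k l = ((j : ℝ) - i) * (k - i) * (l - i) * (k - j) * (l - j) * (l - k) / 12 := by
  have h : (Matrix.of fun a b : Fin 4 => if ![i, j, k, l] a = b then (1 : ℝ) else 0) *
      Matrix.vandermonde (fun a : Fin 4 => (a : ℝ)) =
      Matrix.vandermonde (fun a : Fin 4 => ((![i, j, k, l] a : Fin 4) : ℝ)) := by
    ext a b
    simp [Matrix.mul_apply, Matrix.vandermonde_apply]
  have h2 := congrArg Matrix.det h
  rw [Matrix.det_mul, Matrix.det_vandermonde, Matrix.det_vandermonde] at h2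
  simp [Fin.prod_univ_succ, Fin.prod_Ioi_succ] at h2
  rw [leviCivita]
  norm_num at h2
  linarith

theorem hodge_eq (X : Biv) : hodge X = (1 / 2 : ℝ) •
    !![0, X 2 3 - X 3 2, X 3 1 - X 1 3, X 1 2 - X 2 1;
       X 3 2 - X 2 3, 0, X 0 3 - X 3 0, X 2 0 - X 0 2;
       X 1 3 - X 3 1, X 3 0 - X 0 3, 0, X 0 1 - X 1 0;
       X 2 1 - X 1 2, X 0 2 - X 2 0, X 1 0 - X 0 1, 0] := by
  ext i j
  fin_cases i <;> fin_cases j <;>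
    simp [hodge, leviCivita_eq, Fin.sum_univ_four] <;> norm_num <;> ring

theorem wedge4_eq (X Y : Biv) : wedge4 X Y =
    (X 0 1 - X 1 0) * (Y 2 3 - Y 3 2) + (X 0 2 - X 2 0) * (Y 3 1 - Y 1 3)
    + (X 0 3 - X 3 0) * (Y 1 2 - Y 2 1) + (X 1 2 - X 2 1) * (Y 0 3 - Y 3 0)
    + (X 3 1 - X 1 3) * (Y 0 2 - Y 2 0) + (X 2 3 - X 3 2) * (Y 0 1 - Y 1 0) := by
  simp [wedge4, leviCivita_eq, Fin.sum_univ_four]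
  norm_num
  ring

/-- The determinant of four vectors. -/
def det4 (a b c d : Vec) : ℝ := Matrix.det (Matrix.of ![a, b, c, d])

theorem det4_eq (a b c d : Vec) : det4 a b c d =
    (a 0 * b 1 - a 1 * b 0) * (c 2 * d 3 - c 3 * d 2)
    + (a 0 * b 2 - a 2 * b 0) * (c 3 * d 1 - c 1 * d 3)
    + (a 0 * b 3 - a 3 * b 0) * (c 1 * d 2 - c 2 * d 1)
    + (a 1 * b 2 - a 2 * b 1) * (c 0 * d 3 - c 3 * d 0)
    + (a 3 * b 1 - a 1 * b 3) * (c 0 * d 2 - c 2 * d 0)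
    + (a 2 * b 3 - a 3 * b 2) * (c 0 * d 1 - c 1 * d 0) := by
  simp [det4, Matrix.det_succ_row_zero, Fin.sum_univ_succ, Fin.succAbove]
  ring

theorem wedge_apply (x y : Vec) (i j : Fin 4) : wedge x y i j = x i * y j - y i * x j := by
  simp [wedge, Matrix.vecMulVec_apply]

theorem wedge4_wedge (a b c d : Vec) : wedge4 (wedge a b) (wedge c d) = 4 * det4 a b c d := by
  rw [wedge4_eq, det4_eq]; simp only [wedge_apply]; ring

/-- As a bilinear form the dual of a simple bivector is a determinant, which makes its behaviour
under rotations and in dual bases accessible without coordinates. -/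
theorem dot_hodge_wedge (a b x y : Vec) : x ⬝ᵥ (hodge (wedge a b) *ᵥ y) = det4 x y a b := by
  rw [hodge_eq, det4_eq]
  simp [dotProduct, Matrix.mulVec, Fin.sum_univ_four, wedge_apply]
  ring

theorem wedge_smul_left (t : ℝ) (x y : Vec) : wedge (t • x) y = t • wedge x y := by
  ext i j; simp [wedge_apply]; ring

theorem wedge_smul_right (t : ℝ) (x y : Vec) : wedge x (t • y) = t • wedge x y := by
  ext i j; simp [wedge_apply]; ring

theorem wedge_add_left (x x' y : Vec) : wedge (x + x') y = wedge x y + wedge x' y := by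
  ext i j; simp [wedge_apply]; ring

theorem wedge_add_right (x y y' : Vec) : wedge x (y + y') = wedge x y + wedge x y' := by
  ext i j; simp [wedge_apply]; ring

theorem wedge_neg_left (x y : Vec) : wedge (-x) y = - wedge x y := by
  ext i j; simp [wedge_apply]; ring

theorem wedge_neg_right (x y : Vec) : wedge x (-y) = - wedge x y := by
  ext i j; simp [wedge_apply]; ring

theorem wedge_self (x : Vec) : wedge x x = 0 := sub_self _

theorem wedge_swap (x y : Vec) : wedge y x = - wedge x y := by
  ext i j; simp [wedge_apply]

theorem wedge_sum_right {ι : Type*} (s : Finset ι) (x : Vec) (y : ι → Vec) :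
    wedge x (∑ i ∈ s, y i) = ∑ i ∈ s, wedge x (y i) := by
  ext i j
  simp [wedge_apply, Matrix.sum_apply, Finset.sum_apply, Finset.mul_sum, Finset.sum_mul]

theorem wedge_zero_right (x : Vec) : wedge x 0 = 0 := by
  ext i j; simp [wedge_apply]

theorem wedge_mulVec (x y z : Vec) : wedge x y *ᵥ z = (y ⬝ᵥ z) • x - (x ⬝ᵥ z) • y := by
  ext i; simp [wedge_apply, Matrix.mulVec, dotProduct, Fin.sum_univ_four]; ring

theorem transpose_wedge (x y : Vec) : (wedge x y)ᵀ = - wedge x y := by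
  ext i j; simp [wedge_apply]; ring

theorem wedge4_smul_left (t : ℝ) (X Y : Biv) : wedge4 (t • X) Y = t * wedge4 X Y := by
  simp [wedge4_eq]; ring

theorem wedge4_smul_right (t : ℝ) (X Y : Biv) : wedge4 X (t • Y) = t * wedge4 X Y := by
  simp [wedge4_eq]; ring

theorem hodge_smul (t : ℝ) (X : Biv) : hodge (t • X) = t • hodge X := by
  simp only [hodge_eq]; ext i j; fin_cases i <;> fin_cases j <;> simp <;> ring

theorem hodge_neg (X : Biv) : hodge (-X) = - hodge X := by
  have := hodge_smul (-1) X
  simpa using this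

theorem hodge_hodge {X : Biv} (hX : Xᵀ = -X) : hodge (hodge X) = X := by
  have h : ∀ i j, X j i = - X i j := fun i j => by
    have := congrFun (congrFun hX i) j; simpa using this
  have h' : ∀ i, X i i = 0 := fun i => by have := h i i; linarith
  rw [hodge_eq, hodge_eq X]
  ext i j
  fin_cases i <;> fin_cases j <;> simp [h'] <;>
    linarith [h 0 1, h 0 2, h 0 3, h 1 2, h 1 3, h 2 3]

/-- The dual squares to the identity on antisymmetric matrices in Euclidean signature, so it can be
cancelled. -/
theorem hodge_wedge_injective {a b c d : Vec} {s t : ℝ}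
    (h : s • hodge (wedge a b) = t • hodge (wedge c d)) : s • wedge a b = t • wedge c d := by
  have h1 := congrArg hodge h
  rwa [hodge_smul, hodge_smul, hodge_hodge (transpose_wedge _ _),
    hodge_hodge (transpose_wedge _ _)] at h1

/-! ### Lengths and norms -/

theorem dot_self_nonneg (x : Vec) : 0 ≤ x ⬝ᵥ x := by
  simp only [dotProduct, Fin.sum_univ_four]
  nlinarith [sq_nonneg (x 0), sq_nonneg (x 1), sq_nonneg (x 2), sq_nonneg (x 3)]

theorem dot_self_pos {x : Vec} (hx : x ≠ 0) : 0 < x ⬝ᵥ x :=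
  lt_of_le_of_ne (dot_self_nonneg x) fun h => hx (dotProduct_self_eq_zero.1 h.symm)

theorem len_sq (x : Vec) : len x ^ 2 = x ⬝ᵥ x := Real.sq_sqrt (dot_self_nonneg x)

theorem len_pos {x : Vec} (hx : x ≠ 0) : 0 < len x := Real.sqrt_pos.2 (dot_self_pos hx)

theorem len_smul (t : ℝ) (x : Vec) : len (t • x) = |t| * len x := by
  rw [len, len, dotProduct_smul, smul_dotProduct, smul_eq_mul, smul_eq_mul, ← mul_assoc,
    Real.sqrt_mul (mul_self_nonneg t), Real.sqrt_mul_self_eq_abs]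

theorem bivNorm_nonneg (X : Biv) : 0 ≤ bivNorm X := Real.sqrt_nonneg _

theorem bivNorm_sq (X : Biv) : bivNorm X ^ 2 = (1 / 2) * ∑ i, ∑ j, X i j ^ 2 :=
  Real.sq_sqrt (mul_nonneg (by norm_num)
    (Finset.sum_nonneg fun i _ => Finset.sum_nonneg fun j _ => sq_nonneg _))

theorem bivNorm_smul (t : ℝ) (X : Biv) : bivNorm (t • X) = |t| * bivNorm X := by
  rw [bivNorm, bivNorm, ← Real.sqrt_sq_eq_abs, ← Real.sqrt_mul (sq_nonneg t)]
  congr 1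
  simp [Fin.sum_univ_four]; ring

theorem bivNorm_neg (X : Biv) : bivNorm (-X) = bivNorm X := by simp [bivNorm]

theorem bivNorm_hodge {X : Biv} (hX : Xᵀ = -X) : bivNorm (hodge X) = bivNorm X := by
  have h : ∀ i j, X j i = - X i j := fun i j => by
    have := congrFun (congrFun hX i) j; simpa using this
  have h' : ∀ i, X i i = 0 := fun i => by have := h i i; linarith
  rw [bivNorm, bivNorm, hodge_eq]
  congr 2
  simp [Fin.sum_univ_four, h']
  rw [h 0 1, h 0 2, h 0 3, h 1 2, h 1 3, h 2 3]
  ring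

/-- Lagrange's identity: the squared area is the Gram determinant, so areas depend on scalar
products only. -/
theorem bivNorm_wedge_sq (x y : Vec) :
    bivNorm (wedge x y) ^ 2 = (x ⬝ᵥ x) * (y ⬝ᵥ y) - (x ⬝ᵥ y) ^ 2 := by
  rw [bivNorm_sq]
  simp [Fin.sum_univ_four, wedge_apply, dotProduct]
  ring

theorem bivNorm_wedge (x y : Vec) :
    bivNorm (wedge x y) = Real.sqrt ((x ⬝ᵥ x) * (y ⬝ᵥ y) - (x ⬝ᵥ y) ^ 2) := by
  rw [← bivNorm_wedge_sq, Real.sqrt_sq (bivNorm_nonneg _)]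

theorem bivNorm_eq_zero {X : Biv} (h : bivNorm X = 0) : X = 0 := by
  have h1 := bivNorm_sq X
  rw [h] at h1
  ext i j
  have h2 : ∑ i, ∑ j, X i j ^ 2 = 0 := by linarith
  have h3 := (Finset.sum_eq_zero_iff_of_nonneg
    (fun i _ => Finset.sum_nonneg fun j _ => sq_nonneg (X i j))).1 h2 i (Finset.mem_univ _)
  have h4 := (Finset.sum_eq_zero_iff_of_nonneg
    (fun j _ => sq_nonneg (X i j))).1 h3 j (Finset.mem_univ _)
  simpa using h4

/-! ### The action of `SO(4)` -/

theorem SO4.transpose_mul (g : SO4) :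
    (g : Matrix (Fin 4) (Fin 4) ℝ)ᵀ * (g : Matrix (Fin 4) (Fin 4) ℝ) = 1 := by
  have h := (Matrix.mem_specialOrthogonalGroup_iff.1 g.2).1
  simpa [Matrix.star_eq_conjTranspose] using (Matrix.mem_orthogonalGroup_iff' (Fin 4) ℝ).1 h

theorem SO4.mul_transpose (g : SO4) :
    (g : Matrix (Fin 4) (Fin 4) ℝ) * (g : Matrix (Fin 4) (Fin 4) ℝ)ᵀ = 1 :=
  mul_eq_one_comm.1 (SO4.transpose_mul g)

theorem SO4.det (g : SO4) : (g : Matrix (Fin 4) (Fin 4) ℝ).det = 1 :=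
  (Matrix.mem_specialOrthogonalGroup_iff.1 g.2).2

theorem SO4.coe_inv (g : SO4) :
    ((g⁻¹ : SO4) : Matrix (Fin 4) (Fin 4) ℝ) = (g : Matrix (Fin 4) (Fin 4) ℝ)ᵀ := by
  rw [← Matrix.star_eq_inv, Matrix.specialUnitaryGroup.coe_star, Matrix.star_eq_conjTranspose,
    Matrix.conjTranspose_eq_transpose_of_trivial]

/-- The element of `SO(4)` given by a matrix `M` with `M Mᵀ = 1` and `det M = 1`. -/
def SO4.mk (M : Matrix (Fin 4) (Fin 4) ℝ) (h : M * Mᵀ = 1) (hd : M.det = 1) : SO4 :=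
  ⟨M, Matrix.mem_specialOrthogonalGroup_iff.2 ⟨(Matrix.mem_orthogonalGroup_iff (Fin 4) ℝ).2 h, hd⟩⟩

theorem SO4.mulVec_dot (g : SO4) (x y : Vec) :
    ((g : Matrix (Fin 4) (Fin 4) ℝ) *ᵥ x) ⬝ᵥ ((g : Matrix (Fin 4) (Fin 4) ℝ) *ᵥ y) = x ⬝ᵥ y := by
  rw [Matrix.dotProduct_mulVec, Matrix.vecMul_mulVec, ← Matrix.mulVec_transpose]
  simp [SO4.transpose_mul]

theorem SO4.len_mulVec (g : SO4) (x : Vec) :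
    len ((g : Matrix (Fin 4) (Fin 4) ℝ) *ᵥ x) = len x := by
  rw [len, len, SO4.mulVec_dot]

theorem SO4.inv_mulVec (g : SO4) (x : Vec) :
    ((g⁻¹ : SO4) : Matrix (Fin 4) (Fin 4) ℝ) *ᵥ ((g : Matrix (Fin 4) (Fin 4) ℝ) *ᵥ x) = x := by
  rw [SO4.coe_inv, Matrix.mulVec_mulVec, SO4.transpose_mul, Matrix.one_mulVec]

theorem SO4.mulVec_inv (g : SO4) (x : Vec) :
    (g : Matrix (Fin 4) (Fin 4) ℝ) *ᵥ (((g⁻¹ : SO4) : Matrix (Fin 4) (Fin 4) ℝ) *ᵥ x) = x := by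
  rw [SO4.coe_inv, Matrix.mulVec_mulVec, SO4.mul_transpose, Matrix.one_mulVec]

theorem det4_mulVec (M : Matrix (Fin 4) (Fin 4) ℝ) (a b c d : Vec) :
    det4 (M *ᵥ a) (M *ᵥ b) (M *ᵥ c) (M *ᵥ d) = M.det * det4 a b c d := by
  have : (Matrix.of ![M *ᵥ a, M *ᵥ b, M *ᵥ c, M *ᵥ d]) = Matrix.of ![a, b, c, d] * Mᵀ := by
    ext i j
    fin_cases i <;> simp [Matrix.mul_apply, Matrix.mulVec, dotProduct, mul_comm]
  rw [det4, this, Matrix.det_mul, Matrix.det_transpose, det4, mul_comm]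

theorem act_wedge (g : SO4) (x y : Vec) : act g (wedge x y) =
    wedge ((g : Matrix (Fin 4) (Fin 4) ℝ) *ᵥ x) ((g : Matrix (Fin 4) (Fin 4) ℝ) *ᵥ y) := by
  rw [act, wedge, wedge, Matrix.mul_sub, Matrix.sub_mul, Matrix.mul_vecMulVec,
    Matrix.mul_vecMulVec, Matrix.vecMulVec_mul, Matrix.vecMulVec_mul, Matrix.vecMul_transpose,
    Matrix.vecMul_transpose]

theorem act_smul (g : SO4) (t : ℝ) (X : Biv) : act g (t • X) = t • act g X := by
  simp [act]

theorem act_units_smul (g : SO4) (t : ℤˣ) (X : Biv) : act g (t • X) = t • act g X := by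
  rcases Int.units_eq_one_or t with rfl | rfl <;> simp [act]

theorem act_mul (g h : SO4) (X : Biv) : act (g * h) X = act g (act h X) := by
  simp [act, Matrix.mul_assoc]

theorem act_one (X : Biv) : act 1 X = X := by
  simp [act]

theorem act_inv_act (g : SO4) (X : Biv) : act g⁻¹ (act g X) = X := by
  rw [← act_mul, inv_mul_cancel, act_one]

theorem act_act_inv (g : SO4) (X : Biv) : act g (act g⁻¹ X) = X := by
  rw [← act_mul, mul_inv_cancel, act_one]

theorem transpose_act (g : SO4) {X : Biv} (hX : Xᵀ = -X) : (act g X)ᵀ = - act g X := by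
  simp [act, Matrix.transpose_mul, hX, Matrix.mul_assoc]

theorem bivNorm_act (g : SO4) (X : Biv) : bivNorm (act g X) = bivNorm X := by
  have h : ∀ Y : Biv, ∑ i, ∑ j, Y i j ^ 2 = Matrix.trace (Y * Yᵀ) := fun Y => by
    simp [Matrix.trace, Matrix.mul_apply, sq]
  rw [bivNorm, bivNorm, h, h]
  congr 2
  have : act g X * (act g X)ᵀ = (g : Matrix (Fin 4) (Fin 4) ℝ) * (X * Xᵀ) *
      (g : Matrix (Fin 4) (Fin 4) ℝ)ᵀ := by
    simp only [act, Matrix.transpose_mul, Matrix.transpose_transpose]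
    calc _ = (g : Matrix (Fin 4) (Fin 4) ℝ) * X *
        ((g : Matrix (Fin 4) (Fin 4) ℝ)ᵀ * (g : Matrix (Fin 4) (Fin 4) ℝ)) * (Xᵀ *
          (g : Matrix (Fin 4) (Fin 4) ℝ)ᵀ) := by simp only [Matrix.mul_assoc]
      _ = _ := by rw [SO4.transpose_mul]; simp only [Matrix.mul_assoc, Matrix.one_mul]
  rw [this, Matrix.trace_mul_comm, ← Matrix.mul_assoc, SO4.transpose_mul, Matrix.one_mul]

theorem eq_of_dot_mulVec {X Y : Biv} (h : ∀ x y : Vec, x ⬝ᵥ (X *ᵥ y) = x ⬝ᵥ (Y *ᵥ y)) : X = Y := by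
  ext i j
  simpa using h (Pi.single i 1) (Pi.single j 1)

/-- Both sides are determinants as bilinear forms, and these are invariant because det g = 1. -/
theorem hodge_act_wedge (g : SO4) (x y : Vec) :
    hodge (act g (wedge x y)) = act g (hodge (wedge x y)) := by
  refine eq_of_dot_mulVec fun a b => ?_
  rw [act_wedge, dot_hodge_wedge, act, ← Matrix.mulVec_mulVec, ← Matrix.mulVec_mulVec,
    Matrix.dotProduct_mulVec, ← Matrix.mulVec_transpose, dot_hodge_wedge, ← SO4.coe_inv]
  conv_lhs => rw [← SO4.mulVec_inv g a, ← SO4.mulVec_inv g b]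
  rw [det4_mulVec, SO4.det, one_mul]

/-! ### `SU(2)` and the simplicity condition -/

theorem SU2.star_mul (u : SU2) :
    star (u : Matrix (Fin 2) (Fin 2) ℂ) * (u : Matrix (Fin 2) (Fin 2) ℂ) = 1 :=
  (Matrix.mem_unitaryGroup_iff').1 (Matrix.mem_specialUnitaryGroup_iff.1 u.2).1

theorem SU2.det (u : SU2) : (u : Matrix (Fin 2) (Fin 2) ℂ).det = 1 :=
  (Matrix.mem_specialUnitaryGroup_iff.1 u.2).2

theorem SU2.coe_inv (u : SU2) :
    ((u⁻¹ : SU2) : Matrix (Fin 2) (Fin 2) ℂ) = star (u : Matrix (Fin 2) (Fin 2) ℂ) := by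
  rw [← Matrix.star_eq_inv, Matrix.specialUnitaryGroup.coe_star]

theorem quat_eq (x : Vec) : quat x =
    !![(x 0 : ℂ) + x 3 * Complex.I, x 2 + x 1 * Complex.I;
       -x 2 + x 1 * Complex.I, x 0 - x 3 * Complex.I] := by
  ext i j
  fin_cases i <;> fin_cases j <;>
    apply Complex.ext <;> simp [quat, pauliVec, pauli, Fin.sum_univ_three]

/-- The inverse is the adjoint by unitarity and the adjugate by det u = 1; comparing entries gives
the unit quaternion form. -/
theorem SU2.entries (u : SU2) :
    (u : Matrix (Fin 2) (Fin 2) ℂ) 1 1 = star ((u : Matrix (Fin 2) (Fin 2) ℂ) 0 0) ∧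
    (u : Matrix (Fin 2) (Fin 2) ℂ) 1 0 = - star ((u : Matrix (Fin 2) (Fin 2) ℂ) 0 1) := by
  have h1 := SU2.star_mul u
  have h2 : Matrix.adjugate (u : Matrix (Fin 2) (Fin 2) ℂ) * (u : Matrix (Fin 2) (Fin 2) ℂ) = 1 := by
    rw [Matrix.adjugate_mul, SU2.det, one_smul]
  have h3 : (u : Matrix (Fin 2) (Fin 2) ℂ) * star (u : Matrix (Fin 2) (Fin 2) ℂ) = 1 :=
    mul_eq_one_comm.1 h1
  have h4 : Matrix.adjugate (u : Matrix (Fin 2) (Fin 2) ℂ) = star (u : Matrix (Fin 2) (Fin 2) ℂ) := by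
    calc _ = Matrix.adjugate (u : Matrix (Fin 2) (Fin 2) ℂ) *
          ((u : Matrix (Fin 2) (Fin 2) ℂ) * star (u : Matrix (Fin 2) (Fin 2) ℂ)) := by rw [h3, mul_one]
      _ = _ := by rw [← mul_assoc, h2, one_mul]
  rw [Matrix.adjugate_fin_two] at h4
  have ha := congrFun (congrFun h4 0) 0
  have hb := congrFun (congrFun h4 1) 0
  simp [Matrix.star_apply] at ha hb
  exact ⟨by simpa using ha, by rw [← neg_neg ((u : Matrix (Fin 2) (Fin 2) ℂ) 1 0), hb]; rfl⟩

theorem SU2.quat_unitVec (u : SU2) : quat (unitVec (u : Matrix (Fin 2) (Fin 2) ℂ)) = u := by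
  obtain ⟨h1, h2⟩ := SU2.entries u
  ext i j
  rw [quat_eq]
  fin_cases i <;> fin_cases j <;> apply Complex.ext <;>
    simp [unitVec, Matrix.trace, Fin.sum_univ_two, Matrix.mul_apply, pauli, h1, h2]

theorem det_quat (x : Vec) : (quat x).det = ((x ⬝ᵥ x : ℝ) : ℂ) := by
  rw [quat_eq, Matrix.det_fin_two]
  apply Complex.ext <;> simp [dotProduct, Fin.sum_univ_four] <;> ring

theorem quat_mul_star (x : Vec) :
    quat x * star (quat x) = ((x ⬝ᵥ x : ℝ) : ℂ) • (1 : Matrix (Fin 2) (Fin 2) ℂ) := by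
  rw [quat_eq]
  ext i j
  fin_cases i <;> fin_cases j <;> apply Complex.ext <;>
    simp [dotProduct, Fin.sum_univ_four, Matrix.mul_apply] <;> ring

theorem SU2.unitVec_dot_self (u : SU2) : unitVec (u : Matrix (Fin 2) (Fin 2) ℂ) ⬝ᵥ
    unitVec (u : Matrix (Fin 2) (Fin 2) ℂ) = 1 := by
  have h := det_quat (unitVec (u : Matrix (Fin 2) (Fin 2) ℂ))
  rw [SU2.quat_unitVec, SU2.det] at h
  exact_mod_cast h.symm

/-- The element of `SU(2)` given by a unit vector of `ℝ⁴`. -/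
def SU2.ofVec (x : Vec) (hx : x ⬝ᵥ x = 1) : SU2 :=
  ⟨quat x, Matrix.mem_specialUnitaryGroup_iff.2 ⟨Matrix.mem_unitaryGroup_iff.2
    (by rw [quat_mul_star, hx]; simp), by rw [det_quat, hx]; simp⟩⟩

/-- The rotation of `ℝ³` (times `|x|²`) induced by conjugation with `quat x`. -/
def rot (x : Vec) (a : Fin 3 → ℝ) : Fin 3 → ℝ :=
  ![(x 0 * x 0 - (x 1 * x 1 + x 2 * x 2 + x 3 * x 3)) * a 0
      + 2 * (x 1 * a 0 + x 2 * a 1 + x 3 * a 2) * x 1 - 2 * x 0 * (x 2 * a 2 - x 3 * a 1),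
    (x 0 * x 0 - (x 1 * x 1 + x 2 * x 2 + x 3 * x 3)) * a 1
      + 2 * (x 1 * a 0 + x 2 * a 1 + x 3 * a 2) * x 2 - 2 * x 0 * (x 3 * a 0 - x 1 * a 2),
    (x 0 * x 0 - (x 1 * x 1 + x 2 * x 2 + x 3 * x 3)) * a 2
      + 2 * (x 1 * a 0 + x 2 * a 1 + x 3 * a 2) * x 3 - 2 * x 0 * (x 1 * a 1 - x 2 * a 0)]

theorem quat_conj_pauliVec (x : Vec) (a : Fin 3 → ℝ) :
    quat x * pauliVec a * star (quat x) = pauliVec (rot x a) := by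
  have h : ∀ b : Fin 3 → ℝ, pauliVec b =
      !![(b 2 : ℂ), b 0 - b 1 * Complex.I; b 0 + b 1 * Complex.I, -b 2] := fun b => by
    ext i j
    fin_cases i <;> fin_cases j <;> apply Complex.ext <;>
      simp [pauliVec, pauli, Fin.sum_univ_three]
  rw [quat_eq, h, h]
  ext i j
  fin_cases i <;> fin_cases j <;> apply Complex.ext <;>
    simp [Matrix.mul_apply, rot, Fin.sum_univ_two] <;> ring

theorem pauliVec_single : pauliVec ![0, 0, 1] = pauli 2 := by
  simp [pauliVec, Fin.sum_univ_three]

theorem conjSigma_eq (n : SU2) :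
    conjSigma n = pauliVec (rot (unitVec (n : Matrix (Fin 2) (Fin 2) ℂ)) ![0, 0, 1]) := by
  rw [← quat_conj_pauliVec, SU2.quat_unitVec, conjSigma, pauliVec_single, SU2.coe_inv]

theorem conjSigma_mul (u n : SU2) :
    conjSigma (u * n) = pauliVec (rot (unitVec (u : Matrix (Fin 2) (Fin 2) ℂ))
      (pauliCoord (conjSigma n))) := by
  rw [← quat_conj_pauliVec, SU2.quat_unitVec, conjSigma_eq n, pauliCoord_pauliVec, ← conjSigma_eq n,
    ← SU2.coe_inv]
  simp only [conjSigma, _root_.mul_inv_rev, Submonoid.coe_mul, Matrix.mul_assoc]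

theorem pauliVec_pauliCoord_conjSigma (n : SU2) :
    pauliVec (pauliCoord (conjSigma n)) = conjSigma n := by
  rw [conjSigma_eq, pauliCoord_pauliVec]

theorem rot_dot_self (x : Vec) (a : Fin 3 → ℝ) :
    rot x a ⬝ᵥ rot x a = (x ⬝ᵥ x) ^ 2 * (a ⬝ᵥ a) := by
  simp [rot, dotProduct, Fin.sum_univ_three, Fin.sum_univ_four]; ring

theorem rot_smul (x : Vec) (t : ℝ) (a : Fin 3 → ℝ) : rot x (t • a) = t • rot x a := by
  ext i; fin_cases i <;> simp [rot] <;> ring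

theorem pauliCoord_conjSigma_dot_self (n : SU2) :
    pauliCoord (conjSigma n) ⬝ᵥ pauliCoord (conjSigma n) = 1 := by
  rw [conjSigma_eq, pauliCoord_pauliVec, rot_dot_self, SU2.unitVec_dot_self]
  simp [dotProduct, Fin.sum_univ_three]

theorem exists_conjSigma_eq {N : Fin 3 → ℝ} (hN : N ⬝ᵥ N = 1) :
    ∃ n : SU2, conjSigma n = pauliVec N := by
  suffices ∃ x : Vec, x ⬝ᵥ x = 1 ∧ rot x ![0, 0, 1] = N by
    obtain ⟨x, hx, h⟩ := this
    exact ⟨SU2.ofVec x hx, by rw [conjSigma_eq, SU2.ofVec, unitVec_quat, h]⟩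
  have hN' : N 0 * N 0 + N 1 * N 1 + N 2 * N 2 = 1 := by
    simpa [dotProduct, Fin.sum_univ_three] using hN
  by_cases h : N 2 = -1
  -- The south pole is reached by the half turn about the first axis; the half-angle formula below
  -- would divide by zero.
  · refine ⟨![0, 1, 0, 0], by simp [dotProduct, Fin.sum_univ_four], ?_⟩
    have h0 : N 0 = 0 := by nlinarith [mul_self_nonneg (N 0), mul_self_nonneg (N 1)]
    have h1 : N 1 = 0 := by nlinarith [mul_self_nonneg (N 0), mul_self_nonneg (N 1)]
    ext i; fin_cases i <;> simp [rot, h, h0, h1]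
  · have hpos : 0 < (1 + N 2) / 2 := by
      have : -1 ≤ N 2 := by nlinarith [mul_self_nonneg (N 0), mul_self_nonneg (N 1)]
      have := lt_of_le_of_ne this (Ne.symm h)
      linarith
    -- With N 2 = cos θ, r is cos(θ/2): the quaternion rotates the third axis into N about a
    -- horizontal axis.
    set r := Real.sqrt ((1 + N 2) / 2) with hr
    have hr0 : 0 < r := Real.sqrt_pos.2 hpos
    have hr2 : r ^ 2 = (1 + N 2) / 2 := Real.sq_sqrt hpos.le
    have hs : N 0 ^ 2 + N 1 ^ 2 = 4 * r ^ 2 * (1 - r ^ 2) := by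
      rw [hr2]; nlinarith
    refine ⟨![r, N 1 / (2 * r), -(N 0 / (2 * r)), 0], ?_, ?_⟩
    · simp [dotProduct, Fin.sum_univ_four]
      field_simp
      nlinarith
    · ext i; fin_cases i <;> simp [rot] <;> field_simp
      nlinarith

/-- The stabilizer of σ₃ under conjugation is the diagonal torus. The quotient n⁻¹m stabilizes σ₃,
so its quaternion has no first and second components and is a phase. -/
theorem conjSigma_eq_iff (m n : SU2) : conjSigma m = conjSigma n ↔
    ∃ φ : ℝ, (m : Matrix (Fin 2) (Fin 2) ℂ) = (n : Matrix (Fin 2) (Fin 2) ℂ) * phase φ := by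
  constructor
  · intro h
    set k : SU2 := n⁻¹ * m with hk
    have hm : m = n * k := by rw [hk, mul_inv_cancel_left]
    have h1 : conjSigma k = pauli 2 := by
      have : conjSigma k = ((n⁻¹ : SU2) : Matrix (Fin 2) (Fin 2) ℂ) * conjSigma m * n := by
        simp only [conjSigma, hk, _root_.mul_inv_rev, inv_inv, Submonoid.coe_mul, Matrix.mul_assoc]
      rw [this, h, conjSigma]
      have h2 : ((n⁻¹ : SU2) : Matrix (Fin 2) (Fin 2) ℂ) * n = 1 := by
        rw [SU2.coe_inv, SU2.star_mul]
      rw [← Matrix.mul_assoc, ← Matrix.mul_assoc, h2, Matrix.one_mul, Matrix.mul_assoc, h2,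
        Matrix.mul_one]
    have hx := SU2.unitVec_dot_self k
    have hq := SU2.quat_unitVec k
    set x := unitVec (k : Matrix (Fin 2) (Fin 2) ℂ) with hxd
    have h3 : rot x ![0, 0, 1] = ![0, 0, 1] := by
      have := conjSigma_eq k
      rw [h1, ← pauliVec_single] at this
      rw [← pauliCoord_pauliVec (rot _ _), ← this, pauliCoord_pauliVec]
    have h4 := congrFun h3 2
    simp [rot] at h4
    simp [dotProduct, Fin.sum_univ_four] at hx
    have h5 : x 1 = 0 := by nlinarith [mul_self_nonneg (x 1), mul_self_nonneg (x 2)]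
    have h6 : x 2 = 0 := by nlinarith [mul_self_nonneg (x 1), mul_self_nonneg (x 2)]
    set z : ℂ := ⟨x 0, x 3⟩ with hz
    have hz1 : ‖z‖ = 1 := by
      rw [Complex.norm_def, Real.sqrt_eq_one, Complex.normSq_mk]
      rw [h5, h6] at hx; linarith
    refine ⟨Complex.arg z, ?_⟩
    have hz2 : Complex.exp (Complex.arg z * Complex.I) = z := by
      have := Complex.norm_mul_exp_arg_mul_I z
      rwa [hz1, Complex.ofReal_one, one_mul] at this
    have hz3 : Complex.exp (-(Complex.arg z * Complex.I)) = star z := by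
      rw [Complex.exp_neg, hz2, Complex.inv_def, Complex.normSq_eq_norm_sq, hz1]; simp
    rw [hm, Submonoid.coe_mul, ← hq, phase, hz2, hz3, quat_eq]
    congr 1
    ext i j
    fin_cases i <;> fin_cases j <;> apply Complex.ext <;> simp [h5, h6, hz]
  · rintro ⟨φ, h⟩
    rw [conjSigma, conjSigma, SU2.coe_inv, SU2.coe_inv, h, StarMul.star_mul]
    have : phase φ * pauli 2 * star (phase φ) = pauli 2 := by
      have h1 : (starRingEnd ℂ) (Complex.exp (φ * Complex.I)) = Complex.exp (-(φ * Complex.I)) := by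
        rw [← Complex.exp_conj]; simp
      have h2 : (starRingEnd ℂ) (Complex.exp (-(φ * Complex.I))) = Complex.exp (φ * Complex.I) := by
        rw [← Complex.exp_conj]; simp
      ext i j
      fin_cases i <;> fin_cases j <;>
        simp [phase, pauli, Matrix.mul_apply, h1, h2, ← Complex.exp_add]
    calc _ = (n : Matrix (Fin 2) (Fin 2) ℂ) * (phase φ * pauli 2 * star (phase φ)) * star (n : Matrix (Fin 2) (Fin 2) ℂ) := by
          simp only [Matrix.mul_assoc]
      _ = _ := by rw [this]

/-! ### Self-dual and anti-self-dual parts -/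

theorem ofParts_plusPart_minusPart {X : Biv} (hX : Xᵀ = -X) :
    ofParts (plusPart X) (minusPart X) = X := by
  have h : ∀ i j, X j i = - X i j := fun i j => by
    have := congrFun (congrFun hX i) j; simpa using this
  have h' : ∀ i, X i i = 0 := fun i => by have := h i i; linarith
  ext i j
  fin_cases i <;> fin_cases j <;> simp [ofParts, plusPart, minusPart, h'] <;>
    linarith [h 0 1, h 0 2, h 0 3, h 1 2, h 1 3, h 2 3]

theorem transpose_ofParts (a b : Fin 3 → ℝ) : (ofParts a b)ᵀ = - ofParts a b := by
  ext i j
  fin_cases i <;> fin_cases j <;> simp [ofParts] <;> ring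

theorem plusPart_smul (t : ℝ) (X : Biv) : plusPart (t • X) = t • plusPart X := by
  ext i; fin_cases i <;> simp [plusPart] <;> ring

theorem bivNorm_ofParts (a b : Fin 3 → ℝ) :
    bivNorm (ofParts a b) ^ 2 = (a ⬝ᵥ a + b ⬝ᵥ b) / 2 := by
  rw [bivNorm_sq]
  simp [ofParts, Fin.sum_univ_four, dotProduct, Fin.sum_univ_three]
  ring

theorem plusPart_wedge_dot_self (x y : Vec) :
    plusPart (wedge x y) ⬝ᵥ plusPart (wedge x y) = bivNorm (wedge x y) ^ 2 := by
  rw [bivNorm_wedge_sq]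
  simp [plusPart, wedge_apply, dotProduct, Fin.sum_univ_four, Fin.sum_univ_three]
  ring

/-- This is the geometric meaning of the simplicity condition: the rotation that relates the two
chiral parts encodes a unit vector lying in the plane of the bivector. -/
theorem minusPart_wedge {x : Vec} (hx : x ⬝ᵥ x = 1) (y : Vec) :
    minusPart (wedge x y) = - rot x (plusPart (wedge x y)) := by
  have h : (x ⬝ᵥ x) • minusPart (wedge x y) = - rot x (plusPart (wedge x y)) := by
    ext i
    fin_cases i <;>
      simp [plusPart, minusPart, rot, wedge_apply, dotProduct, Fin.sum_univ_four] <;> ring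
  rwa [hx, one_smul] at h

theorem exists_plusPart_wedge {x : Vec} (hx : x ⬝ᵥ x = 1) (a : Fin 3 → ℝ) :
    ∃ y, plusPart (wedge x y) = a := by
  -- The witness is the quaternion product of the imaginary quaternion a with x; it is orthogonal to
  -- x.
  refine ⟨![-(x 1 * a 0 + x 2 * a 1 + x 3 * a 2), x 0 * a 0 + (a 1 * x 3 - a 2 * x 2),
    x 0 * a 1 + (a 2 * x 1 - a 0 * x 3), x 0 * a 2 + (a 0 * x 2 - a 1 * x 1)], ?_⟩
  refine Eq.trans ?_ (one_smul ℝ a)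
  rw [← hx]
  ext i
  fin_cases i <;>
    simp [plusPart, wedge_apply, dotProduct, Fin.sum_univ_four] <;> ring

/-- A simple bivector containing the unit vector `x` is determined by its self-dual part. -/
theorem wedge_eq_ofParts {x : Vec} (hx : x ⬝ᵥ x = 1) (y : Vec) :
    wedge x y = ofParts (plusPart (wedge x y)) (-rot x (plusPart (wedge x y))) := by
  rw [← minusPart_wedge hx, ofParts_plusPart_minusPart (transpose_wedge x y)]

theorem exists_wedge_eq_ofParts {x : Vec} (hx : x ⬝ᵥ x = 1) (a : Fin 3 → ℝ) :
    ∃ y, ofParts a (-rot x a) = wedge x y := by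
  obtain ⟨y, hy⟩ := exists_plusPart_wedge hx a
  exact ⟨y, by rw [wedge_eq_ofParts hx, hy]⟩

theorem exists_act_minusPart {x : Vec} (hx : x ⬝ᵥ x = 1) :
    ∃ h : SO4, ∀ a b, act h (ofParts a b) = ofParts a (rot x b) := by
  have hx' : x 0 * x 0 + x 1 * x 1 + x 2 * x 2 + x 3 * x 3 = 1 := by
    simpa [dotProduct, Fin.sum_univ_four] using hx
  -- Right multiplication by the unit quaternion x, which moves only one chiral part.
  set M : Matrix (Fin 4) (Fin 4) ℝ := !![x 0, -x 1, -x 2, -x 3; x 1, x 0, x 3, -x 2;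
    x 2, -x 3, x 0, x 1; x 3, x 2, -x 1, x 0] with hM
  have h1 : M * Mᵀ = 1 := by
    ext i j
    fin_cases i <;> fin_cases j <;> simp [hM, Matrix.mul_apply, Fin.sum_univ_four] <;>
      first | ring1 | linear_combination hx'
  have h2 : M.det = 1 := by
    have : M.det = (x 0 * x 0 + x 1 * x 1 + x 2 * x 2 + x 3 * x 3) ^ 2 := by
      simp [hM, Matrix.det_succ_row_zero, Fin.sum_univ_succ, Fin.succAbove]; ring
    rw [this, hx', one_pow]
  refine ⟨SO4.mk M h1 h2, fun a b => ?_⟩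
  have key : act (SO4.mk M h1 h2) (ofParts a b) = ofParts ((x ⬝ᵥ x) • a) (rot x b) := by
    ext i j
    fin_cases i <;> fin_cases j <;>
      simp [act, SO4.mk, hM, ofParts, rot, Matrix.mul_apply, Fin.sum_univ_four, dotProduct] <;> ring
  rw [key, hx, one_smul]

theorem exists_act_plusPart {x : Vec} (hx : x ⬝ᵥ x = 1) :
    ∃ h : SO4, ∀ a b, act h (ofParts a b) = ofParts (rot x a) b := by
  have hx' : x 0 * x 0 + x 1 * x 1 + x 2 * x 2 + x 3 * x 3 = 1 := by
    simpa [dotProduct, Fin.sum_univ_four] using hx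
  -- Left multiplication by the conjugate of x, which moves only the other chiral part.
  set M : Matrix (Fin 4) (Fin 4) ℝ := !![x 0, x 1, x 2, x 3; -x 1, x 0, x 3, -x 2;
    -x 2, -x 3, x 0, x 1; -x 3, x 2, -x 1, x 0] with hM
  have h1 : M * Mᵀ = 1 := by
    ext i j
    fin_cases i <;> fin_cases j <;> simp [hM, Matrix.mul_apply, Fin.sum_univ_four] <;>
      first | ring1 | linear_combination hx'
  have h2 : M.det = 1 := by
    have : M.det = (x 0 * x 0 + x 1 * x 1 + x 2 * x 2 + x 3 * x 3) ^ 2 := by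
      simp [hM, Matrix.det_succ_row_zero, Fin.sum_univ_succ, Fin.succAbove]; ring
    rw [this, hx', one_pow]
  refine ⟨SO4.mk M h1 h2, fun a b => ?_⟩
  have key : act (SO4.mk M h1 h2) (ofParts a b) = ofParts (rot x a) ((x ⬝ᵥ x) • b) := by
    ext i j
    fin_cases i <;> fin_cases j <;>
      simp [act, SO4.mk, hM, ofParts, rot, Matrix.mul_apply, Fin.sum_univ_four, dotProduct] <;> ring
  rw [key, hx, one_smul]

/-- Any two pairs of unit vectors are related by an `SO(4)` rotation of their bivectors. -/
theorem exists_act_ofParts_conjSigma (m n : SU2) : ∃ h : SO4, ∀ j : ℝ,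
    act h (ofParts (j • ![0, 0, 1]) (-(j • ![0, 0, 1]))) =
      ofParts (j • pauliCoord (conjSigma m)) (-(j • pauliCoord (conjSigma n))) := by
  obtain ⟨h, hh⟩ := exists_act_plusPart (SU2.unitVec_dot_self m)
  obtain ⟨k, hk⟩ := exists_act_minusPart (SU2.unitVec_dot_self n)
  refine ⟨h * k, fun j => ?_⟩
  rw [act_mul, hk, hh, conjSigma_eq, conjSigma_eq, pauliCoord_pauliVec, pauliCoord_pauliVec,
    rot_smul, ← neg_smul, rot_smul, neg_smul]

/-! ### Bases of `ℝ⁴` and dual vectors -/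

theorem eq_of_dot {a b c d : Vec} (h : det4 a b c d ≠ 0) {x y : Vec} (ha : x ⬝ᵥ a = y ⬝ᵥ a)
    (hb : x ⬝ᵥ b = y ⬝ᵥ b) (hc : x ⬝ᵥ c = y ⬝ᵥ c) (hd : x ⬝ᵥ d = y ⬝ᵥ d) : x = y := by
  have hu : IsUnit (Matrix.of ![a, b, c, d]) := by
    rw [Matrix.isUnit_iff_isUnit_det]; exact isUnit_iff_ne_zero.2 h
  apply Matrix.mulVec_injective_of_isUnit hu
  rw [dotProduct_comm x, dotProduct_comm y] at ha hb hc hd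
  ext i
  fin_cases i
  exacts [ha, hb, hc, hd]

theorem exists_dot_eq {a b c d : Vec} (h : det4 a b c d ≠ 0) (t : Fin 4 → ℝ) :
    ∃ x : Vec, x ⬝ᵥ a = t 0 ∧ x ⬝ᵥ b = t 1 ∧ x ⬝ᵥ c = t 2 ∧ x ⬝ᵥ d = t 3 := by
  have hu : IsUnit (Matrix.of ![a, b, c, d]).det := isUnit_iff_ne_zero.2 h
  have key : Matrix.of ![a, b, c, d] *ᵥ ((Matrix.of ![a, b, c, d])⁻¹ *ᵥ t) = t := by
    rw [Matrix.mulVec_mulVec, Matrix.mul_nonsing_inv _ hu, Matrix.one_mulVec]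
  refine ⟨(Matrix.of ![a, b, c, d])⁻¹ *ᵥ t, ?_⟩
  set x := (Matrix.of ![a, b, c, d])⁻¹ *ᵥ t
  rw [dotProduct_comm x a, dotProduct_comm x b, dotProduct_comm x c, dotProduct_comm x d]
  exact ⟨congrFun key 0, congrFun key 1, congrFun key 2, congrFun key 3⟩

theorem biv_eq_of_basis {a : Fin 4 → Vec} (h : det4 (a 0) (a 1) (a 2) (a 3) ≠ 0) {X Y : Biv}
    (hXY : ∀ i j, a i ⬝ᵥ (X *ᵥ a j) = a i ⬝ᵥ (Y *ᵥ a j)) : X = Y := by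
  have hA : (Matrix.of ![a 0, a 1, a 2, a 3]) = Matrix.of a := by
    ext i j; fin_cases i <;> rfl
  have hu : IsUnit (Matrix.of a) := by
    rw [Matrix.isUnit_iff_isUnit_det, ← hA]; exact isUnit_iff_ne_zero.2 h
  have hu' : IsUnit (Matrix.of a)ᵀ := by
    rw [Matrix.isUnit_iff_isUnit_det, Matrix.det_transpose, ← Matrix.isUnit_iff_isUnit_det]
    exact hu
  have key : ∀ Z : Biv, ∀ i j, (Matrix.of a * Z * (Matrix.of a)ᵀ) i j = a i ⬝ᵥ (Z *ᵥ a j) := by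
    intro Z i j
    rw [Matrix.mul_assoc, Matrix.mul_apply]
    rfl
  have : Matrix.of a * X * (Matrix.of a)ᵀ = Matrix.of a * Y * (Matrix.of a)ᵀ := by
    ext i j; rw [key, key, hXY]
  exact hu.mul_left_cancel (hu'.mul_right_cancel this)

/-- The Hodge dual of the wedge product of two basis vectors is the wedge product of the two
complementary vectors of the dual basis, times the volume. -/
theorem hodge_wedge_eq_dual {a b c d x y : Vec} (h : det4 a b c d ≠ 0)
    (hx : x ⬝ᵥ a = 0 ∧ x ⬝ᵥ b = 0 ∧ x ⬝ᵥ c = 1 ∧ x ⬝ᵥ d = 0)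
    (hy : y ⬝ᵥ a = 0 ∧ y ⬝ᵥ b = 0 ∧ y ⬝ᵥ c = 0 ∧ y ⬝ᵥ d = 1) :
    hodge (wedge a b) = det4 a b c d • wedge x y := by
  obtain ⟨h1, h2, h3, h4⟩ := hx
  obtain ⟨g1, g2, g3, g4⟩ := hy
  refine biv_eq_of_basis (a := ![a, b, c, d]) h fun i j => ?_
  rw [dot_hodge_wedge, Matrix.smul_mulVec, dotProduct_smul, wedge_mulVec, dotProduct_sub,
    dotProduct_smul, dotProduct_smul, dotProduct_comm _ x, dotProduct_comm _ y]
  fin_cases i <;> fin_cases j <;> simp [h1, h2, h3, h4, g1, g2, g3, g4] <;>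
    simp only [det4_eq] <;> ring

theorem det4_mul_dual {a b c d x y z w : Vec}
    (hx : x ⬝ᵥ a = 1 ∧ x ⬝ᵥ b = 0 ∧ x ⬝ᵥ c = 0 ∧ x ⬝ᵥ d = 0)
    (hy : y ⬝ᵥ a = 0 ∧ y ⬝ᵥ b = 1 ∧ y ⬝ᵥ c = 0 ∧ y ⬝ᵥ d = 0)
    (hz : z ⬝ᵥ a = 0 ∧ z ⬝ᵥ b = 0 ∧ z ⬝ᵥ c = 1 ∧ z ⬝ᵥ d = 0)
    (hw : w ⬝ᵥ a = 0 ∧ w ⬝ᵥ b = 0 ∧ w ⬝ᵥ c = 0 ∧ w ⬝ᵥ d = 1) :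
    det4 x y z w * det4 a b c d = 1 := by
  have : Matrix.of ![x, y, z, w] * (Matrix.of ![a, b, c, d])ᵀ = 1 := by
    ext i j
    have h : (Matrix.of ![x, y, z, w] * (Matrix.of ![a, b, c, d])ᵀ) i j =
        ![x, y, z, w] i ⬝ᵥ ![a, b, c, d] j := rfl
    rw [h]
    fin_cases i <;> fin_cases j <;> simp [hx, hy, hz, hw]
  rw [det4, det4, ← Matrix.det_transpose (Matrix.of ![a, b, c, d]), ← Matrix.det_mul, this,
    Matrix.det_one]

theorem det4_ne_zero_wedge {a b c d : Vec} (h : det4 a b c d ≠ 0) : wedge a b ≠ 0 := fun h0 => by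
  have := wedge4_wedge a b c d
  rw [h0] at this
  simp [wedge4_eq] at this
  exact h this

/-- A unit normal to three linearly independent vectors. -/
theorem exists_unit_normal {a b c d : Vec} (h : det4 a b c d ≠ 0) :
    ∃ n : Vec, n ⬝ᵥ n = 1 ∧ n ⬝ᵥ a = 0 ∧ n ⬝ᵥ b = 0 ∧ n ⬝ᵥ c = 0 ∧ det4 a b c n ≠ 0 := by
  obtain ⟨x, hxa, hxb, hxc, hxd⟩ := exists_dot_eq h ![0, 0, 0, 1]
  simp at hxa hxb hxc hxd
  have hx0 : x ≠ 0 := fun h => by simp [h] at hxd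
  have hl := len_pos hx0
  -- A kernel vector y is orthogonal to a, b, c, hence a multiple of x, and it is orthogonal to x,
  -- hence zero.
  have hdet : det4 a b c x ≠ 0 := by
    intro h0
    obtain ⟨y, hy0, hy⟩ := Matrix.exists_mulVec_eq_zero_iff.2 h0
    have ha : y ⬝ᵥ a = 0 := by rw [dotProduct_comm]; exact congrFun hy 0
    have hb : y ⬝ᵥ b = 0 := by rw [dotProduct_comm]; exact congrFun hy 1
    have hc : y ⬝ᵥ c = 0 := by rw [dotProduct_comm]; exact congrFun hy 2
    have hx : x ⬝ᵥ y = 0 := congrFun hy 3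
    have hyx : y = (y ⬝ᵥ d) • x :=
      eq_of_dot h (by simp [ha, hxa]) (by simp [hb, hxb]) (by simp [hc, hxc]) (by simp [hxd])
    have : y ⬝ᵥ y = 0 := by
      nth_rw 1 [hyx]; simp [hx]
    exact hy0 (dotProduct_self_eq_zero.1 this)
  refine ⟨(len x)⁻¹ • x, ?_, by simp [hxa], by simp [hxb], by simp [hxc], ?_⟩
  · rw [smul_dotProduct, dotProduct_smul, ← len_sq, smul_eq_mul, smul_eq_mul]
    field_simp
  · have : det4 a b c ((len x)⁻¹ • x) = (len x)⁻¹ * det4 a b c x := by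
      simp only [det4_eq, Pi.smul_apply, smul_eq_mul]; ring
    rw [this]
    exact mul_ne_zero (inv_ne_zero hl.ne') hdet

/-- The linear map between the two bases is orthogonal because the Gram matrices agree, and has
determinant one because the volumes agree. -/
theorem exists_isometry_of_det {a b c n a' b' c' n' : Vec} (h : det4 a b c n ≠ 0)
    (hd : det4 a' b' c' n' = det4 a b c n)
    (hG : Matrix.of ![a, b, c, n] * (Matrix.of ![a, b, c, n])ᵀ =
      Matrix.of ![a', b', c', n'] * (Matrix.of ![a', b', c', n'])ᵀ) :
    ∃ Ω : SO4, (Ω : Matrix (Fin 4) (Fin 4) ℝ) *ᵥ a = a' ∧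
      (Ω : Matrix (Fin 4) (Fin 4) ℝ) *ᵥ b = b' ∧ (Ω : Matrix (Fin 4) (Fin 4) ℝ) *ᵥ c = c' := by
  rw [det4, det4] at hd
  rw [det4] at h
  set M := Matrix.of ![a, b, c, n] with hM
  set M' := Matrix.of ![a', b', c', n'] with hM'
  have hu : IsUnit Mᵀ.det := by rw [Matrix.det_transpose]; exact isUnit_iff_ne_zero.2 h
  have hu' : IsUnit M.det := isUnit_iff_ne_zero.2 h
  have hinv : (M'ᵀ * Mᵀ⁻¹) * Mᵀ = M'ᵀ := by
    rw [Matrix.mul_assoc, Matrix.nonsing_inv_mul _ hu, Matrix.mul_one]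
  have horth : (M'ᵀ * Mᵀ⁻¹)ᵀ * (M'ᵀ * Mᵀ⁻¹) = 1 := by
    rw [Matrix.transpose_mul, Matrix.transpose_transpose, Matrix.transpose_nonsing_inv,
      Matrix.transpose_transpose]
    calc M⁻¹ * M' * (M'ᵀ * Mᵀ⁻¹) = M⁻¹ * (M' * M'ᵀ) * Mᵀ⁻¹ := by simp only [Matrix.mul_assoc]
      _ = (M⁻¹ * M) * (Mᵀ * Mᵀ⁻¹) := by rw [← hG]; simp only [Matrix.mul_assoc]
      _ = 1 := by rw [Matrix.nonsing_inv_mul _ hu', Matrix.mul_nonsing_inv _ hu, Matrix.one_mul]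
  have hdet : (M'ᵀ * Mᵀ⁻¹).det = 1 := by
    have := congrArg Matrix.det hinv
    rw [Matrix.det_mul, Matrix.det_transpose, Matrix.det_transpose, hd] at this
    exact mul_right_cancel₀ h (by rw [this, one_mul])
  have hcol : ∀ i, (M'ᵀ * Mᵀ⁻¹) *ᵥ (M i) = M' i := fun i => by
    ext j
    exact congrFun (congrFun hinv j) i
  exact ⟨SO4.mk _ (mul_eq_one_comm.1 horth) hdet, hcol 0, hcol 1, hcol 2⟩

/-- Three linearly independent vectors are mapped by a rotation to any three vectors with the same
scalar products. -/
theorem exists_isometry {a b c d a' b' c' d' : Vec} (h : det4 a b c d ≠ 0)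
    (h' : det4 a' b' c' d' ≠ 0) (haa : a' ⬝ᵥ a' = a ⬝ᵥ a) (hbb : b' ⬝ᵥ b' = b ⬝ᵥ b)
    (hcc : c' ⬝ᵥ c' = c ⬝ᵥ c) (hab : a' ⬝ᵥ b' = a ⬝ᵥ b) (hac : a' ⬝ᵥ c' = a ⬝ᵥ c)
    (hbc : b' ⬝ᵥ c' = b ⬝ᵥ c) :
    ∃ Ω : SO4, (Ω : Matrix (Fin 4) (Fin 4) ℝ) *ᵥ a = a' ∧
      (Ω : Matrix (Fin 4) (Fin 4) ℝ) *ᵥ b = b' ∧ (Ω : Matrix (Fin 4) (Fin 4) ℝ) *ᵥ c = c' := by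
  obtain ⟨n, hn, hna, hnb, hnc, hdet⟩ := exists_unit_normal h
  obtain ⟨m, hm, hma, hmb, hmc, hdet'⟩ := exists_unit_normal h'
  have gram : ∀ m : Vec, m ⬝ᵥ m = 1 → m ⬝ᵥ a' = 0 → m ⬝ᵥ b' = 0 → m ⬝ᵥ c' = 0 →
      Matrix.of ![a, b, c, n] * (Matrix.of ![a, b, c, n])ᵀ =
      Matrix.of ![a', b', c', m] * (Matrix.of ![a', b', c', m])ᵀ := by
    intro m hm hma hmb hmc
    ext i j
    change ![a, b, c, n] i ⬝ᵥ ![a, b, c, n] j = ![a', b', c', m] i ⬝ᵥ ![a', b', c', m] j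
    fin_cases i <;> fin_cases j <;>
      simp [haa, hbb, hcc, hab, hac, hbc, hm, hn, hna, hnb, hnc, hma, hmb, hmc,
        dotProduct_comm b a, dotProduct_comm c a, dotProduct_comm c b, dotProduct_comm b' a',
        dotProduct_comm c' a', dotProduct_comm c' b', dotProduct_comm _ n, dotProduct_comm _ m]
  have hsq : det4 a b c n ^ 2 = det4 a' b' c' m ^ 2 := by
    have := congrArg Matrix.det (gram m hm hma hmb hmc)
    rw [Matrix.det_mul, Matrix.det_mul, Matrix.det_transpose, Matrix.det_transpose] at this
    rw [sq, sq]; exact this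
  -- Equal Gram matrices fix the volume up to sign; reversing the free unit normal m corrects the
  -- orientation.
  rcases sq_eq_sq_iff_eq_or_eq_neg.1 hsq with h1 | h1
  · exact exists_isometry_of_det hdet h1.symm (gram m hm hma hmb hmc)
  · refine exists_isometry_of_det (n' := -m) hdet ?_
      (gram (-m) (by simpa using hm) (by simpa using hma) (by simpa using hmb) (by simpa using hmc))
    rw [h1]; simp only [det4_eq, Pi.neg_apply]; ring

/-- The quotient rotation fixes a hyperplane pointwise, so it scales the normal, and determinant one
forces the scale factor to be one. -/
theorem SO4.eq_of_mulVec {a b c d : Vec} (h : det4 a b c d ≠ 0) {Ω Ω' : SO4}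
    (ha : (Ω : Matrix (Fin 4) (Fin 4) ℝ) *ᵥ a = (Ω' : Matrix (Fin 4) (Fin 4) ℝ) *ᵥ a)
    (hb : (Ω : Matrix (Fin 4) (Fin 4) ℝ) *ᵥ b = (Ω' : Matrix (Fin 4) (Fin 4) ℝ) *ᵥ b)
    (hc : (Ω : Matrix (Fin 4) (Fin 4) ℝ) *ᵥ c = (Ω' : Matrix (Fin 4) (Fin 4) ℝ) *ᵥ c) : Ω = Ω' := by
  obtain ⟨n, hn, hna, hnb, hnc, hdet⟩ := exists_unit_normal h
  have hR : ∀ x : Vec, (Ω : Matrix (Fin 4) (Fin 4) ℝ) *ᵥ x = (Ω' : Matrix (Fin 4) (Fin 4) ℝ) *ᵥ x →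
      ((Ω'⁻¹ * Ω : SO4) : Matrix (Fin 4) (Fin 4) ℝ) *ᵥ x = x := fun x hx => by
    rw [Submonoid.coe_mul, ← Matrix.mulVec_mulVec, hx, SO4.inv_mulVec]
  set R := Ω'⁻¹ * Ω with hRdef
  have hRd : ∀ x : Vec, (R : Matrix (Fin 4) (Fin 4) ℝ) *ᵥ x = x →
      ((R : Matrix (Fin 4) (Fin 4) ℝ) *ᵥ n) ⬝ᵥ x = n ⬝ᵥ x := fun x hx => by
    conv_lhs => rw [← hx]
    exact SO4.mulVec_dot R n x
  have hRn : (R : Matrix (Fin 4) (Fin 4) ℝ) *ᵥ n =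
      (((R : Matrix (Fin 4) (Fin 4) ℝ) *ᵥ n) ⬝ᵥ n) • n := by
    refine eq_of_dot hdet ?_ ?_ ?_ ?_
    · rw [hRd a (hR a ha), smul_dotProduct, hna, smul_zero]
    · rw [hRd b (hR b hb), smul_dotProduct, hnb, smul_zero]
    · rw [hRd c (hR c hc), smul_dotProduct, hnc, smul_zero]
    · rw [smul_dotProduct, hn, smul_eq_mul, mul_one]
  set t := ((R : Matrix (Fin 4) (Fin 4) ℝ) *ᵥ n) ⬝ᵥ n
  have ht : t = 1 := by
    have h1 := det4_mulVec (R : Matrix (Fin 4) (Fin 4) ℝ) a b c n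
    rw [hR a ha, hR b hb, hR c hc, hRn, SO4.det, one_mul] at h1
    have h2 : det4 a b c (t • n) = t * det4 a b c n := by
      simp only [det4_eq, Pi.smul_apply, smul_eq_mul]; ring
    rw [h2] at h1
    exact mul_right_cancel₀ hdet (by rw [h1, one_mul])
  rw [ht, one_smul] at hRn
  have hR1 : ∀ x : Vec, (R : Matrix (Fin 4) (Fin 4) ℝ) *ᵥ x = x := by
    intro x
    refine eq_of_dot hdet ?_ ?_ ?_ ?_
    · conv_lhs => rw [← hR a ha]
      exact SO4.mulVec_dot R x a
    · conv_lhs => rw [← hR b hb]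
      exact SO4.mulVec_dot R x b
    · conv_lhs => rw [← hR c hc]
      exact SO4.mulVec_dot R x c
    · conv_lhs => rw [← hRn]
      exact SO4.mulVec_dot R x n
  have : R = 1 := by
    apply Subtype.ext
    apply Matrix.toLin'.injective
    refine LinearMap.ext fun x => ?_
    simpa using hR1 x
  rw [hRdef, inv_mul_eq_one] at this
  exact this.symm

/-! ### Rigidity of bivectors of a tetrahedron -/

/-- Contract with the vector α dual to a. The equation for b ∧ c shows that α annihilates b' and c',
since b' ∧ c' ≠ 0; the other two then make b' and c' multiples of b and c with the same factor k =
η/(a'·α). Its square is η by the equation for b ∧ c. -/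
theorem wedge_pair_rigid {a b c d a' b' c' : Vec} {η : ℝ} (h : det4 a b c d ≠ 0) (hη : η ≠ 0)
    (hab : wedge a' b' = η • wedge a b) (hac : wedge a' c' = η • wedge a c)
    (hbc : wedge b' c' = η • wedge b c) : ∃ k : ℝ, k ^ 2 = η ∧ b' = k • b ∧ c' = k • c := by
  obtain ⟨α, h1, h2, h3, -⟩ := exists_dot_eq h ![1, 0, 0, 0]
  simp at h1 h2 h3
  have hbc0 : wedge b c ≠ 0 := by
    have : det4 b c a d ≠ 0 := by
      have : det4 b c a d = det4 a b c d := by simp only [det4_eq]; ring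
      rwa [this]
    exact det4_ne_zero_wedge this
  have hbc0' : wedge b' c' ≠ 0 := by rw [hbc]; exact smul_ne_zero hη hbc0
  have e1 := congrArg (· *ᵥ α) hab
  have e2 := congrArg (· *ᵥ α) hac
  have e3 := congrArg (· *ᵥ α) hbc
  simp only [Matrix.smul_mulVec, wedge_mulVec, dotProduct_comm a α, dotProduct_comm b α,
    dotProduct_comm c α, h1, h2, h3] at e1 e2 e3
  simp at e1 e2 e3
  have hcα : c' ⬝ᵥ α = 0 := by
    have := congrArg (wedge · c') e3
    simp only [sub_eq_add_neg, wedge_add_left, wedge_neg_left, wedge_smul_left, wedge_self] at this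
    have h0 : wedge 0 c' = 0 := by ext i j; simp [wedge_apply]
    rw [h0] at this
    simpa [hbc0'] using this
  have hbα : b' ⬝ᵥ α = 0 := by
    have := congrArg (wedge b' ·) e3
    simp only [sub_eq_add_neg, wedge_add_right, wedge_neg_right, wedge_smul_right, wedge_self,
      wedge_zero_right] at this
    simpa [hbc0'] using this
  rw [hbα] at e1
  rw [hcα] at e2
  simp at e1 e2
  have ha : a' ⬝ᵥ α ≠ 0 := fun h0 => by
    rw [h0, zero_smul] at e1
    have hb0 : b = 0 := (smul_eq_zero.1 e1.symm).resolve_left hη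
    apply hbc0; rw [hb0]; ext i j; simp [wedge_apply]
  have eb : b' = (η / (a' ⬝ᵥ α)) • b := by
    rw [div_eq_inv_mul, mul_smul, ← e1, smul_smul, inv_mul_cancel₀ ha, one_smul]
  have ec : c' = (η / (a' ⬝ᵥ α)) • c := by
    rw [div_eq_inv_mul, mul_smul, ← e2, smul_smul, inv_mul_cancel₀ ha, one_smul]
  refine ⟨_, ?_, eb, ec⟩
  rw [eb, ec, wedge_smul_left, wedge_smul_right, smul_smul, ← sq] at hbc
  exact smul_left_injective ℝ hbc0 hbc

/-- Applying the pair version twice gives one common factor k with k² = η. A real square cannot be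
-1, which is what makes the global sign ε an invariant of the bivectors. -/
theorem wedge_triple_rigid {a b c d a' b' c' : Vec} {η : ℤˣ} (h : det4 a b c d ≠ 0)
    (hab : wedge a' b' = η • wedge a b) (hac : wedge a' c' = η • wedge a c)
    (hbc : wedge b' c' = η • wedge b c) :
    η = 1 ∧ ∃ s : ℤˣ, a' = s • a ∧ b' = s • b ∧ c' = s • c := by
  have hη : ∀ X : Biv, η • X = ((η : ℤ) : ℝ) • X := fun X => by
    rw [Units.smul_def, ← Int.cast_smul_eq_zsmul ℝ]
  rw [hη] at hab hac hbc
  have hη0 : ((η : ℤ) : ℝ) ≠ 0 := by exact_mod_cast η.ne_zero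
  obtain ⟨k, hk, hb, hc⟩ := wedge_pair_rigid h hη0 hab hac hbc
  have h' : det4 b a c d ≠ 0 := by
    have : det4 b a c d = - det4 a b c d := by simp only [det4_eq]; ring
    rw [this]; exact neg_ne_zero.2 h
  obtain ⟨l, -, ha, hc'⟩ := wedge_pair_rigid h' hη0
    (by rw [wedge_swap, hab, wedge_swap a b, smul_neg]) hbc hac
  have hc0 : c ≠ 0 := fun h0 => h (by rw [h0]; simp [det4_eq])
  have hkl : k = l := by
    rw [hc] at hc'
    exact smul_left_injective ℝ hc0 hc'
  subst hkl
  rcases Int.units_eq_one_or η with rfl | rfl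
  · refine ⟨rfl, ?_⟩
    simp at hk
    rcases hk with rfl | rfl
    · exact ⟨1, by simpa using ha, by simpa using hb, by simpa using hc⟩
    · exact ⟨-1, by simpa using ha, by simpa using hb, by simpa using hc⟩
  · exfalso
    simp at hk
    nlinarith [sq_nonneg k]

/-! ### Orderings -/

section Ordering

variable {ι : Type*} {k : ℕ}

theorem exists_ordering_one (e : Fin k ≃ ι) (i : Fin k) (p : ι) : ∃ e' : Fin k ≃ ι, e' i = p :=
  ⟨(Equiv.swap i (e.symm p)).trans e, by simp⟩

theorem exists_ordering_two (e : Fin k ≃ ι) {i j : Fin k} (hij : i ≠ j) {p q : ι} (hpq : p ≠ q) :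
    ∃ e' : Fin k ≃ ι, e' i = p ∧ e' j = q := by
  obtain ⟨e, he⟩ := exists_ordering_one e i p
  refine ⟨(Equiv.swap j (e.symm q)).trans e, ?_, by simp⟩
  rw [Equiv.trans_apply, Equiv.swap_apply_of_ne_of_ne hij, he]
  rintro rfl
  exact hpq (by rw [← he, Equiv.apply_symm_apply])

theorem exists_ordering_three (e : Fin k ≃ ι) {i j l : Fin k} (hij : i ≠ j) (hil : i ≠ l)
    (hjl : j ≠ l) {p q r : ι} (hpq : p ≠ q) (hpr : p ≠ r) (hqr : q ≠ r) :
    ∃ e' : Fin k ≃ ι, e' i = p ∧ e' j = q ∧ e' l = r := by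
  obtain ⟨e, he, he'⟩ := exists_ordering_two e hij hpq
  refine ⟨(Equiv.swap l (e.symm r)).trans e, ?_, ?_, by simp⟩
  · rw [Equiv.trans_apply, Equiv.swap_apply_of_ne_of_ne hil, he]
    rintro rfl
    exact hpr (by rw [← he, Equiv.apply_symm_apply])
  · rw [Equiv.trans_apply, Equiv.swap_apply_of_ne_of_ne hjl, he']
    rintro rfl
    exact hqr (by rw [← he', Equiv.apply_symm_apply])

theorem exists_ordering_four (e : Fin k ≃ ι) {i j l m : Fin k} (hij : i ≠ j) (hil : i ≠ l)
    (hjl : j ≠ l) (him : i ≠ m) (hjm : j ≠ m) (hlm : l ≠ m) {p q r s : ι} (hpq : p ≠ q)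
    (hpr : p ≠ r) (hqr : q ≠ r) (hps : p ≠ s) (hqs : q ≠ s) (hrs : r ≠ s) :
    ∃ e' : Fin k ≃ ι, e' i = p ∧ e' j = q ∧ e' l = r ∧ e' m = s := by
  obtain ⟨e, h1, h2, h3⟩ := exists_ordering_three e hij hil hjl hpq hpr hqr
  have key : ∀ {a : Fin k} {x : ι}, a ≠ m → e a = x → x ≠ s →
      ((Equiv.swap m (e.symm s)).trans e) a = x := by
    rintro a x ham rfl hxs
    rw [Equiv.trans_apply, Equiv.swap_apply_of_ne_of_ne ham]
    rintro rfl
    exact hxs (by rw [Equiv.apply_symm_apply])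
  exact ⟨(Equiv.swap m (e.symm s)).trans e, key him h1 hps, key hjm h2 hqs, key hlm h3 hrs, by simp⟩

theorem sum_ordering [Fintype ι] {M : Type*} [AddCommMonoid M] (e : Fin 5 ≃ ι) (f : ι → M) :
    ∑ p, f p = f (e 0) + f (e 1) + f (e 2) + f (e 3) + f (e 4) := by
  rw [← e.sum_comp, Fin.sum_univ_five]

end Ordering

/-! ### Geometry of a 4-simplex -/

section Simplex

variable {ι : Type*}

/-- Edge vectors of a 4-simplex. -/
structure IsEdgeFamily (E : ι → ι → Vec) : Prop where
  antisymm : ∀ p q, E q p = - E p q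
  closure : ∀ p q r, E p q + E q r + E r p = 0

/-- `U` is dual to the edge vectors `E`. -/
def IsDual [DecidableEq ι] (E : ι → ι → Vec) (U : ι → Vec) : Prop :=
  ∀ p q r, U p ⬝ᵥ E q r = (if q = p then 1 else 0) - (if r = p then 1 else 0)

/-- The volume form of a 4-simplex, for an ordering of its vertices. -/
def simplexVol (E : ι → ι → Vec) (e : Fin 5 ≃ ι) : ℝ :=
  det4 (E (e 1) (e 0)) (E (e 2) (e 0)) (E (e 3) (e 0)) (E (e 4) (e 0))

variable {E : ι → ι → Vec} {U : ι → Vec}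

theorem IsEdgeFamily.eq_sub (hE : IsEdgeFamily E) (p q o : ι) : E p q = E p o - E q o := by
  have h1 := hE.closure p q o
  have h2 := hE.antisymm p o
  rw [h2] at h1
  rw [← sub_eq_zero, ← h1]; abel

theorem IsEdgeFamily.self (hE : IsEdgeFamily E) (p : ι) : E p p = 0 := by
  rw [hE.eq_sub p p p, sub_self]

theorem IsEdgeFamily.of_points (x : ι → Vec) : IsEdgeFamily fun p q => x p - x q :=
  ⟨fun _ _ => by abel, fun _ _ _ => by abel⟩

theorem IsEdgeFamily.wedge_eq (hE : IsEdgeFamily E) (p q r : ι) :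
    wedge (E p q) (E q r) = wedge (E q p) (E r p) := by
  rw [hE.eq_sub q r p, hE.antisymm q p, sub_eq_add_neg, wedge_add_right, wedge_neg_left, wedge_self,
    wedge_neg_left, wedge_neg_right]
  simp

/-- The volume equals the 5 × 5 determinant with rows (1, E_{p o}) for a base vertex o that does not
depend on the ordering, and reordering permutes these rows. -/
theorem IsEdgeFamily.simplexVol_trans (hE : IsEdgeFamily E) (e : Fin 5 ≃ ι)
    (π : Equiv.Perm (Fin 5)) :
    simplexVol E (π.trans e) = ((Equiv.Perm.sign π : ℤ) : ℝ) * simplexVol E e := by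
  set o := e 0
  have key : ∀ e : Fin 5 ≃ ι, simplexVol E e =
      Matrix.det (Matrix.of fun i : Fin 5 => (Fin.cons 1 (E (e i) o) : Fin 5 → ℝ)) := by
    intro e
    rw [simplexVol, hE.eq_sub (e 1) (e 0) o, hE.eq_sub (e 2) (e 0) o, hE.eq_sub (e 3) (e 0) o,
      hE.eq_sub (e 4) (e 0) o, det4]
    -- Subtracting row 0 from the others clears the first column except for its top entry.
    rw [Matrix.det_eq_of_forall_row_eq_smul_add_const (B := Matrix.of fun i : Fin 5 =>
      if i = 0 then (Fin.cons 1 (E (e 0) o) : Fin 5 → ℝ) else Fin.cons 0 (E (e i) o - E (e 0) o))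
      (fun i => if i = 0 then 0 else 1) 0 (by simp)
      (fun i j => by
        refine Fin.cases ?_ (fun j => ?_) j <;> by_cases hi : i = 0 <;> simp [hi])]
    refine Eq.trans ?_ (Matrix.det_succ_column_zero _).symm
    rw [Finset.sum_eq_single 0]
    · simp
      congr 1
      ext i j
      fin_cases i <;> simp
    · intro i _ hi
      simp [hi]
    · simp
  rw [key, key, ← Matrix.det_permute]
  rfl

theorem IsEdgeFamily.abs_simplexVol (hE : IsEdgeFamily E) (e e' : Fin 5 ≃ ι) :
    |simplexVol E e| = |simplexVol E e'| := by
  have he : e = (e.trans e'.symm).trans e' := by ext i; simp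
  rw [he, hE.simplexVol_trans]
  rcases Int.units_eq_one_or (Equiv.Perm.sign (e.trans e'.symm)) with h | h <;> rw [h] <;> simp

theorem IsEdgeFamily.simplexVol_ne_zero (hE : IsEdgeFamily E)
    (hs : Submodule.span ℝ (Set.range fun pq : ι × ι => E pq.1 pq.2) = ⊤) (e : Fin 5 ≃ ι) :
    simplexVol E e ≠ 0 := by
  set a : Fin 4 → Vec := ![E (e 1) (e 0), E (e 2) (e 0), E (e 3) (e 0), E (e 4) (e 0)] with ha
  have hmem : ∀ p, E p (e 0) ∈ Submodule.span ℝ (Set.range a) := by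
    intro p
    obtain ⟨i, rfl⟩ := e.surjective p
    refine Fin.cases ?_ (fun i => ?_) i
    · rw [hE.self]; exact Submodule.zero_mem _
    · apply Submodule.subset_span
      refine ⟨i, ?_⟩
      fin_cases i <;> rfl
  have htop : ⊤ ≤ Submodule.span ℝ (Set.range a) := by
    rw [← hs, Submodule.span_le]
    rintro _ ⟨⟨p, q⟩, rfl⟩
    dsimp only
    rw [hE.eq_sub p q (e 0)]
    exact Submodule.sub_mem _ (hmem p) (hmem q)
  have hli : LinearIndependent ℝ a :=
    linearIndependent_of_top_le_span_of_card_eq_finrank htop (by simp)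
  have := Matrix.linearIndependent_rows_iff_isUnit.1
    (show LinearIndependent ℝ (Matrix.of a).row from hli)
  rw [Matrix.isUnit_iff_isUnit_det] at this
  exact this.ne_zero

theorem span_eq_top_of_simplexVol_ne_zero {e : Fin 5 ≃ ι} (h : simplexVol E e ≠ 0) :
    Submodule.span ℝ (Set.range fun pq : ι × ι => E pq.1 pq.2) = ⊤ := by
  set a : Fin 4 → Vec := ![E (e 1) (e 0), E (e 2) (e 0), E (e 3) (e 0), E (e 4) (e 0)] with ha
  have hu : IsUnit (Matrix.of a) := by
    rw [Matrix.isUnit_iff_isUnit_det]; exact isUnit_iff_ne_zero.2 h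
  have hli : LinearIndependent ℝ a := Matrix.linearIndependent_rows_iff_isUnit.2 hu
  have htop := hli.span_eq_top_of_card_eq_finrank' (by simp)
  rw [eq_top_iff, ← htop]
  apply Submodule.span_mono
  rintro _ ⟨i, rfl⟩
  fin_cases i
  exacts [⟨(e 1, e 0), rfl⟩, ⟨(e 2, e 0), rfl⟩, ⟨(e 3, e 0), rfl⟩, ⟨(e 4, e 0), rfl⟩]

variable [DecidableEq ι]

theorem IsEdgeFamily.exists_dual (hE : IsEdgeFamily E) {e : Fin 5 ≃ ι} (h : simplexVol E e ≠ 0) :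
    ∃ U, IsDual E U := by
  have : ∀ p, ∃ x : Vec, ∀ q r,
      x ⬝ᵥ E q r = (if q = p then 1 else 0) - (if r = p then 1 else 0) := by
    intro p
    obtain ⟨x, h1, h2, h3, h4⟩ := exists_dot_eq h fun i =>
      (if e i.succ = p then 1 else 0) - (if e 0 = p then 1 else 0)
    have key : ∀ q, x ⬝ᵥ E q (e 0) = (if q = p then 1 else 0) - (if e 0 = p then 1 else 0) := by
      intro q
      obtain ⟨i, rfl⟩ := e.surjective q
      refine Fin.cases ?_ (fun i => ?_) i
      · rw [hE.self]; simp
      · fin_cases i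
        exacts [h1, h2, h3, h4]
    refine ⟨x, fun q r => ?_⟩
    rw [hE.eq_sub q r (e 0), dotProduct_sub, key, key]; ring
  choose U hU using this
  exact ⟨U, hU⟩

theorem IsDual.dot_self_left (hU : IsDual E U) {p q : ι} (h : p ≠ q) : U p ⬝ᵥ E p q = 1 := by
  rw [hU]; simp [h.symm]

theorem IsDual.dot_other (hU : IsDual E U) {p q r : ι} (h : q ≠ p) (h' : r ≠ p) :
    U p ⬝ᵥ E q r = 0 := by
  rw [hU]; simp [h, h']

theorem IsDual.ne_zero (hU : IsDual E U) {p q : ι} (h : p ≠ q) : U p ≠ 0 := fun h0 => by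
  have := hU.dot_self_left h
  rw [h0] at this
  simp at this

theorem IsDual.unique {e : Fin 5 ≃ ι} (h : simplexVol E e ≠ 0) (hU : IsDual E U) {U' : ι → Vec}
    (hU' : IsDual E U') : U' = U := by
  funext p
  exact eq_of_dot h (by rw [hU, hU']) (by rw [hU, hU']) (by rw [hU, hU']) (by rw [hU, hU'])

/-- The sum pairs to zero with every edge, since each edge starts and ends at exactly one vertex.
This is the source of exterior closure in the converse. -/
theorem IsDual.sum_eq_zero [Fintype ι] {e : Fin 5 ≃ ι} (h : simplexVol E e ≠ 0)
    (hU : IsDual E U) : ∑ p, U p = 0 := by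
  have key : ∀ q r, (∑ p, U p) ⬝ᵥ E q r = 0 ⬝ᵥ E q r := fun q r => by
    rw [sum_dotProduct, zero_dotProduct]
    simp only [hU _ q r, Finset.sum_sub_distrib]
    simp
  exact eq_of_dot h (key _ _) (key _ _) (key _ _) (key _ _)

theorem IsDual.det4_mul_vol (hU : IsDual E U) (e : Fin 5 ≃ ι) :
    det4 (U (e 1)) (U (e 2)) (U (e 3)) (U (e 4)) * simplexVol E e = 1 := by
  apply det4_mul_dual <;> simp [hU _ _ _]

/-- The normals of slots 3 and 4 are the dual basis vectors complementary to the edges from slot 0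
to slots 1 and 2. This identity carries the equivalence of the two bivector formulas. -/
theorem IsDual.hodge_wedge (hE : IsEdgeFamily E) (hU : IsDual E U) {e : Fin 5 ≃ ι}
    (h : simplexVol E e ≠ 0) :
    hodge (wedge (E (e 0) (e 1)) (E (e 1) (e 2))) =
      simplexVol E e • wedge (U (e 3)) (U (e 4)) := by
  rw [hE.wedge_eq]
  apply hodge_wedge_eq_dual h <;> simp [hU _ _ _]

theorem IsDual.det4_ne_zero (hU : IsDual E U) (e : Fin 5 ≃ ι) :
    det4 (U (e 0)) (U (e 1)) (U (e 2)) (U (e 3)) ≠ 0 := by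
  have := hU.det4_mul_vol ((finRotate 5).symm.trans e)
  exact left_ne_zero_of_mul_eq_one this

/-- Vectors orthogonal to the edges of a tetrahedron are multiples of its normal. -/
theorem IsDual.eq_smul_of_orthogonal (hE : IsEdgeFamily E) (hU : IsDual E U) {e : Fin 5 ≃ ι}
    (h : simplexVol E e ≠ 0) {y : Vec}
    (hy : ∀ i j : Fin 5, i ≠ 0 → j ≠ 0 → y ⬝ᵥ E (e i) (e j) = 0) :
    y = -(y ⬝ᵥ E (e 1) (e 0)) • U (e 0) := by
  have key : ∀ i : Fin 5, i ≠ 0 →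
      y ⬝ᵥ E (e i) (e 0) = (-(y ⬝ᵥ E (e 1) (e 0)) • U (e 0)) ⬝ᵥ E (e i) (e 0) := by
    intro i hi
    have h1 := hy i 1 hi (by decide)
    rw [hE.eq_sub (e i) (e 1) (e 0), dotProduct_sub, sub_eq_zero] at h1
    rw [h1, smul_dotProduct, hU]
    simp [hi]
  exact eq_of_dot h (key 1 (by decide)) (key 2 (by decide)) (key 3 (by decide)) (key 4 (by decide))

end Simplex

/-! ### Reconstruction of a 4-simplex from its bivectors -/

section Reconstruction

variable {ι : Type*} {B : ι → ι → Biv} {N : ι → Vec} {W : ι → ι → Vec}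

/-- The plane of the bivector contains N p, and by antisymmetry also N q; non-degeneracy makes these
independent, so they span it. -/
theorem exists_eq_smul_wedge (e : Fin 5 ≃ ι)
    (hBW : ∀ p q, p ≠ q → B p q = wedge (N p) (W p q)) (hB : ∀ p q, B q p = - B p q)
    (hN : ∀ p, N p ≠ 0) (hnd : ∀ e : Fin 5 ≃ ι, wedge4 (B (e 0) (e 1)) (B (e 2) (e 3)) ≠ 0)
    {p q : ι} (hpq : p ≠ q) : ∃ t : ℝ, B p q = t • wedge (N p) (N q) := by
  have hindep : ∀ t : ℝ, N p ≠ t • N q := by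
    intro t ht
    obtain ⟨e, h0, h2⟩ := exists_ordering_two e (i := 0) (j := 2) (by decide) hpq
    apply hnd e
    rw [hBW _ _ (e.injective.ne (by decide)), hBW _ _ (e.injective.ne (by decide)), h0, h2,
      ht, wedge4_wedge]
    simp only [det4_eq, Pi.smul_apply, smul_eq_mul]; ring
  -- y is the part of N p orthogonal to N q; contracting with it expresses W p q through N p and N
  -- q.
  have hq : N q ⬝ᵥ N q ≠ 0 := (dot_self_pos (hN q)).ne'
  set y := N p - ((N p ⬝ᵥ N q) / (N q ⬝ᵥ N q)) • N q with hy
  have hy0 : y ≠ 0 := fun h => hindep _ (sub_eq_zero.1 h)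
  have hqy : N q ⬝ᵥ y = 0 := by
    rw [hy, dotProduct_sub, dotProduct_smul, smul_eq_mul, div_mul_cancel₀ _ hq,
      dotProduct_comm (N q), sub_self]
  have hpy : N p ⬝ᵥ y ≠ 0 := by
    have : N p ⬝ᵥ y = y ⬝ᵥ y := by
      conv_rhs => rw [hy, sub_dotProduct, ← hy, smul_dotProduct, hqy, smul_zero, sub_zero]
    rw [this]; exact (dot_self_pos hy0).ne'
  have h1 := congrArg (· *ᵥ y) (hB p q)
  simp only [hBW p q hpq, hBW q p hpq.symm, Matrix.neg_mulVec, wedge_mulVec, hqy, zero_smul,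
    sub_zero] at h1
  have h2 : W p q = (N p ⬝ᵥ y)⁻¹ • ((W p q ⬝ᵥ y) • N p + (W q p ⬝ᵥ y) • N q) := by
    rw [h1, neg_sub, add_sub_cancel, smul_smul, inv_mul_cancel₀ hpy, one_smul]
  refine ⟨(N p ⬝ᵥ y)⁻¹ * (W q p ⬝ᵥ y), ?_⟩
  rw [hBW p q hpq]
  conv_lhs => rw [h2]
  rw [wedge_smul_right, wedge_add_right, wedge_smul_right, wedge_smul_right, wedge_self, smul_zero,
    zero_add, smul_smul]

/-- Replace the first argument of the determinant by the vanishing sum; the terms with repeated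
vectors drop out. -/
theorem det4_relation {x : ι → Vec} {m : ι → ℝ} [Fintype ι] (h : ∑ p, m p • x p = 0)
    (e : Fin 5 ≃ ι) : m (e 0) * det4 (x (e 0)) (x (e 2)) (x (e 3)) (x (e 4)) +
      m (e 1) * det4 (x (e 1)) (x (e 2)) (x (e 3)) (x (e 4)) = 0 := by
  rw [sum_ordering e] at h
  have h1 : ∀ i, m (e 0) * x (e 0) i + m (e 1) * x (e 1) i + m (e 2) * x (e 2) i +
      m (e 3) * x (e 3) i + m (e 4) * x (e 4) i = 0 := fun i => by
    simpa using congrFun h i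
  have h2 : det4 (fun i => m (e 0) * x (e 0) i + m (e 1) * x (e 1) i + m (e 2) * x (e 2) i +
      m (e 3) * x (e 3) i + m (e 4) * x (e 4) i) (x (e 2)) (x (e 3)) (x (e 4)) = 0 := by
    simp only [h1]; simp [det4_eq]
  rw [← h2]
  simp only [det4_eq]; ring

variable [DecidableEq ι]

/-- The bivectors are proportional to the wedge products of vectors that sum to zero. -/
theorem exists_normals [Fintype ι] (e₀ : Fin 5 ≃ ι)
    (hBW : ∀ p q, p ≠ q → B p q = wedge (N p) (W p q)) (hB : ∀ p q, B q p = - B p q)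
    (hsum : ∀ p, ∑ q, B p q = 0) (hN : ∀ p, N p ≠ 0)
    (hnd : ∀ e : Fin 5 ≃ ι, wedge4 (B (e 0) (e 1)) (B (e 2) (e 3)) ≠ 0) :
    ∃ (μ : ι → ℝ) (c : ℝ), c ≠ 0 ∧ (∀ p, μ p ≠ 0) ∧ ∑ p, μ p • N p = 0 ∧
      (∀ e : Fin 5 ≃ ι, det4 (N (e 0)) (N (e 1)) (N (e 2)) (N (e 3)) ≠ 0) ∧
      ∀ p q, B p q = c • wedge (μ p • N p) (μ q • N q) := by
  have hBself : ∀ p, B p p = 0 := fun p => by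
    have := hB p p
    have h2 : (2 : ℝ) • B p p = 0 := by rw [two_smul]; nth_rw 1 [this]; exact neg_add_cancel _
    exact (smul_eq_zero.1 h2).resolve_left two_ne_zero
  have hex : ∀ p q, ∃ t : ℝ, B p q = t • wedge (N p) (N q) := by
    intro p q
    by_cases hpq : p = q
    · subst hpq
      exact ⟨0, by rw [hBself, zero_smul]⟩
    · exact exists_eq_smul_wedge e₀ hBW hB hN hnd hpq
  choose l hl using hex
  -- Non-degeneracy factors into two coefficients times a determinant: no coefficient vanishes, and
  -- any four normals are independent.
  have hD : ∀ e : Fin 5 ≃ ι, l (e 0) (e 1) * l (e 2) (e 3) ≠ 0 ∧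
      det4 (N (e 0)) (N (e 1)) (N (e 2)) (N (e 3)) ≠ 0 := by
    intro e
    have := hnd e
    rw [hl, hl, wedge4_smul_left, wedge4_smul_right, wedge4_wedge] at this
    constructor <;> intro h0 <;> apply this
    · rw [← mul_assoc, h0, zero_mul]
    · rw [h0]; simp
  have hD' : ∀ e : Fin 5 ≃ ι, det4 (N (e 1)) (N (e 2)) (N (e 3)) (N (e 4)) ≠ 0 := fun e =>
    (hD ((finRotate 5).trans e)).2
  have hD0 : ∀ e : Fin 5 ≃ ι, det4 (N (e 0)) (N (e 2)) (N (e 3)) (N (e 4)) ≠ 0 := fun e => by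
    have := hD' ((Equiv.swap 0 1).trans e)
    exact this
  have hsymm : ∀ p q, p ≠ q → l p q = l q p := by
    intro p q hpq
    have h1 := hB p q
    rw [hl, hl, wedge_swap (N p) (N q), smul_neg, neg_inj] at h1
    obtain ⟨e, rfl, rfl⟩ := exists_ordering_two e₀ (i := 0) (j := 1) (by decide) hpq
    exact (smul_left_injective ℝ (det4_ne_zero_wedge (hD e).2) h1).symm
  -- Five vectors in a space of dimension four satisfy a relation; independence of any four makes
  -- all its coefficients nonzero.
  obtain ⟨m, hm, i₀, hi₀⟩ : ∃ m : ι → ℝ, ∑ p, m p • N p = 0 ∧ ∃ i, m i ≠ 0 := by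
    rw [← Fintype.not_linearIndependent_iff]
    intro hli
    have h1 := hli.fintype_card_le_finrank
    have h2 : Fintype.card ι = 5 := by rw [← Fintype.card_congr e₀]; rfl
    simp [h2] at h1
  have hm0 : ∀ p, m p ≠ 0 := by
    intro p hp
    by_cases h : p = i₀
    · exact hi₀ (h ▸ hp)
    · obtain ⟨e, h0, h1⟩ := exists_ordering_two e₀ (i := 0) (j := 1) (by decide) h
      have h2 := det4_relation hm e
      rw [h0, hp, zero_mul, zero_add, h1, mul_eq_zero] at h2
      have h3 := hD' e
      rw [h1] at h3
      exact h2.elim hi₀ h3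
  -- Closure at e 2 says that N (e 2) ∧ ∑ l N = 0. Wedging with two more normals leaves a relation
  -- between the same two determinants as in `det4_relation`, so the l are in the ratio of the m.
  have hlm : ∀ e : Fin 5 ≃ ι, l (e 2) (e 0) * m (e 1) = l (e 2) (e 1) * m (e 0) := by
    intro e
    have h1 := hsum (e 2)
    simp only [hl] at h1
    have h2 : wedge (N (e 2)) (∑ q, l (e 2) q • N q) = 0 := by
      rw [wedge_sum_right]
      simpa only [wedge_smul_right] using h1
    have h3 : l (e 2) (e 0) * det4 (N (e 0)) (N (e 2)) (N (e 3)) (N (e 4)) +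
        l (e 2) (e 1) * det4 (N (e 1)) (N (e 2)) (N (e 3)) (N (e 4)) = 0 := by
      have h4 := wedge4_wedge (N (e 2)) (∑ q, l (e 2) q • N q) (N (e 3)) (N (e 4))
      rw [h2, sum_ordering e] at h4
      have h5 : wedge4 0 (wedge (N (e 3)) (N (e 4))) = 0 := by simp [wedge4_eq]
      rw [h5] at h4
      simp only [det4_eq, Pi.add_apply, Pi.smul_apply, smul_eq_mul] at h4 ⊢
      linear_combination (1 / 4) * h4
    have h4 := det4_relation hm e
    have h5 := hD0 e
    apply mul_right_cancel₀ h5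
    linear_combination m (e 1) * h3 - l (e 2) (e 1) * h4
  -- The quotient is symmetric and independent of its second index, so it is a single constant c off
  -- the diagonal.
  set κ : ι → ι → ℝ := fun p q => l p q / (m p * m q) with hκ
  have hκs : ∀ p q, p ≠ q → κ p q = κ q p := fun p q h => by
    simp only [hκ, hsymm p q h, mul_comm]
  have hκ3 : ∀ p q r, p ≠ q → p ≠ r → κ p q = κ p r := by
    intro p q r hpq hpr
    by_cases hqr : q = r
    · rw [hqr]
    · obtain ⟨e, h2, h0, h1⟩ := exists_ordering_three e₀ (i := 2) (j := 0) (l := 1) (by decide)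
        (by decide) (by decide) hpq hpr hqr
      have h3 := hlm e
      rw [h0, h1, h2] at h3
      simp only [hκ]
      have := hm0 p; have := hm0 q; have := hm0 r
      field_simp
      linarith
  set c := κ (e₀ 0) (e₀ 1) with hc
  have h01 : e₀ 0 ≠ e₀ 1 := e₀.injective.ne (by decide)
  have hκc : ∀ p q, p ≠ q → κ p q = c := by
    have step : ∀ q, e₀ 0 ≠ q → κ (e₀ 0) q = c := fun q h => hκ3 _ _ _ h h01
    intro p q hpq
    by_cases hp : p = e₀ 0
    · subst hp; exact step q hpq
    · rw [hκ3 p q (e₀ 0) hpq hp, hκs _ _ hp, step p (Ne.symm hp)]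
  refine ⟨m, c, ?_, hm0, hm, fun e => (hD e).2, fun p q => ?_⟩
  · exact div_ne_zero (left_ne_zero_of_mul (hD e₀).1) (mul_ne_zero (hm0 _) (hm0 _))
  · by_cases hpq : p = q
    · subst hpq; rw [hBself, wedge_self, smul_zero]
    · rw [hl, ← hκc p q hpq, wedge_smul_left, wedge_smul_right, smul_smul, smul_smul]
      congr 1
      have := hm0 p; have := hm0 q
      simp only [hκ]; field_simp

/-- Vectors that sum to zero, any four of which are linearly independent, are dual to the edge
vectors of a 4-simplex. -/
theorem exists_edgeFamily_dual [Fintype ι] {U : ι → Vec} (e : Fin 5 ≃ ι) (hU : ∑ p, U p = 0)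
    (hD : det4 (U (e 1)) (U (e 2)) (U (e 3)) (U (e 4)) ≠ 0) :
    ∃ E : ι → ι → Vec, IsEdgeFamily E ∧ IsDual E U := by
  have hx : ∀ q : ι, ∃ x : Vec, ∀ i : Fin 4, x ⬝ᵥ U (e i.succ) = (if q = e i.succ then 1 else 0) := by
    intro q
    obtain ⟨x, h1, h2, h3, h4⟩ := exists_dot_eq hD fun i => if q = e i.succ then 1 else 0
    refine ⟨x, fun i => ?_⟩
    fin_cases i
    exacts [h1, h2, h3, h4]
  choose x hx using hx
  -- The x q are vertex positions with e 0 at the origin; the remaining pairing with U (e 0) comes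
  -- from the vanishing sum.
  refine ⟨fun p q => x p - x q, IsEdgeFamily.of_points x, ?_⟩
  have h0 : ∀ q, x q ⬝ᵥ U (e 0) = (if q = e 0 then 1 else 0) - 1 := by
    intro q
    rw [sum_ordering e] at hU
    have h1 := congrArg (x q ⬝ᵥ ·) hU
    have h2 := hx q 0
    have h3 := hx q 1
    have h4 := hx q 2
    have h5 := hx q 3
    simp only [dotProduct_add, dotProduct_zero] at h1
    simp only [Fin.succ_zero_eq_one, show (1 : Fin 4).succ = 2 from rfl,
      show (2 : Fin 4).succ = 3 from rfl, show (3 : Fin 4).succ = 4 from rfl] at h2 h3 h4 h5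
    rw [h2, h3, h4, h5] at h1
    obtain ⟨i, rfl⟩ := e.surjective q
    simp only [e.injective.eq_iff] at h1 ⊢
    fin_cases i <;> simp at h1 ⊢ <;> linarith
  have key : ∀ p q, U p ⬝ᵥ x q = (if q = p then 1 else 0) - (if p = e 0 then 1 else 0) := by
    intro p q
    rw [dotProduct_comm]
    obtain ⟨i, rfl⟩ := e.surjective p
    refine Fin.cases ?_ (fun i => ?_) i
    · rw [h0]; simp
    · rw [hx]; simp
  intro p q r
  dsimp only
  rw [dotProduct_sub, key, key]; ring

/-- Reconstruction: bivectors that satisfy the simplicity, closure and non-degeneracy conditions come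
from the edge vectors of a 4-simplex. -/
theorem exists_edgeFamily [Fintype ι] (e : Fin 5 ≃ ι)
    (hBW : ∀ p q, p ≠ q → B p q = wedge (N p) (W p q)) (hB : ∀ p q, B q p = - B p q)
    (hsum : ∀ p, ∑ q, B p q = 0) (hN : ∀ p, N p ≠ 0)
    (hnd : ∀ e : Fin 5 ≃ ι, wedge4 (B (e 0) (e 1)) (B (e 2) (e 3)) ≠ 0) :
    ∃ (ε : ℤˣ) (E : ι → ι → Vec) (U : ι → Vec), IsEdgeFamily E ∧ IsDual E U ∧
      simplexVol E e ≠ 0 ∧ (∀ p q, B p q = ε • (simplexVol E e • wedge (U p) (U q))) ∧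
      ∀ p, ∃ k : ℝ, k ≠ 0 ∧ U p = k • N p := by
  obtain ⟨m, c, hc, hm0, hm, hD, hBc⟩ := exists_normals e hBW hB hsum hN hnd
  set D := det4 (m (e 1) • N (e 1)) (m (e 2) • N (e 2)) (m (e 3) • N (e 3)) (m (e 4) • N (e 4))
    with hDdef
  have hD0 : D ≠ 0 := by
    have h1 : D = m (e 1) * m (e 2) * m (e 3) * m (e 4) *
        det4 (N (e 1)) (N (e 2)) (N (e 3)) (N (e 4)) := by
      rw [hDdef]; simp only [det4_eq, Pi.smul_apply, smul_eq_mul]; ring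
    rw [h1]
    exact mul_ne_zero (mul_ne_zero (mul_ne_zero (mul_ne_zero (hm0 _) (hm0 _)) (hm0 _)) (hm0 _))
      (hD ((finRotate 5).trans e))
  have hcD : 0 < |c * D| := abs_pos.2 (mul_ne_zero hc hD0)
  -- With U = α m N one has V₄ = 1/(α⁴ D), so ε V₄ U ∧ U = c (mN) ∧ (mN) requires α² = ε/(cD): ε
  -- must be the sign of cD and α² = 1/|cD|.
  set α := Real.sqrt (|c * D|⁻¹) with hα
  have hα0 : 0 < α := Real.sqrt_pos.2 (inv_pos.2 hcD)
  have hα2 : α ^ 2 = |c * D|⁻¹ := Real.sq_sqrt (inv_pos.2 hcD).le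
  obtain ⟨ε, hε⟩ : ∃ ε : ℤˣ, ((ε : ℤ) : ℝ) * |c * D| = c * D := by
    rcases le_or_gt 0 (c * D) with h | h
    · exact ⟨1, by simp [abs_of_nonneg h]⟩
    · exact ⟨-1, by simp [abs_of_neg h]⟩
  set U : ι → Vec := fun p => α • (m p • N p) with hUdef
  have hUsum : ∑ p, U p = 0 := by
    rw [hUdef, ← Finset.smul_sum, hm, smul_zero]
  have hUD : det4 (U (e 1)) (U (e 2)) (U (e 3)) (U (e 4)) = α ^ 4 * D := by
    rw [hDdef, hUdef]; simp only [det4_eq, Pi.smul_apply, smul_eq_mul]; ring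
  have hUD0 : det4 (U (e 1)) (U (e 2)) (U (e 3)) (U (e 4)) ≠ 0 := by
    rw [hUD]; exact mul_ne_zero (pow_ne_zero _ hα0.ne') hD0
  obtain ⟨E, hE, hEU⟩ := exists_edgeFamily_dual e hUsum hUD0
  have hvol := hEU.det4_mul_vol e
  refine ⟨ε, E, U, hE, hEU, right_ne_zero_of_mul_eq_one hvol, fun p q => ?_, fun p =>
    ⟨α * m p, mul_ne_zero hα0.ne' (hm0 p), smul_smul _ _ _⟩⟩
  have hv : simplexVol E e = (α ^ 4 * D)⁻¹ := by
    rw [← hUD]; exact eq_inv_of_mul_eq_one_right hvol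
  have hUw : wedge (U p) (U q) = (α * α) • wedge (m p • N p) (m q • N q) := by
    rw [hUdef, wedge_smul_left α, wedge_smul_right α, smul_smul]
  rw [hBc, hv, hUw, Units.smul_def, ← Int.cast_smul_eq_zsmul ℝ, smul_smul, smul_smul]
  congr 1
  have h1 : ((ε : ℤ) : ℝ) * ((α ^ 4 * D)⁻¹ * α * α) = ((ε : ℤ) : ℝ) * (α ^ 2)⁻¹ * D⁻¹ := by
    field_simp
  have h2 : ((ε : ℤ) : ℝ) * ((α ^ 4 * D)⁻¹ * α * α) = c := by
    rw [h1, hα2, inv_inv, hε, mul_assoc, mul_inv_cancel₀ hD0, mul_one]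
  linarith

end Reconstruction

theorem units_smul_eq {M : Type*} [AddCommGroup M] [Module ℝ M] (ε : ℤˣ) (x : M) :
    ε • x = ((ε : ℤ) : ℝ) • x := by
  rw [Units.smul_def, ← Int.cast_smul_eq_zsmul ℝ]

namespace Triangulation

variable {P : Type*} [DecidableEq P] {Δ : Triangulation P}

/-! ### Combinatorics of the complex -/

theorem Cell.ext {k : ℕ} {s t : Δ.Cell k} (h : s.verts = t.verts) : s = t := Subtype.ext h

theorem Cell.card_verts {k : ℕ} (s : Δ.Cell k) : s.verts.card = k := s.2.2

theorem Cell.eq_of_subset {k : ℕ} {s t : Δ.Cell k} (h : s.verts ⊆ t.verts) : s = t :=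
  Cell.ext (Finset.eq_of_subset_of_card_le h (by rw [s.card_verts, t.card_verts]))

theorem Cell.exists_eq_opp {k : ℕ} {s : Δ.Cell (k + 2)} {t : Δ.Cell (k + 1)}
    (h : t.verts ⊆ s.verts) : ∃ p : s.verts, t = s.opp p := by
  obtain ⟨p, hp, hpt⟩ := Finset.exists_mem_notMem_of_card_lt_card
    (show t.verts.card < s.verts.card by rw [s.card_verts, t.card_verts]; omega)
  refine ⟨⟨p, hp⟩, Cell.eq_of_subset fun x hx => ?_⟩
  exact Finset.mem_erase.2 ⟨fun hxp => hpt ((show x = p from hxp) ▸ hx), h hx⟩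

theorem edgeAt_subset (v : Δ.Vert) (p : v.verts) : (edgeAt v p).verts ⊆ v.verts :=
  Finset.erase_subset _ _

theorem mem_edgeAt {v : Δ.Vert} {p q : v.verts} : (q : P) ∈ (edgeAt v p).verts ↔ q ≠ p := by
  change (q : P) ∈ v.verts.erase p ↔ _
  rw [Finset.mem_erase, Ne, Ne, Subtype.ext_iff]
  exact and_iff_left q.2

theorem faceAt_subset (v : Δ.Vert) (p q : v.verts) (h : p ≠ q) :
    (faceAt v p q h).verts ⊆ (edgeAt v p).verts := Finset.erase_subset _ _

theorem faceAt_symm (v : Δ.Vert) (p q : v.verts) (h : p ≠ q) :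
    faceAt v q p h.symm = faceAt v p q h :=
  Cell.ext (Finset.erase_right_comm)

theorem faceAt_subset_right (v : Δ.Vert) (p q : v.verts) (h : p ≠ q) :
    (faceAt v p q h).verts ⊆ (edgeAt v q).verts := by
  rw [← faceAt_symm]; exact faceAt_subset _ _ _ _

theorem mem_faceAt {v : Δ.Vert} {p q r : v.verts} (h : p ≠ q) :
    (r : P) ∈ (faceAt v p q h).verts ↔ r ≠ p ∧ r ≠ q := by
  change (r : P) ∈ (v.verts.erase p).erase q ↔ _
  rw [Finset.mem_erase, Finset.mem_erase, Ne, Ne, Ne, Ne, Subtype.ext_iff, Subtype.ext_iff]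
  exact ⟨fun h => ⟨h.2.1, h.1⟩, fun h => ⟨h.2, h.1, r.2⟩⟩

theorem edgeAt_injective (v : Δ.Vert) : Function.Injective (edgeAt v) := by
  intro p q h
  by_contra hne
  have : (p : P) ∈ (edgeAt v q).verts := mem_edgeAt.2 hne
  rw [← h] at this
  exact mem_edgeAt.1 this rfl

theorem exists_eq_edgeAt {e : Δ.Edge} {v : Δ.Vert} (h : e.verts ⊆ v.verts) :
    ∃ p : v.verts, e = edgeAt v p := Cell.exists_eq_opp (k := 3) h

theorem exists_eq_faceAt {f : Δ.Face} {v : Δ.Vert} {p : v.verts}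
    (h : f.verts ⊆ (edgeAt v p).verts) : ∃ (q : v.verts) (hpq : p ≠ q), f = faceAt v p q hpq := by
  obtain ⟨q, rfl⟩ := Cell.exists_eq_opp (k := 2) h
  have hq := Finset.mem_erase.1 q.2
  exact ⟨⟨q, hq.2⟩, fun hp => hq.1 (congrArg Subtype.val hp).symm, rfl⟩

theorem exists_edge_between {f : Δ.Face} {v : Δ.Vert} (h : f.verts ⊆ v.verts) :
    ∃ (p q : v.verts) (hpq : p ≠ q), f = faceAt v p q hpq := by
  obtain ⟨p, hp, hpf⟩ := Finset.exists_mem_notMem_of_card_lt_card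
    (show f.verts.card < v.verts.card by rw [f.card_verts, v.card_verts]; omega)
  obtain ⟨q, hq, rfl⟩ := exists_eq_faceAt (f := f) (v := v) (p := ⟨p, hp⟩)
    (fun x hx => Finset.mem_erase.2 ⟨fun hxp => hpf ((show x = p from hxp) ▸ hx), h hx⟩)
  exact ⟨_, q, hq, rfl⟩

theorem exists_vert_of_mem {s : Finset P} (hs : s ∈ Δ.faces) : ∃ v : Δ.Vert, s ⊆ v.verts := by
  obtain ⟨σ, h1, h2, h3⟩ := Δ.pure s hs
  exact ⟨⟨σ, h1, h2⟩, h3⟩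

theorem exists_vert_cell {k : ℕ} (s : Δ.Cell k) : ∃ v : Δ.Vert, s.verts ⊆ v.verts :=
  exists_vert_of_mem s.2.1

variable (Δ) in
theorem exists_vert : ∃ _ : Δ.Vert, True := by
  obtain ⟨s, hs⟩ := Δ.nonempty
  obtain ⟨v, -⟩ := exists_vert_of_mem hs
  exact ⟨v, trivial⟩

theorem exists_two_verts (e : Δ.Edge) : ∃ v v' : Δ.Vert, v ≠ v' ∧ e.verts ⊆ v.verts ∧
    e.verts ⊆ v'.verts ∧ ∀ w : Δ.Vert, e.verts ⊆ w.verts → w = v ∨ w = v' := by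
  have h := Δ.closed e.1 e.2.1 e.2.2
  obtain ⟨a, b, hab, hs⟩ := Set.ncard_eq_two.1 h
  have ha : a ∈ ({a, b} : Set (Finset P)) := by simp
  have hb : b ∈ ({a, b} : Set (Finset P)) := by simp
  rw [← hs] at ha hb
  refine ⟨⟨a, ha.1, ha.2.1⟩, ⟨b, hb.1, hb.2.1⟩, fun h => hab (congrArg Subtype.val h), ha.2.2,
    hb.2.2, fun w hw => ?_⟩
  have : w.1 ∈ {σ | σ ∈ Δ.faces ∧ σ.card = 5 ∧ e.1 ⊆ σ} := ⟨w.2.1, w.2.2, hw⟩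
  rw [hs] at this
  rcases this with h | h
  · exact Or.inl (Subtype.ext h)
  · exact Or.inr (Subtype.ext h)

theorem exists_neighbour {e : Δ.Edge} {v : Δ.Vert} (hv : e.verts ⊆ v.verts) :
    ∃ w : Δ.Vert, v ≠ w ∧ e.verts ⊆ w.verts := by
  obtain ⟨a, b, hab, ha, hb, h⟩ := exists_two_verts e
  rcases h v hv with rfl | rfl
  · exact ⟨b, hab, hb⟩
  · exact ⟨a, hab.symm, ha⟩

/-- Two different 4-simplices share at most one tetrahedron. -/
theorem edge_unique {e e' : Δ.Edge} {v v' : Δ.Vert} (hne : v ≠ v') (h : e.verts ⊆ v.verts)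
    (h' : e.verts ⊆ v'.verts) (k : e'.verts ⊆ v.verts) (k' : e'.verts ⊆ v'.verts) : e = e' := by
  have key : ∀ e : Δ.Edge, e.verts ⊆ v.verts → e.verts ⊆ v'.verts →
      e.verts = v.verts ∩ v'.verts := by
    intro e h h'
    apply Finset.eq_of_subset_of_card_le (Finset.subset_inter h h')
    by_contra hcard
    have h1 : v.verts ∩ v'.verts = v.verts := by
      apply Finset.eq_of_subset_of_card_le Finset.inter_subset_left
      rw [v.card_verts]; rw [e.card_verts] at hcard; omega
    exact hne (Cell.eq_of_subset (Finset.inter_eq_left.1 h1))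
  exact Cell.ext ((key e h h').trans (key e' k k').symm)

/-- Induction along chains of neighbouring 4-simplices that contain `ρ`. -/
theorem vert_induction {C : Δ.Vert → Prop} {ρ : Finset P} {v₀ : Δ.Vert} (hρ : ρ ⊆ v₀.verts)
    (h₀ : C v₀) (step : ∀ (v v' : Δ.Vert) (e : Δ.Edge), v ≠ v' → e.verts ⊆ v.verts →
      e.verts ⊆ v'.verts → ρ ⊆ e.verts → C v → C v') {v : Δ.Vert} (hv : ρ ⊆ v.verts) : C v := by
  have h := Δ.connected ρ v₀.1 v.1 v₀.2.1 v₀.2.2 hρ v.2.1 v.2.2 hv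
  have key : ∀ b, Relation.ReflTransGen
      (fun a b => b ∈ Δ.faces ∧ b.card = 5 ∧ ρ ⊆ b ∧ (a ∩ b).card = 4) v₀.1 b →
      ρ ⊆ b ∧ ∃ hb : b ∈ Δ.faces ∧ b.card = 5, C ⟨b, hb⟩ := by
    intro b hb
    induction hb with
    | refl => exact ⟨hρ, v₀.2, h₀⟩
    | @tail a b _ hab ih =>
      obtain ⟨ha, ha', hC⟩ := ih
      obtain ⟨h1, h2, h3, h4⟩ := hab
      refine ⟨h3, ⟨h1, h2⟩, ?_⟩
      have hmem : a ∩ b ∈ Δ.faces := (Δ.isRelLowerSet_faces h1).2 Finset.inter_subset_right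
        (Finset.card_pos.1 (by omega))
      refine step ⟨a, ha'⟩ ⟨b, h1, h2⟩ ⟨a ∩ b, hmem, h4⟩ ?_ Finset.inter_subset_left
        Finset.inter_subset_right (Finset.subset_inter ha h3) hC
      intro hEq
      have : a = b := congrArg Subtype.val hEq
      rw [this, Finset.inter_self] at h4
      omega
  obtain ⟨-, hb, hC⟩ := key v.1 h
  exact hC

theorem exists_ordering (v : Δ.Vert) : ∃ _ : Δ.Ordering v, True :=
  ⟨(v.verts.equivFinOfCardEq v.card_verts).symm, trivial⟩

theorem exists_neighbour_ordering_zero {v v' : Δ.Vert} (p : Δ.Ordering v)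
    (h' : (edgeAt v (p 0)).verts ⊆ v'.verts) :
    ∃ p' : Δ.Ordering v', edgeAt v' (p' 0) = edgeAt v (p 0) ∧
      ∀ i : Fin 5, i ≠ 0 → (p i : P) = p' i := by
  obtain ⟨q, hq⟩ := exists_eq_edgeAt h'
  have hmem : ∀ i : Fin 4, (p i.succ : P) ∈ (edgeAt v (p 0)).verts := fun i =>
    mem_edgeAt.2 (p.injective.ne (Fin.succ_ne_zero i))
  set F : Fin 5 → v'.verts := Fin.cons q fun i => ⟨p i.succ, h' (hmem i)⟩ with hF
  have hinj : Function.Injective F := by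
    rw [hF, Fin.cons_injective_iff]
    constructor
    · rintro ⟨i, hi⟩
      have h1 := hmem i
      rw [hq] at h1
      have h2 : (q : P) ∈ (edgeAt v' q).verts :=
        (show (p i.succ : P) = q from congrArg Subtype.val hi) ▸ h1
      exact mem_edgeAt.1 h2 rfl
    · intro i j hij
      have h1 : (p i.succ : P) = p j.succ :=
        Subtype.mk.inj (show (⟨p i.succ, h' (hmem i)⟩ : v'.verts) = ⟨p j.succ, h' (hmem j)⟩ from hij)
      exact Fin.succ_injective _ (p.injective (Subtype.ext h1))
  have hbij : Function.Bijective F := by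
    rw [Fintype.bijective_iff_injective_and_card]
    exact ⟨hinj, by simp [v'.card_verts]⟩
  refine ⟨Equiv.ofBijective F hbij, hq.symm, fun i hi => ?_⟩
  obtain ⟨j, rfl⟩ := Fin.exists_succ_eq.2 hi
  rfl

/-- The ordering of a neighbouring 4-simplex that agrees with `p` on the common tetrahedron. -/
theorem exists_neighbour_ordering {v v' : Δ.Vert} (p : Δ.Ordering v) (k : Fin 5)
    (h' : (edgeAt v (p k)).verts ⊆ v'.verts) :
    ∃ p' : Δ.Ordering v', edgeAt v' (p' k) = edgeAt v (p k) ∧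
      ∀ i : Fin 5, i ≠ k → (p i : P) = p' i := by
  obtain ⟨p', h0, h⟩ := exists_neighbour_ordering_zero ((Equiv.swap 0 k).trans p) (v' := v')
    (by simpa using h')
  refine ⟨(Equiv.swap 0 k).trans p', by simpa using h0, fun i hi => ?_⟩
  have := h (Equiv.swap 0 k i) (fun h1 => hi (by
    rw [Equiv.swap_apply_eq_iff, Equiv.swap_apply_left] at h1; exact h1))
  simpa using this

theorem Orientation.sgn_neighbour (o : Δ.Orientation) {v v' : Δ.Vert} (hne : v ≠ v')
    {p : Δ.Ordering v} {p' : Δ.Ordering v'} {k : Fin 5} (h : ∀ i : Fin 5, i ≠ k → (p i : P) = p' i) :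
    o.sgn v' p' = - o.sgn v p := by
  have := o.consistent v v' ((Equiv.swap 0 k).trans p) ((Equiv.swap 0 k).trans p') hne
    (fun i hi => h _ (fun h1 => hi (by
      rw [Equiv.swap_apply_eq_iff, Equiv.swap_apply_right] at h1; exact h1)))
  rw [o.perm, o.perm, ← mul_neg] at this
  exact mul_left_cancel this

theorem Orientation.sgn_swap (o : Δ.Orientation) {v : Δ.Vert} (p : Δ.Ordering v) {i j : Fin 5}
    (hij : i ≠ j) : o.sgn v ((Equiv.swap i j).trans p) = - o.sgn v p := by
  rw [o.perm, Equiv.Perm.sign_swap hij, neg_one_mul]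

theorem Orientation.exists_positive (o : Δ.Orientation) {v : Δ.Vert} {q r : v.verts} (h : q ≠ r) :
    ∃ p : Δ.Ordering v, o.sgn v p = 1 ∧ p 3 = q ∧ p 4 = r := by
  obtain ⟨p, -⟩ := exists_ordering v
  obtain ⟨p, h3, h4⟩ := exists_ordering_two p (i := 3) (j := 4) (by decide) h
  rcases Int.units_eq_one_or (o.sgn v p) with h1 | h1
  · exact ⟨p, h1, h3, h4⟩
  -- Swapping slots 0 and 1 corrects the orientation without moving slots 3 and 4.
  · refine ⟨(Equiv.swap 0 1).trans p, by rw [o.sgn_swap p (by decide), h1, neg_neg], ?_, ?_⟩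
    · rw [← h3]; rfl
    · rw [← h4]; rfl

/-! ### Co-tetrads restricted to a single 4-simplex -/

variable {E : Δ.EdgeVectors} {U : Δ.NormalVectors}

theorem IsCotetrad.isEdgeFamily (hE : IsCotetrad E) (v : Δ.Vert) : IsEdgeFamily (E v) :=
  ⟨hE.antisymm v, hE.closure v⟩

theorem vol4_eq (E : Δ.EdgeVectors) (v : Δ.Vert) (p : Δ.Ordering v) :
    vol4 E v p = simplexVol (E v) p := rfl

theorem IsTetrad.isDual (hU : IsTetrad E U) (v : Δ.Vert) : IsDual (E v) (U v) := hU v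

theorem IsCotetrad.vol4_ne_zero (hE : IsCotetrad E) (hnd : CotetradNondegenerate E) (v : Δ.Vert)
    (p : Δ.Ordering v) : vol4 E v p ≠ 0 := (hE.isEdgeFamily v).simplexVol_ne_zero (hnd v) p

end Triangulation

theorem det4_swap (a b c d : Vec) : det4 a b d c = - det4 a b c d := by
  simp only [det4_eq]; ring

/-- In even dimension minus the identity has determinant one, so a sign can be absorbed into a
rotation. -/
theorem SO4.exists_units_smul (s : ℤˣ) (g : SO4) :
    ∃ k : SO4, (k : Matrix (Fin 4) (Fin 4) ℝ) = s • (g : Matrix (Fin 4) (Fin 4) ℝ) := by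
  rcases Int.units_eq_one_or s with rfl | rfl
  · exact ⟨g, by simp⟩
  · refine ⟨SO4.mk (-(g : Matrix (Fin 4) (Fin 4) ℝ)) ?_ ?_, ?_⟩
    · rw [Matrix.transpose_neg, neg_mul_neg, SO4.mul_transpose]
    · rw [Matrix.det_neg, SO4.det]; norm_num
    · simp [SO4.mk]

/-- The action is quadratic in the rotation, so bivectors do not see the signs ε_e; this is why they
remain free. -/
theorem act_eq_of_coe_eq_units_smul {k g : SO4} {s : ℤˣ}
    (h : (k : Matrix (Fin 4) (Fin 4) ℝ) = s • (g : Matrix (Fin 4) (Fin 4) ℝ)) (X : Biv) :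
    act k X = act g X := by
  rw [act, act, h]
  rcases Int.units_eq_one_or s with rfl | rfl <;> simp

/-! ### Comparison of two 4-simplices with proportional triangle bivectors -/

section Compare

variable {ι κ : Type*} {E : ι → ι → Vec} {F : κ → κ → Vec} {r : Fin 5 ≃ ι} {r' : Fin 5 → κ} {η : ℤˣ}
  {g : SO4}

/-- If the triangle bivectors of a tetrahedron are mapped to each other up to a sign, then the edge
vectors are mapped to each other up to a sign. -/
theorem tetrahedron_rigid (hF : IsEdgeFamily F) (hE : IsEdgeFamily E) (h : simplexVol E r ≠ 0)
    (hw : ∀ i j : Fin 5, i ≠ j → i ≠ 0 → i ≠ 3 → j ≠ 0 → j ≠ 3 →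
      wedge (F (r' i) (r' 0)) (F (r' j) (r' 0)) =
      η • act g (wedge (E (r i) (r 0)) (E (r j) (r 0)))) :
    η = 1 ∧ ∃ s : ℤˣ, ∀ i j : Fin 5, i ≠ 3 → j ≠ 3 →
      F (r' i) (r' j) = s • ((g : Matrix (Fin 4) (Fin 4) ℝ) *ᵥ E (r i) (r j)) := by
  simp only [act_wedge] at hw
  -- Slot 3 is the vertex outside the tetrahedron; its edge only completes the other three to a
  -- basis.
  have hdet : det4 ((g : Matrix (Fin 4) (Fin 4) ℝ) *ᵥ E (r 1) (r 0))
      ((g : Matrix (Fin 4) (Fin 4) ℝ) *ᵥ E (r 2) (r 0))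
      ((g : Matrix (Fin 4) (Fin 4) ℝ) *ᵥ E (r 4) (r 0))
      ((g : Matrix (Fin 4) (Fin 4) ℝ) *ᵥ E (r 3) (r 0)) ≠ 0 := by
    rw [det4_mulVec, SO4.det, one_mul, det4_swap]
    exact neg_ne_zero.2 h
  obtain ⟨hη, s, h1, h2, h4⟩ := wedge_triple_rigid hdet
    (hw 1 2 (by decide) (by decide) (by decide) (by decide) (by decide))
    (hw 1 4 (by decide) (by decide) (by decide) (by decide) (by decide))
    (hw 2 4 (by decide) (by decide) (by decide) (by decide) (by decide))
  refine ⟨hη, s, ?_⟩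
  have key : ∀ i : Fin 5, i ≠ 3 →
      F (r' i) (r' 0) = s • ((g : Matrix (Fin 4) (Fin 4) ℝ) *ᵥ E (r i) (r 0)) := by
    intro i hi
    fin_cases i
    · simp [hF.self, hE.self]
    · exact h1
    · exact h2
    · exact absurd rfl hi
    · exact h4
  intro i j hi hj
  rw [hF.eq_sub _ _ (r' 0), hE.eq_sub _ _ (r 0), key i hi, key j hj, Matrix.mulVec_sub, smul_sub]

/-- The tetrahedra opposite to slots 3 and 4 together contain every edge from slot 0. Each is rigid
up to a sign, and the signs agree because the tetrahedra share an edge. -/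
theorem simplex_rigid {F : ι → ι → Vec} (hF : IsEdgeFamily F) (hE : IsEdgeFamily E)
    (h : ∀ r, simplexVol E r ≠ 0) (r : Fin 5 ≃ ι)
    (hw : ∀ r : Fin 5 ≃ ι, wedge (F (r 1) (r 0)) (F (r 2) (r 0)) =
      η • wedge (E (r 1) (r 0)) (E (r 2) (r 0))) :
    η = 1 ∧ ∃ s : ℤˣ, ∀ p q, F p q = s • E p q := by
  have hw' : ∀ (r : Fin 5 ≃ ι) (i j : Fin 5), i ≠ j → i ≠ 0 → i ≠ 3 → j ≠ 0 → j ≠ 3 →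
      wedge (F (r i) (r 0)) (F (r j) (r 0)) =
      η • act 1 (wedge (E (r i) (r 0)) (E (r j) (r 0))) := by
    intro r i j hij hi _ hj _
    obtain ⟨e, h0, h1, h2⟩ := exists_ordering_three r (i := 0) (j := 1) (l := 2) (by decide)
      (by decide) (by decide) (r.injective.ne hi.symm) (r.injective.ne hj.symm)
      (r.injective.ne hij)
    have := hw e
    rwa [h0, h1, h2, ← act_one (wedge (E _ _) (E _ _))] at this
  obtain ⟨hη, s, hs⟩ := tetrahedron_rigid (r' := r) hF hE (h r) (hw' r)
  obtain ⟨-, t, ht⟩ := tetrahedron_rigid (r' := (Equiv.swap 3 4).trans r) hF hE (h _)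
    (hw' ((Equiv.swap 3 4).trans r))
  refine ⟨hη, s, ?_⟩
  have h10 := hs 1 0 (by decide) (by decide)
  have h10' := ht 1 0 (by decide) (by decide)
  have e1 : ((Equiv.swap 3 4).trans r) 1 = r 1 := rfl
  have e0 : ((Equiv.swap 3 4).trans r) 0 = r 0 := rfl
  have e4 : ((Equiv.swap 3 4).trans r) 4 = r 3 := rfl
  rw [e0, e1, h10, units_smul_eq, units_smul_eq] at h10'
  have hne : E (r 1) (r 0) ≠ 0 := fun h0 => h r (by simp [simplexVol, h0, det4_eq])
  have hst : s = t := by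
    have := smul_left_injective ℝ (by simpa using hne) h10'
    exact_mod_cast this
  have key : ∀ i, F (r i) (r 0) = s • E (r i) (r 0) := by
    intro i
    by_cases hi : i = 3
    · subst hi
      have := ht 4 0 (by decide) (by decide)
      rw [e0, e4, ← hst] at this
      simpa using this
    · simpa using hs i 0 hi (by decide)
  intro p q
  obtain ⟨i, rfl⟩ := r.surjective p
  obtain ⟨j, rfl⟩ := r.surjective q
  rw [hF.eq_sub _ _ (r 0), hE.eq_sub _ _ (r 0), key, key, smul_sub]

end Compare

namespace Triangulation

variable {P : Type*} [DecidableEq P] {Δ : Triangulation P} {E : Δ.EdgeVectors} {U : Δ.NormalVectors}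

theorem exists_incl_eq {e : Δ.Edge} {v v' : Δ.Vert} (h : e.verts ⊆ v.verts)
    (h' : e.verts ⊆ v'.verts) {p : Δ.Ordering v} {p' : Δ.Ordering v'} {k : Fin 5}
    (hp : edgeAt v (p k) = e) (hpp : ∀ i : Fin 5, i ≠ k → (p i : P) = p' i) (x : e.verts) :
    ∃ i : Fin 5, i ≠ k ∧ incl h x = p i ∧ incl h' x = p' i := by
  obtain ⟨i, hi⟩ := p.surjective (incl h x)
  have hik : i ≠ k := by
    rintro rfl
    have h1 : (p i : P) ∈ (edgeAt v (p i)).verts := by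
      rw [hp, hi]; exact x.2
    exact mem_edgeAt.1 h1 rfl
  refine ⟨i, hik, hi.symm, Subtype.ext ?_⟩
  rw [← hpp i hik, hi]; rfl

theorem exists_incl_ordering {v v' : Δ.Vert} {p : Δ.Ordering v} {p' : Δ.Ordering v'} {k : Fin 5}
    (h' : (edgeAt v (p k)).verts ⊆ v'.verts) (hpp : ∀ i : Fin 5, i ≠ k → (p i : P) = p' i)
    {i : Fin 5} (hi : i ≠ k) : ∃ x : (edgeAt v (p k)).verts,
      incl (edgeAt_subset v (p k)) x = p i ∧ incl h' x = p' i :=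
  ⟨⟨p i, mem_edgeAt.2 (p.injective.ne hi)⟩, rfl, Subtype.ext (hpp i hi)⟩

/-- A rotation is determined by its action on the edges of a tetrahedron. -/
theorem SO4_eq_of_edges {v : Δ.Vert} (h0 : ∀ p, vol4 E v p ≠ 0)
    {e : Δ.Edge} (h : e.verts ⊆ v.verts) {g k : SO4}
    (hgk : ∀ p q : e.verts, (g : Matrix (Fin 4) (Fin 4) ℝ) *ᵥ E v (incl h p) (incl h q) =
      (k : Matrix (Fin 4) (Fin 4) ℝ) *ᵥ E v (incl h p) (incl h q)) : g = k := by
  obtain ⟨q, rfl⟩ := exists_eq_edgeAt h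
  obtain ⟨p, -⟩ := exists_ordering v
  obtain ⟨p, rfl⟩ := exists_ordering_one p 4 q
  have key : ∀ i j : Fin 5, i ≠ 4 → j ≠ 4 → (g : Matrix (Fin 4) (Fin 4) ℝ) *ᵥ E v (p i) (p j) =
      (k : Matrix (Fin 4) (Fin 4) ℝ) *ᵥ E v (p i) (p j) := fun i j hi hj =>
    hgk ⟨p i, mem_edgeAt.2 (p.injective.ne hi)⟩ ⟨p j, mem_edgeAt.2 (p.injective.ne hj)⟩
  exact SO4.eq_of_mulVec (h0 p) (key 1 0 (by decide) (by decide)) (key 2 0 (by decide) (by decide))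
    (key 3 0 (by decide) (by decide))

/-- Parallel transport of the edge vectors of a tetrahedron between neighbouring 4-simplices. -/
theorem exists_transport (hE : IsCotetrad E) (h0 : ∀ v p, vol4 E v p ≠ 0) {v v' : Δ.Vert}
    {e : Δ.Edge} (h : e.verts ⊆ v.verts) (h' : e.verts ⊆ v'.verts) :
    ∃ g : SO4, ∀ p q : e.verts, (g : Matrix (Fin 4) (Fin 4) ℝ) *ᵥ E v (incl h p) (incl h q) =
      E v' (incl h' p) (incl h' q) := by
  obtain ⟨q, rfl⟩ := exists_eq_edgeAt h
  obtain ⟨p, -⟩ := exists_ordering v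
  obtain ⟨p, rfl⟩ := exists_ordering_one p 4 q
  obtain ⟨p', -, hpp⟩ := exists_neighbour_ordering p 4 h'
  have hdot : ∀ i j : Fin 5, i ≠ 4 → j ≠ 4 → E v' (p' i) (p' 0) ⬝ᵥ E v' (p' j) (p' 0) =
      E v (p i) (p 0) ⬝ᵥ E v (p j) (p 0) := by
    intro i j hi hj
    obtain ⟨x, hx, hx'⟩ := exists_incl_ordering h' hpp hi
    obtain ⟨y, hy, hy'⟩ := exists_incl_ordering h' hpp hj
    obtain ⟨z, hz, hz'⟩ := exists_incl_ordering h' hpp (show (0 : Fin 5) ≠ 4 by decide)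
    rw [← hx, ← hx', ← hy, ← hy', ← hz, ← hz']
    exact hE.metric _ _ _ _ _ _ _ _ _
  obtain ⟨g, h1, h2, h3⟩ := exists_isometry (h0 v p) (h0 v' p')
    (hdot 1 1 (by decide) (by decide)) (hdot 2 2 (by decide) (by decide))
    (hdot 3 3 (by decide) (by decide)) (hdot 1 2 (by decide) (by decide))
    (hdot 1 3 (by decide) (by decide)) (hdot 2 3 (by decide) (by decide))
  have key : ∀ i : Fin 5, i ≠ 4 →
      (g : Matrix (Fin 4) (Fin 4) ℝ) *ᵥ E v (p i) (p 0) = E v' (p' i) (p' 0) := by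
    intro i hi
    fin_cases i
    · simp [(hE.isEdgeFamily _).self]
    · exact h1
    · exact h2
    · exact h3
    · exact absurd rfl hi
  refine ⟨g, fun x y => ?_⟩
  obtain ⟨i, hi, hx, hx'⟩ := exists_incl_eq h h' rfl hpp x
  obtain ⟨j, hj, hy, hy'⟩ := exists_incl_eq h h' rfl hpp y
  rw [hx, hx', hy, hy', (hE.isEdgeFamily v).eq_sub _ _ (p 0), (hE.isEdgeFamily v').eq_sub _ _ (p' 0),
    Matrix.mulVec_sub, key i hi, key j hj]

theorem exists_spinConnection (hE : IsCotetrad E) (h0 : ∀ v p, vol4 E v p ≠ 0) :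
    ∃ Ω : Δ.Vert → Δ.Vert → SO4, IsSpinConnection E Ω := by
  classical
  have : ∀ v' v : Δ.Vert, ∃ g : SO4, ∀ (e : Δ.Edge) (h : e.verts ⊆ v.verts)
      (h' : e.verts ⊆ v'.verts), v ≠ v' → ∀ p q : e.verts,
      (g : Matrix (Fin 4) (Fin 4) ℝ) *ᵥ E v (incl h p) (incl h q) =
        E v' (incl h' p) (incl h' q) := by
    intro v' v
    -- Different 4-simplices share at most one tetrahedron, so one rotation per pair suffices; pairs
    -- without a common tetrahedron get the identity.
    by_cases hex : ∃ e : Δ.Edge, e.verts ⊆ v.verts ∧ e.verts ⊆ v'.verts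
    · obtain ⟨e, h, h'⟩ := hex
      obtain ⟨g, hg⟩ := exists_transport hE h0 h h'
      refine ⟨g, fun e' k k' hne => ?_⟩
      obtain rfl := edge_unique hne h h' k k'
      exact hg
    · exact ⟨1, fun e h h' => absurd ⟨e, h, h'⟩ hex⟩
  choose Ω hΩ using this
  exact ⟨Ω, fun v v' e h h' hne => hΩ v' v e h h' hne⟩

theorem IsSpinConnection.eq_of_edges {Ω : Δ.Vert → Δ.Vert → SO4} (hΩ : IsSpinConnection E Ω)
    {v v' : Δ.Vert} (h0 : ∀ p, vol4 E v p ≠ 0) {e : Δ.Edge}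
    (h : e.verts ⊆ v.verts) (h' : e.verts ⊆ v'.verts) (hne : v ≠ v') {g : SO4}
    (hg : ∀ p q : e.verts, (g : Matrix (Fin 4) (Fin 4) ℝ) *ᵥ E v (incl h p) (incl h q) =
      E v' (incl h' p) (incl h' q)) : g = Ω v' v :=
  SO4_eq_of_edges h0 h fun p q => by rw [hg, hΩ v v' e h h' hne]

theorem IsSpinConnection.inv_eq {Ω : Δ.Vert → Δ.Vert → SO4} (hΩ : IsSpinConnection E Ω)
    (h0 : ∀ v p, vol4 E v p ≠ 0) {v v' : Δ.Vert} {e : Δ.Edge}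
    (h : e.verts ⊆ v.verts) (h' : e.verts ⊆ v'.verts) (hne : v ≠ v') :
    (Ω v' v)⁻¹ = Ω v v' :=
  hΩ.eq_of_edges (h0 v') h' h hne.symm fun p q => by
    rw [← hΩ v v' e h h' hne, SO4.inv_mulVec]

end Triangulation

namespace Triangulation.Config

variable {P : Type*} [DecidableEq P] {Δ : Triangulation P} (c : Δ.Config)

/-! ### Bivectors of a configuration -/

/-- Both sides are the bivector based at e carried to v', so this transport equation holds
identically. The next lemma is the analogue for the normals. -/
theorem biv_eq_act_transport (e : Δ.Edge) (f : Δ.Face) (v v' : Δ.Vert) :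
    c.biv e f v' = act (c.transport e v' v) (c.biv e f v) := by
  rw [biv, biv, transport, act_mul, act_act_inv]

theorem unitNormal_eq_transport (e : Δ.Edge) (v v' : Δ.Vert) :
    c.unitNormal e v' = (c.transport e v' v : Matrix (Fin 4) (Fin 4) ℝ) *ᵥ c.unitNormal e v := by
  rw [unitNormal, unitNormal, transport, Submonoid.coe_mul, ← Matrix.mulVec_mulVec, SO4.mulVec_inv]

theorem bivEdge_eq (e : Δ.Edge) (f : Δ.Face) :
    c.bivEdge e f = ofParts (c.j f • pauliCoord (conjSigma (c.n e f)))
      (-rot (unitVec (c.u e : Matrix (Fin 2) (Fin 2) ℂ))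
        (c.j f • pauliCoord (conjSigma (c.n e f)))) := by
  rw [bivEdge, conjSigma_mul, pauliCoord_pauliVec, rot_smul]

theorem exists_bivEdge_eq_wedge (e : Δ.Edge) (f : Δ.Face) :
    ∃ y, c.bivEdge e f = wedge (unitVec (c.u e : Matrix (Fin 2) (Fin 2) ℂ)) y := by
  rw [bivEdge_eq]
  exact exists_wedge_eq_ofParts (SU2.unitVec_dot_self _) _

theorem exists_biv_eq_wedge (e : Δ.Edge) (f : Δ.Face) (v : Δ.Vert) :
    ∃ y, c.biv e f v = wedge (c.unitNormal e v) y := by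
  obtain ⟨y, hy⟩ := c.exists_bivEdge_eq_wedge e f
  exact ⟨_, by rw [biv, hy, act_wedge]; rfl⟩

theorem unitNormal_dot_self (e : Δ.Edge) (v : Δ.Vert) :
    c.unitNormal e v ⬝ᵥ c.unitNormal e v = 1 := by
  rw [unitNormal, SO4.mulVec_dot, SU2.unitVec_dot_self]

theorem unitNormal_ne_zero (e : Δ.Edge) (v : Δ.Vert) : c.unitNormal e v ≠ 0 := fun h => by
  have := c.unitNormal_dot_self e v
  rw [h] at this
  simp at this

theorem bivNorm_biv (e : Δ.Edge) (f : Δ.Face) (v : Δ.Vert) : bivNorm (c.biv e f v) = c.j f := by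
  have h : bivNorm (c.biv e f v) ^ 2 = c.j f ^ 2 := by
    rw [biv, bivNorm_act, bivEdge_eq, bivNorm_ofParts, neg_dotProduct_neg, rot_dot_self,
      SU2.unitVec_dot_self, smul_dotProduct, dotProduct_smul, pauliCoord_conjSigma_dot_self]
    simp only [smul_eq_mul]; ring
  exact (sq_eq_sq₀ (bivNorm_nonneg _) (c.j_nonneg f)).1 h

theorem transpose_biv (e : Δ.Edge) (f : Δ.Face) (v : Δ.Vert) :
    (c.biv e f v)ᵀ = - c.biv e f v := transpose_act _ (transpose_ofParts _ _)

theorem bivNorm_hodge_biv (e : Δ.Edge) (f : Δ.Face) (v : Δ.Vert) :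
    bivNorm (hodge (c.biv e f v)) = c.j f := by
  rw [bivNorm_hodge (c.transpose_biv e f v), bivNorm_biv]

variable {c} {o : Δ.Orientation} {w : Δ.FaceOrientation}

/-- A face enters one end of the edge and leaves through the other, so its incidence sign flips
while the bivector itself is just transported. -/
theorem bivPair_neighbour {v v' : Δ.Vert} (hne : v ≠ v') {p : Δ.Ordering v} {p' : Δ.Ordering v'}
    {k i : Fin 5} (he : edgeAt v' (p' k) = edgeAt v (p k)) (hi : k ≠ i)
    (hpp : ∀ i : Fin 5, i ≠ k → (p i : P) = p' i) :
    c.bivPair w v' (p' k) (p' i) (p'.injective.ne hi) =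
      - act (c.transport (edgeAt v (p k)) v' v)
        (c.bivPair w v (p k) (p i) (p.injective.ne hi)) := by
  have hf : faceAt v' (p' k) (p' i) (p'.injective.ne hi) =
      faceAt v (p k) (p i) (p.injective.ne hi) := by
    apply Cell.ext
    have h1 : (faceAt v' (p' k) (p' i) (p'.injective.ne hi)).verts =
      (edgeAt v' (p' k)).verts.erase (p' i) := rfl
    rw [h1, he, ← hpp i hi.symm]; rfl
  have hsub := he ▸ edgeAt_subset v' (p' k)
  rw [bivPair, bivPair, he, hf, w.flip_vert _ _ v v' (faceAt_subset _ _ _ _) (edgeAt_subset _ _)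
    hsub hne, act_units_smul, ← biv_eq_act_transport, Units.neg_smul]

variable (c o w)

/-- The formula for the bivectors at one vertex in terms of edge vectors. -/
def BivFromCotetradAt (ε : ℤˣ) (v : Δ.Vert) (E : v.verts → v.verts → Vec) : Prop :=
  ∀ p : Δ.Ordering v, o.sgn v p = 1 →
    c.bivPair w v (p 3) (p 4) (p.injective.ne (by decide))
      = ε • hodge (wedge (E (p 0) (p 1)) (E (p 1) (p 2)))

/-- The formula for the bivectors at one vertex in terms of normal vectors. -/
def BivFromTetradAt (ε : ℤˣ) (v : Δ.Vert) (E : v.verts → v.verts → Vec) (U : v.verts → Vec) :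
    Prop :=
  ∀ p : Δ.Ordering v, o.sgn v p = 1 → ∀ (q r : v.verts) (h : q ≠ r),
    c.bivPair w v q r h = ε • (simplexVol E p • wedge (U q) (U r))

variable {c o w}

/-! ### Edge vectors and normals at a single vertex -/

section Local

variable {ε : ℤˣ} {v : Δ.Vert} {E : v.verts → v.verts → Vec} {U : v.verts → Vec}

theorem simplexVol_eq_of_sgn_eq (hE : IsEdgeFamily E)
    {p p' : Δ.Ordering v} (h : o.sgn v p = o.sgn v p') : simplexVol E p = simplexVol E p' := by
  set π : Equiv.Perm (Fin 5) := p.trans p'.symm with hπ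
  have hp : p = π.trans p' := by ext i; simp [hπ]
  rw [hp, o.perm] at h
  have h1 : Equiv.Perm.sign π = 1 := by simpa using h
  rw [hp, hE.simplexVol_trans, h1]
  simp

theorem bivFromTetradAt_iff (hE : IsEdgeFamily E) (h0 : ∀ p, simplexVol E p ≠ 0)
    (hU : IsDual E U) :
    c.BivFromCotetradAt o w ε v E ↔ c.BivFromTetradAt o w ε v E U := by
  constructor
  · intro h p hp q r hqr
    obtain ⟨p', hp', rfl, rfl⟩ := o.exists_positive hqr
    rw [h p' hp', hU.hodge_wedge hE (h0 p'), simplexVol_eq_of_sgn_eq hE (hp.trans hp'.symm)]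
  · intro h p hp
    rw [h p hp, hU.hodge_wedge hE (h0 p)]

/-- An odd ordering becomes positive by exchanging slots 0 and 1, which reverses the wedge product.
-/
theorem BivFromCotetradAt.ordering (hE : IsEdgeFamily E) (h : c.BivFromCotetradAt o w ε v E)
    (p : Δ.Ordering v) : c.bivPair w v (p 3) (p 4) (p.injective.ne (by decide))
      = (o.sgn v p * ε) • hodge (wedge (E (p 1) (p 0)) (E (p 2) (p 0))) := by
  rcases Int.units_eq_one_or (o.sgn v p) with h1 | h1
  · rw [h p h1, h1, one_mul, hE.wedge_eq]
  · have h2 := h ((Equiv.swap 0 1).trans p) (by rw [o.sgn_swap p (by decide), h1, neg_neg])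
    have h3 : c.bivPair w v (p 3) (p 4) (p.injective.ne (by decide)) =
      ε • hodge (wedge (E (p 1) (p 0)) (E (p 0) (p 2))) := h2
    rw [h3, h1, hE.antisymm (p 2) (p 0), wedge_neg_right, hodge_neg, smul_neg, neg_one_mul,
      Units.neg_smul]

theorem BivFromCotetradAt.unique {ε' : ℤˣ} {E' : v.verts → v.verts → Vec} (hE : IsEdgeFamily E)
    (h0 : ∀ p, simplexVol E p ≠ 0) (h : c.BivFromCotetradAt o w ε v E) (hE' : IsEdgeFamily E')
    (h' : c.BivFromCotetradAt o w ε' v E') :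
    ε' = ε ∧ ∃ s : ℤˣ, ∀ p q, E' p q = s • E p q := by
  obtain ⟨p, -⟩ := exists_ordering v
  have hw : ∀ r : Δ.Ordering v, wedge (E' (r 1) (r 0)) (E' (r 2) (r 0)) =
      (ε' * ε) • wedge (E (r 1) (r 0)) (E (r 2) (r 0)) := by
    intro r
    have h1 := (h'.ordering hE' r).symm.trans (h.ordering hE r)
    rw [mul_smul, mul_smul, smul_left_cancel_iff] at h1
    have h2 : hodge (wedge (E' (r 1) (r 0)) (E' (r 2) (r 0))) =
        (ε' * ε) • hodge (wedge (E (r 1) (r 0)) (E (r 2) (r 0))) := by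
      rw [mul_smul, ← h1, smul_smul, Int.units_mul_self, one_smul]
    rw [units_smul_eq, ← one_smul ℝ (hodge (wedge (E' _ _) _))] at h2
    rw [units_smul_eq, ← hodge_wedge_injective h2, one_smul]
  obtain ⟨h1, h2⟩ := simplex_rigid hE' hE h0 p hw
  refine ⟨?_, h2⟩
  have := congrArg (· * ε) h1
  simpa [mul_assoc, Int.units_mul_self] using this

end Local

/-- The signs and edge vectors of neighbouring 4-simplices agree, up to a sign and parallel
transport. -/
theorem neighbour_rigid {v v' : Δ.Vert} (hne : v ≠ v') {e : Δ.Edge} (he : e.verts ⊆ v.verts)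
    (he' : e.verts ⊆ v'.verts) {ε ε' : ℤˣ} {E : v.verts → v.verts → Vec}
    {E' : v'.verts → v'.verts → Vec} (hE : IsEdgeFamily E) (h0 : ∀ p, simplexVol E p ≠ 0)
    (h : c.BivFromCotetradAt o w ε v E) (hE' : IsEdgeFamily E')
    (h' : c.BivFromCotetradAt o w ε' v' E') :
    ε' = ε ∧ ∃ s : ℤˣ, ∀ x y : e.verts, E' (incl he' x) (incl he' y) =
      s • ((c.transport e v' v : Matrix (Fin 4) (Fin 4) ℝ) *ᵥ E (incl he x) (incl he y)) := by
  obtain ⟨q, rfl⟩ := exists_eq_edgeAt he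
  obtain ⟨p, -⟩ := exists_ordering v
  obtain ⟨p, rfl⟩ := exists_ordering_one p 3 q
  obtain ⟨p', hep, hpp⟩ := exists_neighbour_ordering p 3 he'
  set g := c.transport (edgeAt v (p 3)) v' v with hg
  have hw : ∀ i j : Fin 5, i ≠ j → i ≠ 0 → i ≠ 3 → j ≠ 0 → j ≠ 3 →
      wedge (E' (p' i) (p' 0)) (E' (p' j) (p' 0)) =
      (ε' * ε) • act g (wedge (E (p i) (p 0)) (E (p j) (p 0))) := by
    intro i j hij hi hi3 hj hj3
    -- The face is the triangle of slots 0, i, j; slot 3 keeps the vertex deleted to form the common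
    -- tetrahedron.
    obtain ⟨π, h0, h1, h2, h3⟩ := exists_ordering_four (Equiv.refl (Fin 5)) (i := 0) (j := 1)
      (l := 2) (m := 3) (by decide) (by decide) (by decide) (by decide) (by decide) (by decide)
      hi.symm hj.symm hij (show (0 : Fin 5) ≠ 3 by decide) hi3 hj3
    have hπ : ∀ i : Fin 5, i ≠ 3 → ((π.trans p) i : P) = (π.trans p') i := fun i hi =>
      hpp (π i) (fun h4 => hi (π.injective (h4.trans h3.symm)))
    have hsgn := o.sgn_neighbour hne hπ
    have hb := bivPair_neighbour (c := c) (w := w) hne (p := π.trans p) (p' := π.trans p') (k := 3)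
      (i := 4) (by simpa [h3] using hep) (by decide) hπ
    -- The minus sign of the face orientation cancels that of the neighbouring ordering; only the
    -- ratio of the two signs ε survives.
    rw [h.ordering hE, h'.ordering hE', hsgn, neg_mul, Units.neg_smul, neg_inj, act_units_smul,
      mul_smul, mul_smul, smul_left_cancel_iff, ← hodge_act_wedge] at hb
    simp only [Equiv.trans_apply, h0, h1, h2, h3] at hb
    have hb2 : hodge (wedge (E' (p' i) (p' 0)) (E' (p' j) (p' 0))) =
        (ε' * ε) • hodge (act g (wedge (E (p i) (p 0)) (E (p j) (p 0)))) := by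
      rw [mul_smul, ← hb, smul_smul, Int.units_mul_self, one_smul]
    rw [act_wedge] at hb2 ⊢
    rw [units_smul_eq, ← one_smul ℝ (hodge (wedge (E' _ _) _))] at hb2
    rw [units_smul_eq, ← hodge_wedge_injective hb2, one_smul]
  obtain ⟨h1, s, hs⟩ := tetrahedron_rigid hE' hE (h0 p) hw
  refine ⟨?_, s, fun x y => ?_⟩
  · have := congrArg (· * ε) h1
    simpa [mul_assoc, Int.units_mul_self] using this
  · obtain ⟨i, hi, hx, hx'⟩ := exists_incl_eq he he' rfl hpp x
    obtain ⟨j, hj, hy, hy'⟩ := exists_incl_eq he he' rfl hpp y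
    rw [hx, hx', hy, hy']
    exact hs i j hi hj

/-! ### Reconstruction at a vertex -/

theorem IsSolution.bivPair_symm (hc : c.IsSolution w) {v : Δ.Vert} {p q : v.verts} (h : p ≠ q) :
    c.bivPair w v q p h.symm = - c.bivPair w v p q h := by
  have h1 := faceAt_subset v p q h
  have h2 := faceAt_subset_right v p q h
  have hne : edgeAt v p ≠ edgeAt v q := (edgeAt_injective v).ne h
  rw [bivPair, bivPair, faceAt_symm, w.flip_edge _ (edgeAt v p) (edgeAt v q) v h1 h2
    (edgeAt_subset _ _) (edgeAt_subset _ _) hne, Units.neg_smul,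
    hc.interior (edgeAt v p) (edgeAt v q) _ v h1 h2 (edgeAt_subset _ _) (edgeAt_subset _ _)]

theorem ne_incl (v : Δ.Vert) (p : v.verts) (x : (edgeAt v p).verts) :
    p ≠ incl (edgeAt_subset v p) x := by
  have h : ((incl (edgeAt_subset v p) x : v.verts) : P) ∈ (edgeAt v p).verts := x.2
  exact (mem_edgeAt.1 h).symm

theorem sum_bivPair (v : Δ.Vert) (p : v.verts) :
    ∑ q : v.verts, (if h : p ≠ q then c.bivPair w v p q h else 0) =
      ∑ x : (edgeAt v p).verts, w.eps (edgeAt v p) (Cell.opp (k := 2) (edgeAt v p) x) v •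
        c.biv (edgeAt v p) (Cell.opp (k := 2) (edgeAt v p) x) v := by
  symm
  rw [← Finset.sum_filter_add_sum_filter_not Finset.univ (fun q : v.verts => p ≠ q)]
  rw [Finset.sum_eq_zero (s := Finset.univ.filter fun q : v.verts => ¬ p ≠ q)
    (fun q hq => dif_neg (Finset.mem_filter.1 hq).2), add_zero]
  refine Finset.sum_bij' (fun x _ => incl (edgeAt_subset v p) x)
    (fun q hq => ⟨q, mem_edgeAt.2 (Finset.mem_filter.1 hq).2.symm⟩) ?_ ?_ ?_ ?_ ?_
  · intro x _
    exact Finset.mem_filter.2 ⟨Finset.mem_univ _, ne_incl v p x⟩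
  · intro q hq; exact Finset.mem_univ _
  · intro x _; rfl
  · intro q _; rfl
  · intro x _
    rw [dif_pos (ne_incl v p x)]; rfl

/-- The three conditions of `exists_edgeFamily` are simplicity, the two closure constraints and
non-degeneracy; ε may still depend on the vertex. -/
theorem IsSolution.exists_local (hc : c.IsSolution w) (hnd : c.Nondegenerate) (v : Δ.Vert) :
    ∃ (ε : ℤˣ) (E : v.verts → v.verts → Vec) (U : v.verts → Vec), IsEdgeFamily E ∧ IsDual E U ∧
      (∀ p, simplexVol E p ≠ 0) ∧ c.BivFromTetradAt o w ε v E U ∧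
      ∀ p, ∃ k : ℝ, k ≠ 0 ∧ U p = k • c.unitNormal (edgeAt v p) v := by
  set B : v.verts → v.verts → Biv := fun p q => if h : p ≠ q then c.bivPair w v p q h else 0 with hB
  have hBne : ∀ {p q : v.verts} (h : p ≠ q), B p q = c.bivPair w v p q h := fun h => dif_pos h
  have hex : ∀ p q, ∃ y, p ≠ q → B p q = wedge (c.unitNormal (edgeAt v p) v) y := by
    intro p q
    by_cases h : p = q
    · exact ⟨0, fun h' => absurd h h'⟩
    · obtain ⟨y, hy⟩ := c.exists_biv_eq_wedge (edgeAt v p) (faceAt v p q h) v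
      refine ⟨((w.eps (edgeAt v p) (faceAt v p q h) v : ℤ) : ℝ) • y, fun _ => ?_⟩
      rw [hBne h, bivPair, hy, units_smul_eq, wedge_smul_right]
  choose W hW using hex
  obtain ⟨p₀, -⟩ := exists_ordering v
  have hlt : (3 : Fin 5) ≠ 4 := by decide
  obtain ⟨p, hp, -, -⟩ := o.exists_positive (p₀.injective.ne hlt)
  obtain ⟨ε, E, U, hE, hU, h0, hBE, hUN⟩ := exists_edgeFamily (B := B) (W := W)
    (N := fun p => c.unitNormal (edgeAt v p) v) p hW
    (fun p q => by
      by_cases h : p = q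
      · subst h; simp [hB]
      · rw [hBne h, hBne (Ne.symm h), hc.bivPair_symm])
    (fun p => by rw [hB, sum_bivPair]; exact hc.exterior _ v (edgeAt_subset _ _))
    (fun p => c.unitNormal_ne_zero _ _)
    (fun e => by
      have h01 : e 0 ≠ e 1 := e.injective.ne (by decide)
      have h23 : e 2 ≠ e 3 := e.injective.ne (by decide)
      rw [hBne h01, hBne h23, bivPair, bivPair, units_smul_eq, units_smul_eq, wedge4_smul_left,
        wedge4_smul_right]
      refine mul_ne_zero (by exact_mod_cast Units.ne_zero _)
        (mul_ne_zero (by exact_mod_cast Units.ne_zero _) ?_)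
      refine hnd v _ _ _ _ (faceAt_subset _ _ _ _) (edgeAt_subset _ _) (faceAt_subset _ _ _ _)
        (edgeAt_subset _ _) ?_
      -- The two triangles together contain all five vertices, too many for a tetrahedron.
      rintro ⟨t, ht, ht'⟩
      have hsub : v.verts ⊆ t.verts := by
        intro x hx
        obtain ⟨i, hi⟩ := e.surjective ⟨x, hx⟩
        have hxi : x = e i := congrArg Subtype.val hi.symm
        rw [hxi]
        by_cases h : i ≠ 0 ∧ i ≠ 1
        · exact ht ((mem_faceAt h01).2 ⟨e.injective.ne h.1, e.injective.ne h.2⟩)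
        · refine ht' ((mem_faceAt h23).2 ⟨e.injective.ne ?_, e.injective.ne ?_⟩) <;>
            · rintro rfl; revert h; decide
      have := Finset.card_le_card hsub
      rw [v.card_verts, t.card_verts] at this
      omega)
  have h0' : ∀ q, simplexVol E q ≠ 0 :=
    fun q => hE.simplexVol_ne_zero (span_eq_top_of_simplexVol_ne_zero h0) q
  refine ⟨ε, E, U, hE, hU, h0', fun q hq x y hxy => ?_, hUN⟩
  rw [← hBne hxy, hBE, simplexVol_eq_of_sgn_eq hE (hp.trans hq.symm)]

end Triangulation.Config

/-! ### Areas of triangles -/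

/-- By the law of cosines Heron's expression is a quarter of the Gram determinant of two sides. -/
theorem triangleArea_len (x y z : Vec) (h : x + y + z = 0) :
    Triangulation.triangleArea (len x) (len y) (len z) = (1 / 2) * bivNorm (wedge x y) := by
  have hz : len z ^ 2 = len x ^ 2 + 2 * (x ⬝ᵥ y) + len y ^ 2 := by
    have : z = -(x + y) := by rw [eq_neg_iff_add_eq_zero, add_comm, h]
    rw [len_sq, len_sq, len_sq, this, neg_dotProduct_neg, add_dotProduct, dotProduct_add,
      dotProduct_add, dotProduct_comm y x]
    ring
  have h2 : (len x + len y + len z) / 2 * ((len x + len y + len z) / 2 - len x) *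
      ((len x + len y + len z) / 2 - len y) * ((len x + len y + len z) / 2 - len z) =
      (1 / 2) ^ 2 * ((x ⬝ᵥ x) * (y ⬝ᵥ y) - (x ⬝ᵥ y) ^ 2) := by
    rw [← len_sq x, ← len_sq y]
    have hxy : x ⬝ᵥ y = (len z ^ 2 - len x ^ 2 - len y ^ 2) / 2 := by rw [hz]; ring
    rw [hxy]; ring
  rw [Triangulation.triangleArea, h2, Real.sqrt_mul (by norm_num), Real.sqrt_sq (by norm_num),
    bivNorm_wedge]

theorem triangleArea_mul {t : ℝ} (a b c : ℝ) :
    Triangulation.triangleArea (t * a) (t * b) (t * c) =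
      t ^ 2 * Triangulation.triangleArea a b c := by
  rw [Triangulation.triangleArea, Triangulation.triangleArea]
  conv_rhs => rw [← Real.sqrt_sq (sq_nonneg t), ← Real.sqrt_mul (sq_nonneg _)]
  congr 1
  ring

theorem quat_units_smul (s : ℤˣ) (x : Vec) : quat (((s : ℤ) : ℝ) • x) = s • quat x := by
  rw [quat_eq, quat_eq]
  rcases Int.units_eq_one_or s with rfl | rfl
  · simp
  · ext i j
    fin_cases i <;> fin_cases j <;> (simp <;> ring)

theorem exists_inv_len_smul {k : ℝ} (hk : k ≠ 0) {x : Vec} (hx : x ⬝ᵥ x = 1) :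
    ∃ s : ℤˣ, x = ((s : ℤ) : ℝ) • ((len (k • x))⁻¹ • (k • x)) := by
  have hl : len x = 1 := by rw [len, hx, Real.sqrt_one]
  rw [len_smul, hl, mul_one, smul_smul]
  rcases lt_or_gt_of_ne hk with h | h
  · refine ⟨-1, ?_⟩
    rw [abs_of_neg h, smul_smul]
    have : (((-1 : ℤˣ) : ℤ) : ℝ) * ((-k)⁻¹ * k) = 1 := by
      push_cast; field_simp
    rw [this, one_smul]
  · refine ⟨1, ?_⟩
    rw [abs_of_pos h, inv_mul_cancel₀ hk]
    simp

namespace Triangulation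

variable {P : Type*} [DecidableEq P] {Δ : Triangulation P} {E : Δ.EdgeVectors} {U : Δ.NormalVectors}

/-! ### The discrete metric of a co-tetrad -/

theorem IsCotetrad.exists_length (hE : IsCotetrad E) :
    ∃ l : P → P → ℝ, ∀ (v : Δ.Vert) (p q : v.verts), l p q = len (E v p q) := by
  classical
  have hwd : ∀ p q : P, ∃ L : ℝ, ∀ (v : Δ.Vert) (hp : p ∈ v.verts) (hq : q ∈ v.verts),
      L = len (E v ⟨p, hp⟩ ⟨q, hq⟩) := by
    intro p q
    by_cases hex : ∃ v : Δ.Vert, p ∈ v.verts ∧ q ∈ v.verts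
    · obtain ⟨v₀, hp₀, hq₀⟩ := hex
      refine ⟨len (E v₀ ⟨p, hp₀⟩ ⟨q, hq₀⟩), fun v hp hq => ?_⟩
      have hsub : ∀ {s : Finset P}, p ∈ s → q ∈ s → ({p, q} : Finset P) ⊆ s := fun h h' =>
        Finset.insert_subset h (Finset.singleton_subset_iff.2 h')
      -- Any two 4-simplices containing p and q are joined through tetrahedra containing both, along
      -- which the length is preserved.
      refine vert_induction (C := fun v => ∀ (hp : p ∈ v.verts) (hq : q ∈ v.verts),
        len (E v₀ ⟨p, hp₀⟩ ⟨q, hq₀⟩) = len (E v ⟨p, hp⟩ ⟨q, hq⟩)) (hsub hp₀ hq₀)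
        (fun _ _ => rfl) ?_ (hsub hp hq) hp hq
      intro v v' e _ h h' hρ ih hp hq
      have hpe : p ∈ e.verts := hρ (by simp)
      have hqe : q ∈ e.verts := hρ (by simp)
      rw [ih (h hpe) (h hqe), len, len]
      congr 1
      exact (hE.metric v v' e h h' ⟨p, hpe⟩ ⟨q, hqe⟩ ⟨p, hpe⟩ ⟨q, hqe⟩).symm
    · exact ⟨0, fun v hp hq => absurd ⟨v, hp, hq⟩ hex⟩
  choose l hl using hwd
  exact ⟨l, fun v p q => hl p q v p.2 q.2⟩

theorem isDiscreteMetric_mul (hE : IsCotetrad E) (hU : IsTetrad E U) {l : P → P → ℝ}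
    (hl : ∀ (v : Δ.Vert) (p q : v.verts), l p q = len (E v p q)) {t : ℝ} (ht : 0 < t) :
    IsDiscreteMetric Δ fun p q => t * l p q := by
  intro v
  obtain ⟨o, -⟩ := exists_ordering v
  refine ⟨fun p => t • E v p (o 0), ?_, fun p q => ?_⟩
  -- Pairing an affine relation with the normal opposite to p isolates the weight of p.
  · rw [affineIndependent_iff]
    intro s w hw hs p hp
    have h1 := congrArg (U v p ⬝ᵥ ·) hs
    simp only [dotProduct_sum, dotProduct_smul, dotProduct_zero, hU v p, smul_eq_mul] at h1
    have h2 : ∀ q : v.verts, w q * (t * ((if q = p then (1 : ℝ) else 0) - if o 0 = p then 1 else 0))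
        = t * (if q = p then w q else 0) - t * (if o 0 = p then 1 else 0) * w q := by
      intro q; split_ifs <;> ring
    rw [Finset.sum_congr rfl fun q _ => h2 q, Finset.sum_sub_distrib, ← Finset.mul_sum,
      ← Finset.mul_sum, hw, mul_zero, sub_zero, Finset.sum_ite_eq' s p w, if_pos hp] at h1
    exact (mul_eq_zero.1 h1).resolve_left ht.ne'
  · dsimp only
    rw [hl v p q, ← smul_sub, ← (hE.isEdgeFamily v).eq_sub, len_smul, abs_of_pos ht]

theorem exists_ordering_faceAt {f : Δ.Face} {p q r : P} (hf : f.verts = {p, q, r}) :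
    ∃ (v : Δ.Vert) (e : Δ.Ordering v), (e 0 : P) = p ∧ (e 1 : P) = q ∧ (e 2 : P) = r ∧
      f = faceAt v (e 3) (e 4) (e.injective.ne (by decide)) := by
  obtain ⟨v, hv⟩ := exists_vert_cell f
  have hcard : ({p, q, r} : Finset P).card = 3 := by rw [← hf]; exact f.card_verts
  have hne : p ≠ q ∧ p ≠ r ∧ q ≠ r := by
    refine ⟨?_, ?_, ?_⟩ <;> rintro rfl <;> revert hcard
    · have := Finset.card_le_two (a := p) (b := r)
      simp; omega
    · have := Finset.card_le_two (a := q) (b := p)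
      rw [Finset.insert_comm, Finset.pair_eq_singleton]; omega
    · have := Finset.card_le_two (a := p) (b := q)
      rw [Finset.pair_eq_singleton]; omega
  have hp : p ∈ f.verts := by simp [hf]
  have hq : q ∈ f.verts := by simp [hf]
  have hr : r ∈ f.verts := by simp [hf]
  obtain ⟨e₀, -⟩ := exists_ordering v
  obtain ⟨e, h0, h1, h2⟩ := exists_ordering_three e₀ (i := 0) (j := 1) (l := 2) (by decide)
    (by decide) (by decide) (p := ⟨p, hv hp⟩) (q := ⟨q, hv hq⟩) (r := ⟨r, hv hr⟩)
    (fun h => hne.1 (Subtype.mk.inj h)) (fun h => hne.2.1 (Subtype.mk.inj h))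
    (fun h => hne.2.2 (Subtype.mk.inj h))
  have h0' : (e 0 : P) = p := by rw [h0]
  have h1' : (e 1 : P) = q := by rw [h1]
  have h2' : (e 2 : P) = r := by rw [h2]
  have h34 : e 3 ≠ e 4 := e.injective.ne (by decide)
  refine ⟨v, e, h0', h1', h2', Cell.eq_of_subset ?_⟩
  rw [hf, ← h0', ← h1', ← h2']
  intro x hx
  simp only [Finset.mem_insert, Finset.mem_singleton] at hx
  rcases hx with rfl | rfl | rfl <;>
    exact (mem_faceAt h34).2 ⟨e.injective.ne (by decide), e.injective.ne (by decide)⟩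

theorem isAreaOf_half (hE : IsCotetrad E) {l : P → P → ℝ}
    (hl : ∀ (v : Δ.Vert) (p q : v.verts), l p q = len (E v p q)) {j : Δ.Face → ℝ}
    (hj : ∀ (v : Δ.Vert) (p : Δ.Ordering v), j (faceAt v (p 3) (p 4) (p.injective.ne (by decide)))
      = bivNorm (wedge (E v (p 0) (p 1)) (E v (p 1) (p 2)))) :
    IsAreaOf (fun f => (1 / 2) * j f) l := by
  intro f p q r hf
  obtain ⟨v, e, rfl, rfl, rfl, rfl⟩ := exists_ordering_faceAt hf
  dsimp only
  rw [hl, hl, hl, hj, triangleArea_len _ _ _ ((hE.isEdgeFamily v).closure _ _ _)]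

theorem isReggeLike (hE : IsCotetrad E) (hU : IsTetrad E U) {l : P → P → ℝ}
    (hl : ∀ (v : Δ.Vert) (p q : v.verts), l p q = len (E v p q)) {j : Δ.Face → ℝ}
    (hj : IsAreaOf (fun f => (1 / 2) * j f) l) {κ : ℝ} (hκ : 0 < κ) : IsReggeLike κ j := by
  -- Areas scale quadratically, so this factor turns j/2 into κ j.
  have ht : 0 < Real.sqrt (2 * κ) := Real.sqrt_pos.2 (by linarith)
  refine ⟨fun p q => Real.sqrt (2 * κ) * l p q, isDiscreteMetric_mul hE hU hl ht, ?_⟩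
  intro f p q r hf
  have h1 := hj f p q r hf
  dsimp only at h1 ⊢
  rw [triangleArea_mul, ← h1, Real.sq_sqrt (by linarith)]
  ring

/-! ### From local simplices to a global co-tetrad -/

namespace Config

variable {c : Δ.Config} {o : Δ.Orientation} {w : Δ.FaceOrientation} {ε : ℤˣ}

/-- Every non-degenerate solution comes from a co-tetrad. -/
theorem IsSolution.exists_cotetrad (o : Δ.Orientation) (hc : c.IsSolution w)
    (hnd : c.Nondegenerate) :
    ∃ (ε : ℤˣ) (E : Δ.EdgeVectors) (U : Δ.NormalVectors), IsCotetrad E ∧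
      CotetradNondegenerate E ∧ IsTetrad E U ∧ c.BivFromCotetrad o w ε E ∧
      c.BivFromTetrad o w ε E U ∧
      ∀ v p, ∃ k : ℝ, k ≠ 0 ∧ U v p = k • c.unitNormal (edgeAt v p) v := by
  choose ε E U hE hU h0 hB hN using hc.exists_local (o := o) hnd
  have hC : ∀ v, c.BivFromCotetradAt o w (ε v) v (E v) := fun v =>
    (bivFromTetradAt_iff (hE v) (h0 v) (hU v)).2 (hB v)
  obtain ⟨v₀, -⟩ := Δ.exists_vert
  -- Neighbours have equal signs; chains with ρ = ∅ reach every 4-simplex.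
  have hε : ∀ v, ε v = ε v₀ := fun v =>
    vert_induction (C := fun v => ε v = ε v₀) (Finset.empty_subset v₀.verts) rfl
      (fun v v' e hne h h' _ ih =>
        (neighbour_rigid hne h h' (hE v) (h0 v) (hC v) (hE v') (hC v')).1.trans ih)
      (Finset.empty_subset v.verts)
  refine ⟨ε v₀, E, U, ⟨fun v => (hE v).antisymm, fun v => (hE v).closure, ?_⟩, fun v => ?_,
    fun v => hU v, fun v => hε v ▸ hC v, fun v => hε v ▸ hB v, hN⟩
  · intro v v' e h h' p q r s
    by_cases hne : v = v'
    · subst hne; rfl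
    · obtain ⟨-, s, hs⟩ := neighbour_rigid hne h h' (hE v) (h0 v) (hC v) (hE v') (hC v')
      rw [hs, hs]
      rcases Int.units_eq_one_or s with rfl | rfl
      · rw [one_smul, one_smul, SO4.mulVec_dot]
      · rw [Units.neg_smul, Units.neg_smul, one_smul, one_smul, neg_dotProduct_neg, SO4.mulVec_dot]
  · obtain ⟨p, -⟩ := exists_ordering v
    exact span_eq_top_of_simplexVol_ne_zero (h0 v p)

/-- One direction is rigidity of each simplex. Conversely, independent inversions are harmless
because the bivectors and the metric are quadratic in the edge vectors of one simplex. -/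
theorem cotetrad_unique_iff (hE : IsCotetrad E) (h0 : ∀ v p, vol4 E v p ≠ 0)
    (h : c.BivFromCotetrad o w ε E) (ε' : ℤˣ) (E' : Δ.EdgeVectors) :
    (IsCotetrad E' ∧ c.BivFromCotetrad o w ε' E') ↔
      (ε' = ε ∧ ∃ s : Δ.Vert → ℤˣ, ∀ v p q, E' v p q = s v • E v p q) := by
  constructor
  · rintro ⟨hE', h'⟩
    have hu := fun v => BivFromCotetradAt.unique (hE.isEdgeFamily v) (h0 v) (h v)
      (hE'.isEdgeFamily v) (h' v)
    obtain ⟨v₀, -⟩ := Δ.exists_vert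
    choose s hs using fun v => (hu v).2
    exact ⟨(hu v₀).1, s, hs⟩
  · rintro ⟨rfl, s, hs⟩
    obtain rfl : E' = fun v p q => s v • E v p q := by
      funext v p q; exact hs v p q
    refine ⟨⟨fun v p q => ?_, fun v p q r => ?_, fun v v' e k k' p q r t => ?_⟩, fun v p hp => ?_⟩
    · rw [hE.antisymm, smul_neg]
    · rw [← smul_add, ← smul_add, hE.closure, smul_zero]
    · have key : ∀ (s : ℤˣ) (x y : Vec), (s • x) ⬝ᵥ (s • y) = x ⬝ᵥ y := by
        intro s x y
        rcases Int.units_eq_one_or s with rfl | rfl <;> simp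
      rw [key, key]
      exact hE.metric _ _ _ _ _ _ _ _ _
    · rw [h v p hp]
      dsimp only
      rcases Int.units_eq_one_or (s v) with h1 | h1 <;> rw [h1]
      · simp
      · simp [wedge_neg_left, wedge_neg_right]

theorem transport_inv (c : Δ.Config) (e : Δ.Edge) (v v' : Δ.Vert) :
    (c.transport e v' v)⁻¹ = c.transport e v v' := by
  simp [transport]

/-- The connection of a solution agrees with the spin connection up to signs. -/
theorem exists_connection_sign (hE : IsCotetrad E) (h0 : ∀ v p, vol4 E v p ≠ 0)
    (h : c.BivFromCotetrad o w ε E) {Ω : Δ.Vert → Δ.Vert → SO4} (hΩ : IsSpinConnection E Ω)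
    (e : Δ.Edge) : ∃ s : ℤˣ, ∀ v v' : Δ.Vert, e.verts ⊆ v.verts → e.verts ⊆ v'.verts → v ≠ v' →
      (c.transport e v' v : Matrix (Fin 4) (Fin 4) ℝ)
        = s • (Ω v' v : Matrix (Fin 4) (Fin 4) ℝ) := by
  obtain ⟨a, b, hab, ha, hb, hex⟩ := exists_two_verts e
  obtain ⟨-, s, hs⟩ := neighbour_rigid hab ha hb (hE.isEdgeFamily a) (h0 a) (h a)
    (hE.isEdgeFamily b) (h b)
  -- The transport corrected by the sign s maps the edges as the spin connection does, and such a
  -- rotation is unique.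
  obtain ⟨k, hk⟩ := SO4.exists_units_smul s (c.transport e b a)
  have hkΩ : k = Ω b a := hΩ.eq_of_edges (h0 a) ha hb hab fun p q => by
    rw [hs, hk]
    rcases Int.units_eq_one_or s with rfl | rfl <;> simp [Matrix.neg_mulVec]
  have h1 : (c.transport e b a : Matrix (Fin 4) (Fin 4) ℝ)
      = s • (Ω b a : Matrix (Fin 4) (Fin 4) ℝ) := by
    rw [← hkΩ, hk, smul_smul, Int.units_mul_self, one_smul]
  have h2 : (c.transport e a b : Matrix (Fin 4) (Fin 4) ℝ)
      = s • (Ω a b : Matrix (Fin 4) (Fin 4) ℝ) := by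
    rw [← transport_inv, SO4.coe_inv, h1, Matrix.transpose_smul, ← SO4.coe_inv,
      hΩ.inv_eq h0 ha hb hab]
  refine ⟨s, fun v v' hv hv' hne => ?_⟩
  rcases hex v hv with rfl | rfl <;> rcases hex v' hv' with rfl | rfl
  · exact absurd rfl hne
  · exact h1
  · exact h2
  · exact absurd rfl hne

theorem bivNorm_units_smul (s : ℤˣ) (X : Biv) : bivNorm (s • X) = bivNorm X := by
  rcases Int.units_eq_one_or s with rfl | rfl <;> simp [bivNorm_neg]

theorem biv_eq_eps_smul_bivPair (v : Δ.Vert) (p q : v.verts) (h : p ≠ q) :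
    c.biv (edgeAt v p) (faceAt v p q h) v =
      w.eps (edgeAt v p) (faceAt v p q h) v • c.bivPair w v p q h := by
  rw [bivPair, smul_smul, Int.units_mul_self, one_smul]

theorem isDeterminedBy_of_bivFromTetrad (hE : IsCotetrad E)
    (h : c.BivFromCotetrad o w ε E) (hT : c.BivFromTetrad o w ε E U)
    (hN : ∀ v p, ∃ k : ℝ, k ≠ 0 ∧ U v p = k • c.unitNormal (edgeAt v p) v)
    {Ω : Δ.Vert → Δ.Vert → SO4} {sgn : Δ.Edge → ℤˣ}
    (hsgn : ∀ (e : Δ.Edge) (v v' : Δ.Vert), e.verts ⊆ v.verts → e.verts ⊆ v'.verts → v ≠ v' →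
      (c.transport e v' v : Matrix (Fin 4) (Fin 4) ℝ)
        = sgn e • (Ω v' v : Matrix (Fin 4) (Fin 4) ℝ)) :
    c.IsDeterminedBy o w ε sgn E U Ω := by
  refine ⟨fun v p => ?_, hsgn, fun v p => ?_, fun v p hp q r hqr heps => ?_⟩
  · rw [← c.bivNorm_biv (edgeAt v (p 3)) _ v, biv_eq_eps_smul_bivPair (w := w), bivNorm_units_smul,
      BivFromCotetradAt.ordering (hE.isEdgeFamily v) (h v) p, bivNorm_units_smul,
      bivNorm_hodge (transpose_wedge _ _), (hE.isEdgeFamily v).wedge_eq]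
  · obtain ⟨k, hk, hU⟩ := hN v p
    have hgU : (c.g (edgeAt v p) v : Matrix (Fin 4) (Fin 4) ℝ) *ᵥ U v p =
        k • unitVec (c.u (edgeAt v p) : Matrix (Fin 2) (Fin 2) ℂ) := by
      rw [hU, Matrix.mulVec_smul, unitNormal, SO4.mulVec_inv]
    obtain ⟨s, hs⟩ := exists_inv_len_smul hk (SU2.unitVec_dot_self (c.u (edgeAt v p)))
    refine ⟨s, ?_⟩
    rw [← SO4.len_mulVec (c.g (edgeAt v p) v) (U v p), hgU, ← quat_units_smul, ← hs,
      SU2.quat_unitVec]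
  · refine ⟨_, (pauliVec_pauliCoord_conjSigma _).symm, ?_⟩
    have h1 : plusPart (c.bivEdge (edgeAt v q) (faceAt v q r hqr)) =
        c.j (faceAt v q r hqr) • pauliCoord (conjSigma (c.n (edgeAt v q) (faceAt v q r hqr))) := by
      rw [bivEdge, plusPart_ofParts]
    have h2 : c.bivEdge (edgeAt v q) (faceAt v q r hqr) =
        act (c.g (edgeAt v q) v) (c.bivPair w v q r hqr) := by
      rw [bivPair, heps, one_smul, biv, act_act_inv]
    rw [← h1, h2, hT v p hp, act_units_smul, act_smul, units_smul_eq, plusPart_smul, plusPart_smul,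
      units_smul_eq]

end Config

end Triangulation

namespace Triangulation

variable {P : Type*} [DecidableEq P] {Δ : Triangulation P} {E : Δ.EdgeVectors} {U : Δ.NormalVectors}

theorem faceAt_eq {v : Δ.Vert} {p q p' q' : v.verts} {h : p ≠ q} {h' : p' ≠ q'}
    (heq : faceAt v p q h = faceAt v p' q' h') : (p = p' ∧ q = q') ∨ (p = q' ∧ q = p') := by
  have key : ∀ r : v.verts, (r ≠ p ∧ r ≠ q) ↔ (r ≠ p' ∧ r ≠ q') := fun r => by
    rw [← mem_faceAt h, ← mem_faceAt h', heq]
  have hp := key p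
  have hq := key q
  simp only [ne_eq, not_true_eq_false, false_and, and_false, false_iff, not_and_or, not_not] at hp hq
  rcases hp with hp | hp <;> rcases hq with hq | hq
  · exact absurd (hp.trans hq.symm) h
  · exact Or.inl ⟨hp, hq⟩
  · exact Or.inr ⟨hp, hq⟩
  · exact absurd (hp.trans hq.symm) h

theorem faceAt_right_injective {v : Δ.Vert} {p q q' : v.verts} {h : p ≠ q} {h' : p ≠ q'}
    (heq : faceAt v p q h = faceAt v p q' h') : q = q' := by
  rcases faceAt_eq heq with h1 | h1
  · exact h1.2
  · exact absurd h1.1 h'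

theorem eq_faceAt {f : Δ.Face} {v : Δ.Vert} {p q : v.verts} (h : p ≠ q)
    (hp : f.verts ⊆ (edgeAt v p).verts) (hq : f.verts ⊆ (edgeAt v q).verts) :
    f = faceAt v p q h := by
  refine Cell.eq_of_subset fun x hx => ?_
  have hxv := edgeAt_subset v p (hp hx)
  exact (mem_faceAt (r := ⟨x, hxv⟩) h).2 ⟨mem_edgeAt.1 (hp hx), mem_edgeAt.1 (hq hx)⟩

/-! ### Areas are independent of the 4-simplex -/

theorem bivNorm_triangle (hE : IsCotetrad E) (h0 : ∀ v p, vol4 E v p ≠ 0) (hU : IsTetrad E U)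
    {v : Δ.Vert} (p : Δ.Ordering v) : bivNorm (wedge (E v (p 0) (p 1)) (E v (p 1) (p 2))) =
      |vol4 E v p| * bivNorm (wedge (U v (p 3)) (U v (p 4))) := by
  rw [← bivNorm_hodge (transpose_wedge _ _), (hU.isDual v).hodge_wedge (hE.isEdgeFamily v) (h0 v p),
    bivNorm_smul]
  rfl

/-- Within one 4-simplex the area is |V₄| times the norm of U ∧ U', which depends only on the pair
of normals. Between neighbours around the triangle the relevant scalar products agree. -/
theorem exists_area (hE : IsCotetrad E) (h0 : ∀ v p, vol4 E v p ≠ 0) (hU : IsTetrad E U)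
    (f : Δ.Face) : ∃ L : ℝ, 0 ≤ L ∧ ∀ (v : Δ.Vert) (p : Δ.Ordering v),
      faceAt v (p 3) (p 4) (p.injective.ne (by decide)) = f →
      bivNorm (wedge (E v (p 0) (p 1)) (E v (p 1) (p 2))) = L := by
  obtain ⟨v₀, hv₀⟩ := exists_vert_cell f
  obtain ⟨q, r, hqr, hf⟩ := exists_edge_between hv₀
  obtain ⟨p₀, -⟩ := exists_ordering v₀
  obtain ⟨p₀, rfl, rfl⟩ := exists_ordering_two p₀ (i := 3) (j := 4) (by decide) hqr
  refine ⟨_, bivNorm_nonneg (wedge (E v₀ (p₀ 0) (p₀ 1)) (E v₀ (p₀ 1) (p₀ 2))), fun v p hp => ?_⟩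
  have hfv : f.verts ⊆ v.verts := by
    rw [← hp]; exact (faceAt_subset _ _ _ _).trans (edgeAt_subset _ _)
  refine vert_induction (C := fun v => ∀ p : Δ.Ordering v,
    faceAt v (p 3) (p 4) (p.injective.ne (by decide)) = f →
      bivNorm (wedge (E v (p 0) (p 1)) (E v (p 1) (p 2))) =
      bivNorm (wedge (E v₀ (p₀ 0) (p₀ 1)) (E v₀ (p₀ 1) (p₀ 2)))) hv₀ ?_ ?_ hfv p hp
  · intro p hp
    rw [bivNorm_triangle hE h0 hU, bivNorm_triangle hE h0 hU, vol4_eq, vol4_eq,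
      (hE.isEdgeFamily v₀).abs_simplexVol p p₀]
    rcases faceAt_eq (hp.trans hf) with ⟨h3, h4⟩ | ⟨h3, h4⟩
    · rw [h3, h4]
    · rw [h3, h4, wedge_swap, bivNorm_neg]
  · intro v v' e _ h h' hρ ih p' hp'
    have hp34 : p' 3 ≠ p' 4 := p'.injective.ne (by decide)
    -- The tetrahedron shared with the neighbour contains the triangle, so the vertex it omits sits
    -- in slot 3 or 4.
    obtain ⟨q, hq⟩ := exists_eq_edgeAt h'
    have hqf : ¬ (q ≠ p' 3 ∧ q ≠ p' 4) := fun hq2 => by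
      have h1 : (q : P) ∈ f.verts := by rw [← hp']; exact (mem_faceAt hp34).2 hq2
      have h2 := hρ h1
      rw [hq] at h2
      exact mem_edgeAt.1 h2 rfl
    obtain ⟨k, hk, rfl⟩ : ∃ k : Fin 5, (k = 3 ∨ k = 4) ∧ q = p' k := by
      rw [not_and_or, not_not, not_not] at hqf
      rcases hqf with h | h
      · exact ⟨3, Or.inl rfl, h⟩
      · exact ⟨4, Or.inr rfl, h⟩
    obtain ⟨p, -, hpp⟩ := exists_neighbour_ordering p' k (v' := v) (hq ▸ h)
    have hlow : ∀ i : Fin 5, i ≠ 3 → i ≠ 4 → i ≠ k := by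
      rintro i h3 h4 rfl
      rcases hk with hk | hk
      · exact h3 hk
      · exact h4 hk
    have hface : faceAt v (p 3) (p 4) (p.injective.ne (by decide)) = f := by
      symm
      refine Cell.eq_of_subset fun x hx => ?_
      have hxv' : x ∈ v'.verts := h' (hρ hx)
      obtain ⟨i, hi⟩ := p'.surjective ⟨x, hxv'⟩
      have hxi : x = p' i := congrArg Subtype.val hi.symm
      have hx2 := hx
      rw [← hp', hxi] at hx2
      have hi34 := (mem_faceAt hp34).1 hx2
      have h3 : i ≠ 3 := fun h => hi34.1 (congrArg p' h)
      have h4 : i ≠ 4 := fun h => hi34.2 (congrArg p' h)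
      rw [hxi, hpp i (hlow i h3 h4)]
      exact (mem_faceAt (p.injective.ne (by decide))).2 ⟨p.injective.ne h3, p.injective.ne h4⟩
    rw [← ih p hface]
    subst hq
    have hdot : ∀ i j a b : Fin 5, i ≠ k → j ≠ k → a ≠ k → b ≠ k →
        E v' (p' i) (p' j) ⬝ᵥ E v' (p' a) (p' b) = E v (p i) (p j) ⬝ᵥ E v (p a) (p b) := by
      intro i j a b hi hj ha hb
      obtain ⟨x, hx, hx'⟩ := exists_incl_ordering h hpp hi
      obtain ⟨y, hy, hy'⟩ := exists_incl_ordering h hpp hj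
      obtain ⟨z, hz, hz'⟩ := exists_incl_ordering h hpp ha
      obtain ⟨t, ht, ht'⟩ := exists_incl_ordering h hpp hb
      rw [← hx, ← hx', ← hy, ← hy', ← hz, ← hz', ← ht, ← ht']
      exact hE.metric _ _ _ _ _ _ _ _ _
    have k0 := hlow 0 (by decide) (by decide)
    have k1 := hlow 1 (by decide) (by decide)
    have k2 := hlow 2 (by decide) (by decide)
    rw [bivNorm_wedge, bivNorm_wedge, hdot 0 1 0 1 k0 k1 k0 k1, hdot 1 2 1 2 k1 k2 k1 k2,
      hdot 0 1 1 2 k0 k1 k1 k2]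

/-- The normals of a tetrahedron in neighbouring 4-simplices are parallel. -/
theorem normal_transport (hE : IsCotetrad E) (h0 : ∀ v p, vol4 E v p ≠ 0) (hU : IsTetrad E U)
    {Ω : Δ.Vert → Δ.Vert → SO4} (hΩ : IsSpinConnection E Ω) {v v' : Δ.Vert} (hne : v ≠ v')
    {q : v.verts} {q' : v'.verts} (he : edgeAt v' q' = edgeAt v q) :
    ∃ k : ℝ, k ≠ 0 ∧ U v' q' = k • ((Ω v' v : Matrix (Fin 4) (Fin 4) ℝ) *ᵥ U v q) := by
  obtain ⟨p, -⟩ := exists_ordering v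
  obtain ⟨p, rfl⟩ := exists_ordering_one p 0 q
  have h' : (edgeAt v (p 0)).verts ⊆ v'.verts := he ▸ edgeAt_subset v' q'
  obtain ⟨p', he', hpp⟩ := exists_neighbour_ordering p 0 h'
  obtain rfl : p' 0 = q' := edgeAt_injective v' (he'.trans he.symm)
  -- The transported normal is orthogonal to the transported edges, which are the edges of the
  -- tetrahedron in v'.
  have hy : (Ω v' v : Matrix (Fin 4) (Fin 4) ℝ) *ᵥ U v (p 0) =
      -(((Ω v' v : Matrix (Fin 4) (Fin 4) ℝ) *ᵥ U v (p 0)) ⬝ᵥ E v' (p' 1) (p' 0)) • U v' (p' 0) := by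
    refine (hU.isDual v').eq_smul_of_orthogonal (hE.isEdgeFamily v') (h0 v' p') fun i j hi hj => ?_
    obtain ⟨x, hx, hx'⟩ := exists_incl_ordering h' hpp hi
    obtain ⟨y, hy, hy'⟩ := exists_incl_ordering h' hpp hj
    rw [← hx', ← hy', ← hΩ v v' _ (edgeAt_subset _ _) h' hne, SO4.mulVec_dot, hx, hy]
    exact (hU.isDual v).dot_other (p.injective.ne hi) (p.injective.ne hj)
  set k := -(((Ω v' v : Matrix (Fin 4) (Fin 4) ℝ) *ᵥ U v (p 0)) ⬝ᵥ E v' (p' 1) (p' 0)) with hk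
  have hk0 : k ≠ 0 := by
    intro h
    rw [h, zero_smul] at hy
    have h1 := SO4.inv_mulVec (Ω v' v) (U v (p 0))
    rw [hy, Matrix.mulVec_zero] at h1
    exact (hU.isDual v).ne_zero (p.injective.ne (show (0 : Fin 5) ≠ 1 by decide)) h1.symm
  exact ⟨k⁻¹, inv_ne_zero hk0, by rw [hy, smul_smul, inv_mul_cancel₀ hk0, one_smul]⟩

namespace Config

variable {c : Δ.Config} {o : Δ.Orientation} {w : Δ.FaceOrientation} {ε : ℤˣ}

/-! ### Construction of the variables -/

theorem exists_connection (h0 : ∀ v p, vol4 E v p ≠ 0) {Ω : Δ.Vert → Δ.Vert → SO4}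
    (hΩ : IsSpinConnection E Ω) (s : ℤˣ) (e : Δ.Edge) :
    ∃ g : Δ.Vert → SO4, ∀ v v' : Δ.Vert, e.verts ⊆ v.verts → e.verts ⊆ v'.verts → v ≠ v' →
      (((g v')⁻¹ * g v : SO4) : Matrix (Fin 4) (Fin 4) ℝ)
        = s • (Ω v' v : Matrix (Fin 4) (Fin 4) ℝ) := by
  classical
  obtain ⟨a, b, hab, ha, hb, hex⟩ := exists_two_verts e
  obtain ⟨k, hk⟩ := SO4.exists_units_smul s (Ω b a)
  -- Only the combination across e is prescribed, so the frame at e can be taken to be the frame at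
  -- a.
  refine ⟨fun v => if v = a then 1 else k⁻¹, fun v v' hv hv' hne => ?_⟩
  rcases hex v hv with rfl | rfl <;> rcases hex v' hv' with rfl | rfl
  · exact absurd rfl hne
  · simp only [if_neg hab.symm, if_true, inv_inv, mul_one, hk]
  · simp only [if_neg hab.symm, if_true, inv_one, one_mul]
    rw [SO4.coe_inv, hk, Matrix.transpose_smul, ← SO4.coe_inv, hΩ.inv_eq h0 ha hb hab]
  · exact absurd rfl hne

/-- u is defined from one 4-simplex at e. The transported normal of the other is parallel to it, so
normalizing changes it at most by a sign. -/
theorem exists_normal (hE : IsCotetrad E) (h0 : ∀ v p, vol4 E v p ≠ 0) (hU : IsTetrad E U)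
    {Ω : Δ.Vert → Δ.Vert → SO4} (hΩ : IsSpinConnection E Ω) {s : ℤˣ} {e : Δ.Edge}
    {g : Δ.Vert → SO4} (hg : ∀ v v' : Δ.Vert, e.verts ⊆ v.verts → e.verts ⊆ v'.verts → v ≠ v' →
      (((g v')⁻¹ * g v : SO4) : Matrix (Fin 4) (Fin 4) ℝ)
        = s • (Ω v' v : Matrix (Fin 4) (Fin 4) ℝ)) :
    ∃ u : SU2, ∀ (v : Δ.Vert) (p : v.verts), edgeAt v p = e → ∃ t : ℤˣ,
      (u : Matrix (Fin 2) (Fin 2) ℂ) = t • quat ((len (U v p))⁻¹ •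
          ((g v : Matrix (Fin 4) (Fin 4) ℝ) *ᵥ U v p)) := by
  obtain ⟨a, ha⟩ := exists_vert_cell e
  obtain ⟨q, rfl⟩ := exists_eq_edgeAt ha
  have hUne : ∀ (v : Δ.Vert) (p : v.verts), U v p ≠ 0 := by
    intro v p
    obtain ⟨r, -⟩ := exists_ordering v
    obtain ⟨r, rfl⟩ := exists_ordering_one r 0 p
    exact (hU.isDual v).ne_zero (r.injective.ne (show (0 : Fin 5) ≠ 1 by decide))
  set y := (g a : Matrix (Fin 4) (Fin 4) ℝ) *ᵥ U a q with hy
  have hly : len y = len (U a q) := SO4.len_mulVec _ _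
  have hly0 : 0 < len y := hly ▸ len_pos (hUne a q)
  have hx : ((len y)⁻¹ • y) ⬝ᵥ ((len y)⁻¹ • y) = 1 := by
    rw [smul_dotProduct, dotProduct_smul, ← len_sq, smul_eq_mul, smul_eq_mul]
    field_simp
  refine ⟨SU2.ofVec _ hx, fun v p hp => ?_⟩
  have hpar : ∃ k : ℝ, k ≠ 0 ∧
      (g v : Matrix (Fin 4) (Fin 4) ℝ) *ᵥ U v p = k • ((len y)⁻¹ • y) := by
    by_cases hav : a = v
    · subst hav
      obtain rfl := edgeAt_injective a hp
      exact ⟨len y, hly0.ne', by rw [smul_smul, mul_inv_cancel₀ hly0.ne', one_smul]⟩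
    · obtain ⟨k, hk, hkU⟩ := normal_transport hE h0 hU hΩ hav hp
      have h1 := hg a v ha (hp ▸ edgeAt_subset v p) hav
      have h2 : ((s : ℤ) : ℝ) • ((Ω v a : Matrix (Fin 4) (Fin 4) ℝ) *ᵥ U a q) =
          (((g v)⁻¹ : SO4) : Matrix (Fin 4) (Fin 4) ℝ) *ᵥ y := by
        rw [hy, Matrix.mulVec_mulVec, ← Submonoid.coe_mul, h1, units_smul_eq, Matrix.smul_mulVec]
      have hs : ((s : ℤ) : ℝ) * ((s : ℤ) : ℝ) = 1 := by
        rcases Int.units_eq_one_or s with rfl | rfl <;> simp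
      have h3 : (Ω v a : Matrix (Fin 4) (Fin 4) ℝ) *ᵥ U a q =
          ((s : ℤ) : ℝ) • ((((g v)⁻¹ : SO4) : Matrix (Fin 4) (Fin 4) ℝ) *ᵥ y) := by
        rw [← h2, smul_smul, hs, one_smul]
      refine ⟨k * (s : ℤ) * len y, mul_ne_zero (mul_ne_zero hk (left_ne_zero_of_mul_eq_one hs))
        hly0.ne', ?_⟩
      rw [hkU, h3, Matrix.mulVec_smul, Matrix.mulVec_smul, SO4.mulVec_inv, smul_smul, smul_smul,
        mul_assoc, mul_inv_cancel₀ hly0.ne', mul_one]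
  obtain ⟨k, hk, hkx⟩ := hpar
  obtain ⟨t, ht⟩ := exists_inv_len_smul hk hx
  refine ⟨t, ?_⟩
  rw [← SO4.len_mulVec (g v) (U v p), hkx, ← quat_units_smul, ← ht]
  rfl

theorem wedge_normals_ne_zero (hU : IsTetrad E U) {v : Δ.Vert} {q r : v.verts} (h : q ≠ r) :
    wedge (U v q) (U v r) ≠ 0 := by
  obtain ⟨p, -⟩ := exists_ordering v
  obtain ⟨p, rfl, rfl⟩ := exists_ordering_two p (i := 0) (j := 1) (by decide) h
  exact det4_ne_zero_wedge ((hU.isDual v).det4_ne_zero p)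

/-- The required vector has norm j f, because the self-dual part of a simple bivector has the norm
of the bivector; hence it can be normalized and realized by an element of SU(2). -/
theorem exists_direction (hE : IsCotetrad E) (h0 : ∀ v p, vol4 E v p ≠ 0) (hU : IsTetrad E U)
    {j : Δ.Face → ℝ} (hj : ∀ (v : Δ.Vert) (p : Δ.Ordering v),
      j (faceAt v (p 3) (p 4) (p.injective.ne (by decide))) =
        bivNorm (wedge (E v (p 0) (p 1)) (E v (p 1) (p 2)))) (g : Δ.Edge → Δ.Vert → SO4)
    (e : Δ.Edge) (f : Δ.Face) : ∃ n : SU2, ∀ (v : Δ.Vert) (p : Δ.Ordering v), o.sgn v p = 1 →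
      ∀ (q r : v.verts) (h : q ≠ r), edgeAt v q = e → faceAt v q r h = f → w.eps e f v = 1 →
      ∃ N : Fin 3 → ℝ, conjSigma n = pauliVec N ∧
        j f • N = ε • (vol4 E v p • plusPart (act (g e v) (wedge (U v q) (U v r)))) := by
  by_cases hex : ∃ (v : Δ.Vert) (q r : v.verts) (h : q ≠ r), edgeAt v q = e ∧ faceAt v q r h = f ∧
      w.eps e f v = 1
  · obtain ⟨v, q, r, hqr, he, hf, heps⟩ := hex
    obtain ⟨p, hp, rfl, rfl⟩ := o.exists_positive hqr
    set X := ((ε : ℤ) : ℝ) • (vol4 E v p • plusPart (act (g e v) (wedge (U v (p 3)) (U v (p 4))))) with hX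
    have hjf : j f = |vol4 E v p| * bivNorm (wedge (U v (p 3)) (U v (p 4))) := by
      rw [← hf, ← bivNorm_triangle hE h0 hU, ← hj]
    have hj0 : 0 < j f := by
      rw [hjf]
      refine mul_pos (abs_pos.2 (h0 v p)) (lt_of_le_of_ne (bivNorm_nonneg _) fun h => ?_)
      exact wedge_normals_ne_zero hU hqr (bivNorm_eq_zero h.symm)
    have hXX : X ⬝ᵥ X = j f ^ 2 := by
      have hε : ((ε : ℤ) : ℝ) * ((ε : ℤ) : ℝ) = 1 := by
        rcases Int.units_eq_one_or ε with rfl | rfl <;> simp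
      rw [hX, smul_dotProduct, dotProduct_smul, smul_dotProduct, dotProduct_smul, act_wedge,
        plusPart_wedge_dot_self, ← act_wedge, bivNorm_act, hjf, mul_pow, sq_abs]
      simp only [smul_eq_mul]
      linear_combination (vol4 E v p ^ 2 * bivNorm (wedge (U v (p 3)) (U v (p 4))) ^ 2) * hε
    obtain ⟨n, hn⟩ := exists_conjSigma_eq (N := (j f)⁻¹ • X) (by
      rw [smul_dotProduct, dotProduct_smul, hXX, smul_eq_mul, smul_eq_mul]
      field_simp)
    refine ⟨n, fun v' p' hp' q' r' hqr' he' hf' heps' => ⟨_, hn, ?_⟩⟩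
    have hfe : f.verts ⊆ e.verts := by rw [← he, ← hf]; exact faceAt_subset _ _ _ _
    -- The incidence sign differs at the two ends of e, so only one 4-simplex imposes a condition.
    obtain rfl : v = v' := by
      by_contra hne
      have := w.flip_vert f e v v' hfe (he ▸ edgeAt_subset _ _) (he' ▸ edgeAt_subset _ _) hne
      rw [heps, heps'] at this
      exact absurd this (by decide)
    obtain rfl : p 3 = q' := edgeAt_injective v (he.trans he'.symm)
    obtain rfl : p 4 = r' := faceAt_right_injective (hf.trans hf'.symm)
    rw [smul_smul, mul_inv_cancel₀ hj0.ne', one_smul, units_smul_eq, vol4_eq E v p',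
      simplexVol_eq_of_sgn_eq (hE.isEdgeFamily v) (hp'.trans hp.symm)]
    rfl
  · exact ⟨1, fun v p _ q r h he hf heps => absurd ⟨v, q, r, h, he, hf, heps⟩ hex⟩

/-- Every choice of signs is realized by variables determined by the co-tetrad. -/
theorem exists_isDeterminedBy (o : Δ.Orientation) (w : Δ.FaceOrientation) (hE : IsCotetrad E)
    (h0 : ∀ v p, vol4 E v p ≠ 0) (hU : IsTetrad E U)
    {Ω : Δ.Vert → Δ.Vert → SO4} (hΩ : IsSpinConnection E Ω) (ε : ℤˣ) (sgn : Δ.Edge → ℤˣ) :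
    ∃ c : Δ.Config, c.IsDeterminedBy o w ε sgn E U Ω := by
  choose j hj0 hj using exists_area hE h0 hU
  choose g hg using fun e => exists_connection h0 hΩ (sgn e) e
  choose u hu using fun e => exists_normal hE h0 hU hΩ (hg e)
  choose n hn using exists_direction (o := o) (w := w) (ε := ε) hE h0 hU (j := j)
    (fun v p => (hj _ v p rfl).symm) g
  exact ⟨⟨j, hj0, n, u, g, fun _ _ => 1⟩, fun v p => (hj _ v p rfl).symm, hg,
    fun v p => hu _ v p rfl, fun v p hp q r h heps => hn _ _ v p hp q r h rfl rfl heps⟩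

/-! ### The variables determined by a co-tetrad form a solution -/

/-- The formula for u puts Û along U, and the formula for n fixes the self-dual part; a simple
bivector containing a given unit vector is determined by these data. -/
theorem biv_of_eps_eq_one {Ω : Δ.Vert → Δ.Vert → SO4} {sgn : Δ.Edge → ℤˣ}
    (hU : IsTetrad E U) (hc : c.IsDeterminedBy o w ε sgn E U Ω) {v : Δ.Vert} {p : Δ.Ordering v}
    (hp : o.sgn v p = 1) {q r : v.verts} (h : q ≠ r)
    (heps : w.eps (edgeAt v q) (faceAt v q r h) v = 1) :
    c.biv (edgeAt v q) (faceAt v q r h) v = ε • (vol4 E v p • wedge (U v q) (U v r)) := by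
  obtain ⟨N, hN, hjN⟩ := hc.direction v p hp q r h heps
  obtain ⟨s, hs⟩ := hc.normal v q
  set e := edgeAt v q
  set f := faceAt v q r h
  set a := unitVec (c.u e : Matrix (Fin 2) (Fin 2) ℂ) with ha
  have hl : 0 < len (U v q) := len_pos ((hU.isDual v).ne_zero h)
  have ha' : a = ((s : ℤ) : ℝ) • ((len (U v q))⁻¹ •
      ((c.g e v : Matrix (Fin 4) (Fin 4) ℝ) *ᵥ U v q)) := by
    rw [ha, hs, ← quat_units_smul, unitVec_quat]
  have hss : ((s : ℤ) : ℝ) * ((s : ℤ) : ℝ) = 1 := by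
    rcases Int.units_eq_one_or s with rfl | rfl <;> simp
  have hgU : (c.g e v : Matrix (Fin 4) (Fin 4) ℝ) *ᵥ U v q = (((s : ℤ) : ℝ) * len (U v q)) • a := by
    rw [ha', smul_smul, smul_smul]
    have : ((s : ℤ) : ℝ) * len (U v q) * ((s : ℤ) : ℝ) * (len (U v q))⁻¹ = 1 := by
      field_simp; linarith
    rw [this, one_smul]
  set X := ε • (vol4 E v p • wedge (U v q) (U v r)) with hX
  have hXw : act (c.g e v) X = wedge a ((((ε : ℤ) : ℝ) * vol4 E v p * (((s : ℤ) : ℝ) * len (U v q))) •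
      ((c.g e v : Matrix (Fin 4) (Fin 4) ℝ) *ᵥ U v r)) := by
    rw [hX, act_units_smul, act_smul, act_wedge, hgU, wedge_smul_left, wedge_smul_right,
      units_smul_eq, smul_smul, smul_smul, mul_assoc]
  have hplus : plusPart (act (c.g e v) X) = c.j f • pauliCoord (conjSigma (c.n e f)) := by
    rw [hN, pauliCoord_pauliVec, hjN, hX, act_units_smul, act_smul, units_smul_eq, plusPart_smul,
      plusPart_smul, units_smul_eq]
  have hbiv : c.bivEdge e f = act (c.g e v) X := by
    rw [bivEdge_eq, ← hplus, hXw]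
    exact (wedge_eq_ofParts (SU2.unitVec_dot_self _) _).symm
  rw [biv, hbiv, act_inv_act]

/-- Where the incidence sign is -1 the formula for n says nothing directly. At the other end of the
edge the sign is 1, and the result is transported back by ±Ω in its edge-vector form. -/
theorem IsDeterminedBy.bivFromTetrad {Ω : Δ.Vert → Δ.Vert → SO4} {sgn : Δ.Edge → ℤˣ}
    (hE : IsCotetrad E) (h0 : ∀ v p, vol4 E v p ≠ 0) (hU : IsTetrad E U)
    (hΩ : IsSpinConnection E Ω) (hc : c.IsDeterminedBy o w ε sgn E U Ω) :
    c.BivFromTetrad o w ε E U := by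
  intro v p₀ hp₀ q r h
  obtain ⟨p, hp, rfl, rfl⟩ := o.exists_positive h
  have hvol : vol4 E v p₀ = vol4 E v p :=
    simplexVol_eq_of_sgn_eq (hE.isEdgeFamily v) (hp₀.trans hp.symm)
  rw [hvol]
  rcases Int.units_eq_one_or (w.eps (edgeAt v (p 3)) (faceAt v (p 3) (p 4) h) v) with heps | heps
  · rw [bivPair, biv_of_eps_eq_one hU hc hp h heps, heps, one_smul]
  · obtain ⟨v', hne, h'⟩ := exists_neighbour (edgeAt_subset v (p 3))
    obtain ⟨p', he', hpp⟩ := exists_neighbour_ordering p 3 h'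
    have hsgn' := o.sgn_neighbour hne hpp
    have h34 : (3 : Fin 5) ≠ 4 := by decide
    have hb := bivPair_neighbour (c := c) (w := w) hne he' h34 hpp
    have hf : faceAt v' (p' 3) (p' 4) (p'.injective.ne h34) = faceAt v (p 3) (p 4) h := by
      apply Cell.ext
      have h1 : (faceAt v' (p' 3) (p' 4) (p'.injective.ne h34)).verts =
        (edgeAt v' (p' 3)).verts.erase (p' 4) := rfl
      rw [h1, he', ← hpp 4 (by decide)]; rfl
    have heps' : w.eps (edgeAt v' (p' 3)) (faceAt v' (p' 3) (p' 4) (p'.injective.ne h34)) v' = 1 := by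
      rw [he', hf, w.flip_vert _ _ v v' (faceAt_subset _ _ _ _) (edgeAt_subset _ _) h' hne, heps,
        neg_neg]
    -- The ordering induced on the neighbour is negative, so two slots are exchanged; the resulting
    -- sign of V₄ cancels the one from the reversed half-edge.
    set π := Equiv.swap (0 : Fin 5) 1
    have hπ : o.sgn v' (π.trans p') = 1 := by
      rw [o.sgn_swap p' (by decide), hsgn', hp, neg_neg]
    have hvol' : vol4 E v' (π.trans p') = - vol4 E v' p' := by
      rw [vol4_eq, vol4_eq, (hE.isEdgeFamily v').simplexVol_trans, Equiv.Perm.sign_swap (by decide)]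
      simp
    rw [bivPair, heps', one_smul, biv_of_eps_eq_one hU hc hπ _ heps', hvol', neg_smul,
      vol4_eq, ← (hU.isDual v').hodge_wedge (hE.isEdgeFamily v') (h0 v' p'),
      act_eq_of_coe_eq_units_smul (hc.connection _ v v' (edgeAt_subset _ _) h' hne)] at hb
    obtain ⟨x, hx, hx'⟩ := exists_incl_ordering h' hpp (show (0 : Fin 5) ≠ 3 by decide)
    obtain ⟨y, hy, hy'⟩ := exists_incl_ordering h' hpp (show (1 : Fin 5) ≠ 3 by decide)
    obtain ⟨z, hz, hz'⟩ := exists_incl_ordering h' hpp (show (2 : Fin 5) ≠ 3 by decide)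
    rw [← hx', ← hy', ← hz', ← hΩ v v' _ (edgeAt_subset _ _) h' hne,
      ← hΩ v v' _ (edgeAt_subset _ _) h' hne, ← act_wedge, hodge_act_wedge, hx, hy, hz, smul_neg,
      neg_inj, ← act_units_smul, (hU.isDual v).hodge_wedge (hE.isEdgeFamily v) (h0 v p)] at hb
    rw [← act_inv_act (Ω v' v) (c.bivPair w v (p 3) (p 4) h), ← hb, act_inv_act]
    rfl

/-- The reference bivector depends on the face alone, so h_e'f h_fe carries X_ef to X_e'f for any
two edges of f. -/
theorem exists_holonomy (c : Δ.Config) : ∃ h : Δ.Edge → Δ.Face → SO4, ∀ e f,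
    act (h e f) (ofParts (c.j f • ![0, 0, 1]) (-(c.j f • ![0, 0, 1]))) = c.bivEdge e f := by
  choose h hh using fun e f => exists_act_ofParts_conjSigma (c.n e f) (c.u e * c.n e f)
  exact ⟨h, fun e f => hh e f _⟩

theorem interior_of_bivFromTetrad (hB : c.BivFromTetrad o w ε E U) {e e' : Δ.Edge} {f : Δ.Face}
    {v : Δ.Vert} (hf : f.verts ⊆ e.verts) (hf' : f.verts ⊆ e'.verts) (he : e.verts ⊆ v.verts)
    (he' : e'.verts ⊆ v.verts) : c.biv e f v = c.biv e' f v := by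
  by_cases hne : e = e'
  · rw [hne]
  · obtain ⟨p, rfl⟩ := exists_eq_edgeAt he
    obtain ⟨q, rfl⟩ := exists_eq_edgeAt he'
    have hpq : p ≠ q := fun h => hne (by rw [h])
    obtain rfl := eq_faceAt hpq hf hf'
    have hw := w.flip_edge _ _ _ v hf hf' he he' hne
    obtain ⟨r, hr, -, -⟩ := o.exists_positive hpq
    have h1 := hB v r hr p q hpq
    have h2 := hB v r hr q p hpq.symm
    rw [bivPair] at h1 h2
    rw [faceAt_symm v p q hpq, hw, wedge_swap, smul_neg, smul_neg, ← h1, Units.neg_smul, neg_inj,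
      smul_left_cancel_iff] at h2
    exact h2.symm

/-- The wedge holonomy passes from X_ef to X_e'f through the reference bivector, then to the vertex,
where both agree by interior closure. Exterior closure is U_e ∧ ∑ U_e' = 0. -/
theorem isSolution_of_bivFromTetrad (h0 : ∀ v p, vol4 E v p ≠ 0)
    (hU : IsTetrad E U) (hB : c.BivFromTetrad o w ε E U)
    (hh : ∀ e f, act (c.h e f) (ofParts (c.j f • ![0, 0, 1]) (-(c.j f • ![0, 0, 1]))) =
      c.bivEdge e f) : c.IsSolution w := by
  refine ⟨?_, fun e f v v' _ _ _ _ => c.biv_eq_act_transport e f v v',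
    fun e v v' _ _ _ => c.unitNormal_eq_transport e v v',
    fun e e' f v hf hf' he he' => interior_of_bivFromTetrad hB hf hf' he he', ?_⟩
  · intro e e' f v hf hf' he he' _ _
    have h1 : act (c.g e v) (c.biv e f v) = c.bivEdge e f := by rw [biv, act_act_inv]
    have h2 : act (c.h e f)⁻¹ (c.bivEdge e f) =
        ofParts (c.j f • ![0, 0, 1]) (-(c.j f • ![0, 0, 1])) := by rw [← hh, act_inv_act]
    rw [wedgeHol, act_mul, h1, act_mul, act_mul, act_mul, h2, hh, act_mul]
    have h3 : act (c.g e' v)⁻¹ (c.bivEdge e' f) = c.biv e f v :=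
      (interior_of_bivFromTetrad hB hf hf' he he').symm
    rw [h3, act_inv_act]
  · intro e v he
    obtain ⟨p, rfl⟩ := exists_eq_edgeAt he
    rw [← sum_bivPair]
    obtain ⟨r, -⟩ := exists_ordering v
    obtain ⟨r, hr, -, -⟩ := o.exists_positive (r.injective.ne (show (0 : Fin 5) ≠ 1 by decide))
    have key : ∀ q : v.verts, (if h : p ≠ q then c.bivPair w v p q h else 0) =
        ((ε : ℤ) : ℝ) • (vol4 E v r • wedge (U v p) (U v q)) := by
      intro q
      by_cases h : p = q
      · subst h; simp [wedge_self]
      · rw [dif_pos h, hB v r hr, units_smul_eq]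
    rw [Finset.sum_congr rfl fun q _ => key q, ← Finset.smul_sum, ← Finset.smul_sum,
      ← wedge_sum_right, (hU.isDual v).sum_eq_zero (h0 v r), wedge_zero_right, smul_zero, smul_zero]

theorem nondegenerate_of_bivFromTetrad (h0 : ∀ v p, vol4 E v p ≠ 0)
    (hU : IsTetrad E U) (hB : c.BivFromTetrad o w ε E U) : c.Nondegenerate := by
  intro v e e' f f' hf he hf' he' hnot
  obtain ⟨p, rfl⟩ := exists_eq_edgeAt he
  obtain ⟨q, hpq, rfl⟩ := exists_eq_faceAt hf
  obtain ⟨p', rfl⟩ := exists_eq_edgeAt he'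
  obtain ⟨q', hpq', rfl⟩ := exists_eq_faceAt hf'
  have h2 := faceAt_subset_right v p q hpq
  have h2' := faceAt_subset_right v p' q' hpq'
  -- Faces without a common edge are opposite to disjoint pairs of vertices, so four independent
  -- normals enter the wedge product.
  have n1 : p ≠ p' := by rintro rfl; exact hnot ⟨_, hf, hf'⟩
  have n2 : p ≠ q' := by rintro rfl; exact hnot ⟨_, hf, h2'⟩
  have n3 : q ≠ p' := by rintro rfl; exact hnot ⟨_, h2, hf'⟩
  have n4 : q ≠ q' := by rintro rfl; exact hnot ⟨_, h2, h2'⟩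
  obtain ⟨r₀, -⟩ := exists_ordering v
  obtain ⟨r, rfl, rfl, rfl, rfl⟩ := exists_ordering_four r₀ (i := 0) (j := 1) (l := 2) (m := 3)
    (by decide) (by decide) (by decide) (by decide) (by decide) (by decide) hpq n1 n3 n2 n4 hpq'
  obtain ⟨s, hs, -, -⟩ := o.exists_positive hpq
  rw [biv_eq_eps_smul_bivPair (w := w), biv_eq_eps_smul_bivPair (w := w), hB v s hs, hB v s hs]
  simp only [units_smul_eq, wedge4_smul_left, wedge4_smul_right, wedge4_wedge]
  have hu : ∀ t : ℤˣ, ((t : ℤ) : ℝ) ≠ 0 := fun t => by exact_mod_cast t.ne_zero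
  have hv := h0 v s
  rw [vol4_eq] at hv
  have hd := (hU.isDual v).det4_ne_zero r
  simp [hv, hd, vol4_eq]

end Config

end Triangulation

end SpinFoam

end

/-! ### Assembly of the three parts of the proposition -/

open SpinFoam SpinFoam.Triangulation in
theorem mainTheorem1 {P : Type*} [DecidableEq P] (Δ : Triangulation P)
    (o : Δ.Orientation) (w : Δ.FaceOrientation) :
    -- every non-degenerate solution comes from a co-tetrad
    (∀ c : Δ.Config, c.IsSolution w → c.Nondegenerate →
      ∃ (ε : ℤˣ) (E : Δ.EdgeVectors) (U : Δ.NormalVectors) (Ω : Δ.Vert → Δ.Vert → SO4)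
        (sgn : Δ.Edge → ℤˣ),
        IsCotetrad E ∧ CotetradNondegenerate E ∧ IsTetrad E U ∧ IsSpinConnection E Ω ∧
        c.BivFromCotetrad o w ε E ∧ c.BivFromTetrad o w ε E U ∧
        -- uniqueness up to inversions in the 4-simplices
        (∀ (ε' : ℤˣ) (E' : Δ.EdgeVectors),
          (IsCotetrad E' ∧ c.BivFromCotetrad o w ε' E') ↔
            (ε' = ε ∧ ∃ s : Δ.Vert → ℤˣ, ∀ v p q, E' v p q = s v • E v p q)) ∧
        -- the variables are determined by the co-tetrad
        c.IsDeterminedBy o w ε sgn E U Ω ∧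
        (∀ (e : Δ.Edge) (f : Δ.Face) (v : Δ.Vert), f.verts ⊆ e.verts → e.verts ⊆ v.verts →
          c.j f = bivNorm (hodge (c.biv e f v))) ∧
        (∀ (e : Δ.Edge) (f : Δ.Face) (m : SU2), f.verts ⊆ e.verts →
          (conjSigma m = conjSigma (c.n e f) ↔
            ∃ φ : ℝ, (m : Matrix (Fin 2) (Fin 2) ℂ) = (c.n e f : Matrix (Fin 2) (Fin 2) ℂ) * phase φ)) ∧
        -- the spins are Regge-like, with the metric induced by the co-tetrad
        (∃ l : P → P → ℝ, IsDiscreteMetric Δ l ∧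
          (∀ (v : Δ.Vert) (p q : v.verts), l p q = len (E v p q)) ∧
          IsAreaOf (fun f => (1 / 2) * c.j f) l) ∧
        (∀ κ : ℝ, 0 < κ → IsReggeLike κ c.j)) ∧
    -- the two expressions of the bivectors are equivalent
    (∀ (c : Δ.Config) (ε : ℤˣ) (E : Δ.EdgeVectors) (U : Δ.NormalVectors),
      IsCotetrad E → CotetradNondegenerate E → IsTetrad E U →
      (c.BivFromCotetrad o w ε E ↔ c.BivFromTetrad o w ε E U)) ∧
    -- conversely, every non-degenerate co-tetrad gives rise to solutions
    (∀ E : Δ.EdgeVectors, IsCotetrad E → CotetradNondegenerate E →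
      (∃! U : Δ.NormalVectors, IsTetrad E U) ∧
      (∃ Ω : Δ.Vert → Δ.Vert → SO4, IsSpinConnection E Ω ∧
        ∀ Ω' : Δ.Vert → Δ.Vert → SO4, IsSpinConnection E Ω' →
          ∀ (e : Δ.Edge) (v v' : Δ.Vert), e.verts ⊆ v.verts → e.verts ⊆ v'.verts → v ≠ v' →
            Ω' v' v = Ω v' v) ∧
      ∀ (U : Δ.NormalVectors) (Ω : Δ.Vert → Δ.Vert → SO4), IsTetrad E U → IsSpinConnection E Ω →
        ∀ (ε : ℤˣ) (sgn : Δ.Edge → ℤˣ),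
          (∃ c : Δ.Config, c.IsDeterminedBy o w ε sgn E U Ω) ∧
          ∀ c : Δ.Config, c.IsDeterminedBy o w ε sgn E U Ω →
            ∃ h : Δ.Edge → Δ.Face → SO4,
              ({ c with h := h } : Δ.Config).IsSolution w ∧
              ({ c with h := h } : Δ.Config).Nondegenerate ∧
              ({ c with h := h } : Δ.Config).BivFromCotetrad o w ε E ∧
              ({ c with h := h } : Δ.Config).BivFromTetrad o w ε E U) := by
  refine ⟨fun c hc hnd => ?_, fun c ε E U hE hnd hU => ?_, fun E hE hnd => ?_⟩
  · obtain ⟨ε, E, U, hE, hndE, hU, hC, hT, hN⟩ := Config.IsSolution.exists_cotetrad o hc hnd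
    have h0 : ∀ v p, vol4 E v p ≠ 0 := fun v p => hE.vol4_ne_zero hndE v p
    obtain ⟨Ω, hΩ⟩ := exists_spinConnection hE h0
    choose sgn hsgn using Config.exists_connection_sign hE h0 hC hΩ
    have hdet := Config.isDeterminedBy_of_bivFromTetrad hE hC hT hN hsgn
    obtain ⟨l, hl⟩ := hE.exists_length
    have harea := isAreaOf_half hE hl hdet.spin
    have hmetric := isDiscreteMetric_mul hE hU hl one_pos
    simp only [one_mul] at hmetric
    exact ⟨ε, E, U, Ω, sgn, hE, hndE, hU, hΩ, hC, hT, Config.cotetrad_unique_iff hE h0 hC, hdet,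
      fun e f v _ _ => (c.bivNorm_hodge_biv e f v).symm, fun e f m _ => conjSigma_eq_iff m _,
      ⟨l, hmetric, hl, harea⟩, fun κ hκ => isReggeLike hE hU hl harea hκ⟩
  · exact forall_congr' fun v => Config.bivFromTetradAt_iff (hE.isEdgeFamily v)
      (fun p => hE.vol4_ne_zero hnd v p) (hU.isDual v)
  · have h0 : ∀ v p, vol4 E v p ≠ 0 := fun v p => hE.vol4_ne_zero hnd v p
    refine ⟨?_, ?_, fun U Ω hU hΩ ε sgn => ⟨Config.exists_isDeterminedBy o w hE h0 hU hΩ ε sgn,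
      fun c hc => ?_⟩⟩
    · choose p _ using fun v => exists_ordering (Δ := Δ) v
      choose U hU using fun v => (hE.isEdgeFamily v).exists_dual (h0 v (p v))
      exact ⟨U, hU, fun U' hU' => funext fun v => IsDual.unique (h0 v (p v)) (hU v) (hU' v)⟩
    · obtain ⟨Ω, hΩ⟩ := exists_spinConnection hE h0
      exact ⟨Ω, hΩ, fun Ω' hΩ' e v v' h h' hne =>
        hΩ.eq_of_edges (h0 v) h h' hne (hΩ' v v' e h h' hne)⟩
    · obtain ⟨h, hh⟩ := Config.exists_holonomy c
      have hB₀ : c.BivFromTetrad o w ε E U := hc.bivFromTetrad hE h0 hU hΩ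
      -- The bivectors do not involve h, so the formula carries over definitionally.
      have hB : ({ c with h := h } : Δ.Config).BivFromTetrad o w ε E U := hB₀
      exact ⟨h, Config.isSolution_of_bivFromTetrad h0 hU hB hh,
        Config.nondegenerate_of_bivFromTetrad h0 hU hB,
        fun v => (Config.bivFromTetradAt_iff (hE.isEdgeFamily v) (h0 v) (hU.isDual v)).2 (hB v), hB⟩
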